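/- **Setting.** Let $\mathcal V=K_0(\mathrm{Var}_{\mathbb C})\otimes_{\mathbb Z[\mathbb L]}\mathbb Q(\mathbb L^{1/2})$, where $K_0(\mathrm{Var}_{\mathbb C})$ is the Grothendieck ring of complex algebraic varieties and $\mathbb L=[\mathbb A^1]$; write $q=\mathbb L$. Let $\Gamma$ be a lattice of rank $2$ with a skew-symmetric bilinear form $\langle\cdot,\cdot\rangle:\Gamma\times\Gamma\to\mathbb Z$ and a basis $(e_1,e_2)$ such that $\langle e_1,e_2\rangle>0$. Put $\Gamma_+=\mathbb N e_1+\mathbb N e_2$ and $\Gamma_+^*=\Gamma_+\setminus\{0\}$. For a map $m:\Gamma_+^*\to\mathbb N$ with finite support put $\|m\|=\sum_\alpha m(\alpha)\alpha\in\Gamma_+$ and $m!=\prod_\alpha m(\alpha)!$. A ray is a set $l=\mathbb R_{>0}\gamma\subset\Gamma\otimes\mathbb R$ with $\gamma\in\Gamma_+^*$; rays are ordered by their slope in the first quadrant, so that the ray of $e_1$ is the smallest and that of $e_2$ the largest. The quantum torus of a commutative monoid $M$ with a skew-symmetric biadditive form $\langle\cdot,\cdot\rangle$ consists of the formal series $\sum_{\alpha\in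 M}c_\alpha x^\alpha$, $c_\alpha\in\mathcal V$, with the multiplication $x^\alpha\circ x^\beta=q^{\frac12\langle\alpha,\beta\rangle}x^{\alpha+\beta}$. We use it for $M=\Gamma_+$ (the quantum torus of $\Gamma$), and for the monoid $M$ of maps $m:\Gamma_+^*\to\mathbb N$ with finite support, regarded as dimension vectors of the following quiver $\hat Q$: its set of vertices is $\Gamma_+^*$, and there are $\max(\langle\beta,\alpha\rangle,0)$ arrows from $\alpha$ to $\beta$. The form in the latter case is $\langle m,m'\rangle=r(m',m)-r(m,m')$, where $r(m,m')=\sum_{a:\alpha\to\beta}m(\alpha)m'(\beta)$, the sum being over the arrows of $\hat Q$. **Abelian quiver invariants.** Let $Z:\Gamma\to\mathbb C$ be a homomorphism with $Z(e_i)=-d_i+\sqrt{-1}\,r_i\in\{re^{i\pi\varphi}:r>0,\ 0<\varphi\le1\}$ for $i=1,2$. For $\alpha\in\Gamma_+^*$ with $Z(\alpha)=-d+\sqrt{-1}\,r$ put $\mu_Z(\alpha)=d/r\in\mathbb R\cup\{\infty\}$. Assume that $\mu_Z(e_1)<\mu_Z(e_2)$. For $m$ as above let $\hat Q(m)$ be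 the finite quiver with the vertices $\alpha_k$, $\alpha\in\Gamma_+^*$, $1\le k\le m(\alpha)$, with as many arrows from $\alpha_k$ to $\beta_{k'}$ as there are from $\alpha$ to $\beta$ in $\hat Q$, and with the stability function $Z(\alpha_k)=Z(\alpha)$. Let $R_Z(\hat Q(m))$ be the open subvariety of semistable points in the affine space of the representations of $\hat Q(m)$ which have dimension $1$ at every vertex (a representation $M$ is semistable if $\mu_Z(\underline{\dim}\,N)\le\mu_Z(\underline{\dim}\,M)$ for every nonzero subrepresentation $N$). Put $$f_+(m)=q^{\frac12(v-a)}\frac{[R_Z(\hat Q(m))]}{(q-1)^{v}}\in\mathcal V,$$ where $v$ and $a$ are the numbers of vertices and arrows of $\hat Q(m)$. The abelian quiver invariants $g(m)\in\mathcal V$, $m\ne0$, are defined by the equations, one for every ray $l$, in the quantum torus of $\hat Q$, $$1+\sum_{\|m\|\in l}f_+(m)\frac{x^m}{m!}=\exp\Bigg(\sum_{\|m\|\in l}\frac{g(m)}{q^{1/2}-q^{-1/2}}\frac{x^m}{m!}\Bigg).$$ **Theorem.** Let $(\bar b_\gamma)_{\gamma\in\Gamma_+^*}$ and $(\bar a_\gamma)_{\gamma\in\Gamma_+^*}$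 be two families of elements of $\mathcal V$. Then the Kontsevich–Soibelman wall-crossing formula $$\prod_l^{\curvearrowright}\exp\left(\frac{\sum_{\gamma\in l}\bar b_\gamma x^\gamma}{q^{1/2}-q^{-1/2}}\right)=\prod_l^{\curvearrowleft}\exp\left(\frac{\sum_{\gamma\in l}\bar a_\gamma x^\gamma}{q^{1/2}-q^{-1/2}}\right)$$ holds in the quantum torus of $\Gamma$ (the products are over all rays $l$; on the left in clockwise order, that is, of decreasing slope from left to right, and on the right in anticlockwise order, that is, of increasing slope) if and only if the modified Manschot–Pioline–Sen formula $$\bar b_\gamma=\sum_{\|m\|=\gamma}\frac{g(m)}{m!}\prod_{\alpha\in\Gamma_+^*}\bar a_\alpha^{\,m(\alpha)}$$ holds for all $\gamma\in\Gamma_+^*$, where the sum is over the maps $m:\Gamma_+^*\to\mathbb N$ with finite support and $\|m\|=\gamma$. -/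

import Mathlib

open CategoryTheory AlgebraicGeometry Polynomial
open scoped TensorProduct

/-! ### Motivic classes -/

/-- A complex algebraic variety: a reduced separated scheme of finite type over `ℂ`. -/
structure CVariety : Type 1 where
  X : Scheme.{0}
  str : X ⟶ Spec (CommRingCat.of ℂ)
  isReduced : IsReduced X
  isSeparated : IsSeparated str
  locallyOfFiniteType : LocallyOfFiniteType str
  quasiCompact : QuasiCompact str

/-- The relations of the Grothendieck ring of varieties. -/
inductive K0Rel : MvPolynomial CVariety ℤ → Prop
  /-- Isomorphic varieties have the same class. -/
  | iso (X Y : CVariety) (f : X.X ⟶ Y.X) (hf : IsIso f) (hstr : f ≫ Y.str = X.str) :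
      K0Rel (MvPolynomial.X X - MvPolynomial.X Y)
  /-- `[X] = [Z] + [U]` for a closed subvariety `Z` of `X` with open complement `U`. -/
  | scissor (X Z U : CVariety) (i : Z.X ⟶ X.X) (j : U.X ⟶ X.X)
      (hi : IsClosedImmersion i) (hj : IsOpenImmersion j)
      (histr : i ≫ X.str = Z.str) (hjstr : j ≫ X.str = U.str)
      (hcompl : Set.range j = (Set.range i)ᶜ) :
      K0Rel (MvPolynomial.X X - (MvPolynomial.X Z + MvPolynomial.X U))
  /-- `[X × Y] = [X] [Y]`. -/
  | prod (P X Y : CVariety) (p : P.X ⟶ X.X) (r : P.X ⟶ Y.X)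
      (h : IsPullback p r X.str Y.str) (hstr : p ≫ X.str = P.str) :
      K0Rel (MvPolynomial.X P - MvPolynomial.X X * MvPolynomial.X Y)
  /-- The class of the point is `1`. -/
  | point (X : CVariety) (h : IsIso X.str) : K0Rel (MvPolynomial.X X - 1)

/-- The Grothendieck ring `K₀(Var_ℂ)`, as the commutative ring generated by the classes of
varieties. (The last two families of relations say that the product of classes is induced by the
product of varieties, with unit the class of the point.) -/
def K0Var : Type 1 := MvPolynomial CVariety ℤ ⧸ Ideal.span {p | K0Rel p}

noncomputable instance : CommRing K0Var :=
  inferInstanceAs (CommRing (MvPolynomial CVariety ℤ ⧸ Ideal.span {p | K0Rel p}))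

/-- The class `[X]` of a variety. -/
noncomputable def K0Var.cls (X : CVariety) : K0Var :=
  Ideal.Quotient.mk (Ideal.span {p | K0Rel p}) (MvPolynomial.X X)

/-- Affine space over `ℂ` with coordinates indexed by `A`. -/
noncomputable abbrev affSch (A : Type) : Scheme.{0} :=
  Spec (CommRingCat.of (MvPolynomial A ℂ))

/-- The structure morphism of affine space. -/
noncomputable abbrev affStr (A : Type) : affSch A ⟶ Spec (CommRingCat.of ℂ) :=
  Spec.map (CommRingCat.ofHom (algebraMap ℂ (MvPolynomial A ℂ)))

instance affStr_locallyOfFiniteType (A : Type) [Finite A] : LocallyOfFiniteType (affStr A) := by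
  rw [HasRingHomProperty.Spec_iff (P := @LocallyOfFiniteType)]
  simp only [CommRingCat.hom_ofHom]
  rw [RingHom.finiteType_algebraMap]
  infer_instance

/-- An open subset of affine space, as a variety. -/
noncomputable def openVariety (A : Type) [Finite A] (U : (affSch A).Opens) : CVariety where
  X := U.toScheme
  str := U.ι ≫ affStr A
  isReduced := inferInstance
  isSeparated := inferInstance
  locallyOfFiniteType := inferInstance
  quasiCompact := inferInstance

/-- The Lefschetz motive `𝕃 = [𝔸¹]`. -/
noncomputable def lefschetz : K0Var := K0Var.cls (openVariety Unit ⊤)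

/-- The field `ℚ(𝕃^{1/2})` of rational functions in the variable `𝕃^{1/2}`. -/
def HalfField : Type := RatFunc ℚ

noncomputable instance : Field HalfField := inferInstanceAs (Field (RatFunc ℚ))

noncomputable instance : Algebra ℚ HalfField := inferInstanceAs (Algebra ℚ (RatFunc ℚ))

/-- The variable `𝕃^{1/2} = q^{1/2}`. -/
noncomputable def HalfField.t : HalfField := (RatFunc.X : RatFunc ℚ)

/-- `K₀(Var_ℂ)` is a `ℤ[𝕃]`-algebra. -/
noncomputable instance : Algebra ℤ[X] K0Var :=
  (Polynomial.eval₂RingHom (Int.castRingHom K0Var) lefschetz).toAlgebra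

/-- `ℚ(𝕃^{1/2})` is a `ℤ[𝕃]`-algebra. -/
noncomputable instance : Algebra ℤ[X] HalfField :=
  (Polynomial.eval₂RingHom (Int.castRingHom HalfField) (HalfField.t ^ 2)).toAlgebra

/-- The coefficient ring `𝒱 = K₀(Var_ℂ) ⊗_{ℤ[𝕃]} ℚ(𝕃^{1/2})`. -/
def MotV : Type 1 := HalfField ⊗[ℤ[X]] K0Var

noncomputable instance : CommRing MotV := inferInstanceAs (CommRing (HalfField ⊗[ℤ[X]] K0Var))

noncomputable instance : Algebra HalfField MotV :=
  inferInstanceAs (Algebra HalfField (HalfField ⊗[ℤ[X]] K0Var))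

noncomputable instance : Algebra ℚ MotV :=
  ((algebraMap HalfField MotV).comp (algebraMap ℚ HalfField)).toAlgebra

/-- The class of a variety in `𝒱`. -/
noncomputable def MotV.cls (X : CVariety) : MotV :=
  (1 : HalfField) ⊗ₜ[ℤ[X]] K0Var.cls X

/-- The virtual motive `q^{1/2} - q^{-1/2}` of the multiplicative group. -/
noncomputable def gmVir : HalfField := HalfField.t - HalfField.t⁻¹

theorem HalfField.t_ne_zero : HalfField.t ≠ 0 := RatFunc.X_ne_zero

/-- `q^{1/2}` as a unit of `𝒱`. -/
noncomputable def sqrtQ : MotVˣ :=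
  Units.map (algebraMap HalfField MotV).toMonoidHom
    (Units.mk0 HalfField.t HalfField.t_ne_zero)

/-! ### Quantum tori -/

/-- Formal series `∑ a_α x^α`, `α ∈ M`, with coefficients in `R`, multiplied by the rule
`x^α ∘ x^β = v^⟨α,β⟩ x^(α+β)`. Here `v` plays the role of `q^{1/2}`. -/
@[ext]
structure QTorus {M R : Type*} [AddCommMonoid M] [CommRing R]
    (v : Rˣ) (ω : M →+ M →+ ℤ) where
  coeff : M → R

set_option linter.unusedSectionVars false
namespace QTorus

section

variable {M R : Type*} [AddCommMonoid M] [Finset.HasAntidiagonal M] [DecidableEq M]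
  [CommRing R] {v : Rˣ} {ω : M →+ M →+ ℤ}

instance : Zero (QTorus v ω) := ⟨⟨0⟩⟩
instance : Add (QTorus v ω) := ⟨fun A B => ⟨A.coeff + B.coeff⟩⟩
instance : Neg (QTorus v ω) := ⟨fun A => ⟨-A.coeff⟩⟩
instance : One (QTorus v ω) := ⟨⟨fun γ => if γ = 0 then 1 else 0⟩⟩

instance : Mul (QTorus v ω) :=
  ⟨fun A B => ⟨fun γ => ∑ p ∈ Finset.HasAntidiagonal.antidiagonal γ,
    ((v ^ ω p.1 p.2 : Rˣ) : R) * (A.coeff p.1 * B.coeff p.2)⟩⟩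

@[simp] theorem coeff_zero (γ : M) : (0 : QTorus v ω).coeff γ = 0 := rfl
@[simp] theorem coeff_add (A B : QTorus v ω) (γ : M) :
    (A + B).coeff γ = A.coeff γ + B.coeff γ := rfl
@[simp] theorem coeff_neg (A : QTorus v ω) (γ : M) : (-A).coeff γ = -A.coeff γ := rfl
theorem coeff_one (γ : M) : (1 : QTorus v ω).coeff γ = if γ = 0 then 1 else 0 := rfl
theorem coeff_mul (A B : QTorus v ω) (γ : M) :
    (A * B).coeff γ = ∑ p ∈ Finset.HasAntidiagonal.antidiagonal γ,
      ((v ^ ω p.1 p.2 : Rˣ) : R) * (A.coeff p.1 * B.coeff p.2) := rfl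

protected theorem mul_assoc' (A B C : QTorus v ω) : A * B * C = A * (B * C) := by
  ext γ
  simp only [coeff_mul, Finset.sum_mul, Finset.mul_sum, Finset.sum_sigma']
  apply Finset.sum_nbij' (fun ⟨⟨_i, j⟩, ⟨k, l⟩⟩ => ⟨(k, l + j), (l, j)⟩)
    (fun ⟨⟨i, _j⟩, ⟨k, l⟩⟩ => ⟨(i + k, l), (i, k)⟩)
  · rintro ⟨⟨i, j⟩, ⟨k, l⟩⟩ h
    simp only [Finset.mem_sigma, Finset.HasAntidiagonal.mem_antidiagonal, and_true] at h ⊢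
    obtain ⟨h1, h2⟩ := h
    subst h2
    simpa [add_assoc] using h1
  · rintro ⟨⟨i, j⟩, ⟨k, l⟩⟩ h
    simp only [Finset.mem_sigma, Finset.HasAntidiagonal.mem_antidiagonal] at h ⊢
    obtain ⟨h1, h2⟩ := h
    subst h2
    simpa [add_assoc] using h1
  · rintro ⟨⟨i, j⟩, ⟨k, l⟩⟩ h
    simp only [Finset.mem_sigma, Finset.HasAntidiagonal.mem_antidiagonal] at h
    obtain ⟨h1, h2⟩ := h
    subst h2
    rfl
  · rintro ⟨⟨i, j⟩, ⟨k, l⟩⟩ h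
    simp only [Finset.mem_sigma, Finset.HasAntidiagonal.mem_antidiagonal] at h
    obtain ⟨h1, h2⟩ := h
    subst h2
    rfl
  · rintro ⟨⟨i, j⟩, ⟨k, l⟩⟩ h
    simp only [Finset.mem_sigma, Finset.HasAntidiagonal.mem_antidiagonal] at h
    obtain ⟨h1, h2⟩ := h
    subst h2
    simp only [map_add, AddMonoidHom.add_apply, zpow_add, Units.val_mul]
    ring

theorem sum_antidiagonal_zero_left (f : M → M → R) (hf : ∀ a b, a ≠ 0 → f a b = 0) (γ : M) :
    ∑ p ∈ Finset.HasAntidiagonal.antidiagonal γ, f p.1 p.2 = f 0 γ := by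
  rw [Finset.sum_eq_single (0, γ)]
  · rintro ⟨a, b⟩ h hne
    apply hf
    rintro rfl
    simp_all
  · simp

theorem sum_antidiagonal_zero_right (f : M → M → R) (hf : ∀ a b, b ≠ 0 → f a b = 0) (γ : M) :
    ∑ p ∈ Finset.HasAntidiagonal.antidiagonal γ, f p.1 p.2 = f γ 0 := by
  rw [Finset.sum_eq_single (γ, 0)]
  · rintro ⟨a, b⟩ h hne
    apply hf
    rintro rfl
    simp_all
  · simp

/-- The quantum torus is an associative ring with unit `x^0`. -/
instance : Ring (QTorus v ω) where
  add_assoc A B C := by ext; simp [add_assoc]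
  zero_add A := by ext; simp
  add_zero A := by ext; simp
  add_comm A B := by ext; simp [add_comm]
  neg_add_cancel A := by ext; simp
  nsmul := nsmulRec
  zsmul := zsmulRec
  left_distrib A B C := by ext; simp [coeff_mul, mul_add, Finset.sum_add_distrib]
  right_distrib A B C := by ext; simp [coeff_mul, mul_add, add_mul, Finset.sum_add_distrib]
  zero_mul A := by ext; simp [coeff_mul]
  mul_zero A := by ext; simp [coeff_mul]
  mul_assoc := QTorus.mul_assoc'
  one_mul A := by
    ext γ
    rw [coeff_mul, sum_antidiagonal_zero_left
      (fun a b => ((v ^ ω a b : Rˣ) : R) * ((1 : QTorus v ω).coeff a * A.coeff b))]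
    · simp [coeff_one]
    · intro a b ha; simp [coeff_one, ha]
  mul_one A := by
    ext γ
    rw [coeff_mul, sum_antidiagonal_zero_right
      (fun a b => ((v ^ ω a b : Rˣ) : R) * (A.coeff a * (1 : QTorus v ω).coeff b))]
    · simp [coeff_one]
    · intro a b ha; simp [coeff_one, ha]

/-- `exp A = ∑ Aⁿ/n!`, for a series `A` without constant term. (If `M` is a monoid of finitely
supported functions to `ℕ`, only finitely many `n` contribute to a given coefficient.) -/
noncomputable def exp [Algebra ℚ R] (A : QTorus v ω) : QTorus v ω :=
  ⟨fun γ => ∑ᶠ n : ℕ, ((n.factorial : ℚ)⁻¹) • (A ^ n).coeff γ⟩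

end

end QTorus

/-! ### Stability and abelian quiver representations -/

/-- The half plane `{r e^{iπφ} : r > 0, 0 < φ ≤ 1}`. -/
def HPlus (z : ℂ) : Prop := 0 < z.im ∨ (z.im = 0 ∧ z.re < 0)

/-- The slope `d / r` of `z = -d + i r`, equal to `∞` if `r = 0`. -/
noncomputable def zslope (z : ℂ) : WithTop ℝ :=
  if z.im = 0 then ⊤ else ((-z.re / z.im : ℝ) : WithTop ℝ)

/-- The arrows of the quiver with vertex set `W` that has `r i j` arrows from `i` to `j`. -/
abbrev QArrow {W : Type} (r : W → W → ℕ) : Type := Σ p : W × W, Fin (r p.1 p.2)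

/-- The abelian representation over the field `k` (the one-dimensional space `k` at every vertex,
and the arrow `a` acting by the scalar `c a`) is semistable for the stability function with value
`ζ i` at the vertex `i`: every nonzero subrepresentation `N` satisfies `μ(dim N) ≤ μ(dim M)`. -/
def IsSemistableRep {W : Type} [Fintype W] (r : W → W → ℕ) (ζ : W → ℂ)
    {k : Type} [Field k] (c : QArrow r → k) : Prop :=
  ∀ N : W → Submodule k k,
    (∀ a : QArrow r, ∀ x ∈ N a.1.1, c a * x ∈ N a.1.2) → (∃ i, N i ≠ ⊥) →
      zslope (∑ i, (Module.finrank k (N i) : ℂ) * ζ i) ≤ zslope (∑ i, ζ i)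

theorem IsSemistableRep.mono {W : Type} [Fintype W] {r : W → W → ℕ} {ζ : W → ℂ}
    {k k' : Type} [Field k] [Field k'] {c : QArrow r → k} {c' : QArrow r → k'}
    (hcc : ∀ a, c a ≠ 0 → c' a ≠ 0) (h : IsSemistableRep r ζ c) : IsSemistableRep r ζ c' := by
  classical
  intro N' hN' hne
  have hN := h (fun i => if N' i = ⊥ then ⊥ else ⊤) ?_ ?_
  · have key : ∀ i, Module.finrank k
        ((if N' i = ⊥ then ⊥ else ⊤ : Submodule k k)) = Module.finrank k' (N' i) := by
      intro i
      by_cases hi : N' i = ⊥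
      · rw [if_pos hi, hi, finrank_bot, finrank_bot]
      · rw [if_neg hi, (Ideal.eq_bot_or_top (N' i)).resolve_left hi, finrank_top, finrank_top,
          Module.finrank_self, Module.finrank_self]
    simpa only [key] using hN
  · intro a x hx
    by_cases hsrc : N' a.1.1 = ⊥
    · rw [if_pos hsrc, Submodule.mem_bot] at hx
      rw [hx, mul_zero]
      exact Submodule.zero_mem _
    · by_cases hca : c a = 0
      · rw [hca, zero_mul]
        exact Submodule.zero_mem _
      · have htop : N' a.1.1 = ⊤ := (Ideal.eq_bot_or_top (N' a.1.1)).resolve_left hsrc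
        have h1 := hN' a 1 (by rw [htop]; exact Submodule.mem_top)
        have htgt : N' a.1.2 ≠ ⊥ := by
          intro hb
          rw [hb, mul_one, Submodule.mem_bot] at h1
          exact hcc a hca h1
        rw [if_neg htgt]
        exact Submodule.mem_top
  · obtain ⟨i, hi⟩ := hne
    refine ⟨i, ?_⟩
    rw [if_neg hi]
    exact top_ne_bot

/-- The representation at a point of the space `R(Q) = 𝔸^{Q₁}` of abelian representations: over the
residue field, the arrow `a` acts by the value of the `a`-th coordinate. -/
noncomputable def pointRep {A : Type} (p : PrimeSpectrum (MvPolynomial A ℂ)) (a : A) :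
    p.asIdeal.ResidueField :=
  algebraMap (MvPolynomial A ℂ) p.asIdeal.ResidueField (MvPolynomial.X a)

theorem pointRep_eq_zero {A : Type} (p : PrimeSpectrum (MvPolynomial A ℂ)) (a : A) :
    pointRep p a = 0 ↔ (MvPolynomial.X a : MvPolynomial A ℂ) ∈ p.asIdeal :=
  Ideal.algebraMap_residueField_eq_zero

theorem isOpen_semistable {W : Type} [Fintype W] (r : W → W → ℕ) (ζ : W → ℂ) :
    IsOpen {p : PrimeSpectrum (MvPolynomial (QArrow r) ℂ) |
      IsSemistableRep r ζ (pointRep p)} := by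
  classical
  rw [isOpen_iff_forall_mem_open]
  intro p hp
  let U : TopologicalSpace.Opens (PrimeSpectrum (MvPolynomial (QArrow r) ℂ)) :=
    PrimeSpectrum.basicOpen (∏ a : QArrow r,
      if (MvPolynomial.X a : MvPolynomial (QArrow r) ℂ) ∈ p.asIdeal then 1
      else MvPolynomial.X a)
  refine ⟨U, ?_, U.isOpen, ?_⟩
  · intro p' hp'
    refine IsSemistableRep.mono ?_ hp
    intro a ha h0
    rw [Ne, pointRep_eq_zero] at ha
    rw [pointRep_eq_zero] at h0
    refine hp' (Ideal.mem_of_dvd _ (Finset.dvd_prod_of_mem _ (Finset.mem_univ a)) ?_)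
    simpa [ha] using h0
  · intro hmem
    obtain ⟨a, -, ha⟩ := (Ideal.IsPrime.prod_mem_iff (hp := p.isPrime)).1 hmem
    by_cases h : (MvPolynomial.X a : MvPolynomial (QArrow r) ℂ) ∈ p.asIdeal
    · rw [if_pos h] at ha
      exact p.isPrime.ne_top ((Ideal.eq_top_iff_one _).2 ha)
    · rw [if_neg h] at ha
      exact h ha

/-- The open subset `R_Z(Q)` of semistable points of the space `R(Q) = 𝔸^{Q₁}` of abelian
representations of the finite quiver `Q`. -/
noncomputable def semistableLocus {W : Type} [Fintype W] (r : W → W → ℕ) (ζ : W → ℂ) :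
    (affSch (QArrow r)).Opens :=
  ⟨{p : PrimeSpectrum (MvPolynomial (QArrow r) ℂ) | IsSemistableRep r ζ (pointRep p)},
    isOpen_semistable r ζ⟩

/-- The motivic invariant `f_Z(Q) = q^{(|Q₀|-|Q₁|)/2} [R_Z(Q)] / (q-1)^{|Q₀|}` of the stack of
semistable abelian representations of a finite quiver `Q`. -/
noncomputable def fAbelian {W : Type} [Fintype W] (r : W → W → ℕ) (ζ : W → ℂ) : MotV :=
  (HalfField.t ^ ((Fintype.card W : ℤ) - (Fintype.card (QArrow r) : ℤ)) *
    ((HalfField.t ^ 2 - 1) ^ Fintype.card W)⁻¹) •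
  MotV.cls (openVariety (QArrow r) (semistableLocus r ζ))

/-- `f_Z(m) = f_Z(Q(m))` for a possibly infinite quiver `Q`, given by the numbers `r i j` of arrows
from `i` to `j`, a stability function with value `ζ i` at `i`, and a dimension vector `m`:
the quiver `Q(m)` has the vertices `i_k`, `1 ≤ k ≤ m i`, with `r i j` arrows from `i_k` to `j_k'`. -/
noncomputable def fDim {V : Type} (r : V → V → ℕ) (ζ : V → ℂ) (m : V →₀ ℕ) : MotV :=
  fAbelian (W := Σ i : m.support, Fin (m i)) (fun x y => r x.1 y.1) (fun x => ζ x.1)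

/-- The bilinear form `r(α,β) = ∑_{a : i → j} α_i β_j` on the dimension vectors of a quiver. -/
def quiverForm {V : Type} (r : V → V → ℕ) (α β : V →₀ ℕ) : ℕ :=
  α.sum fun i a => β.sum fun j b => a * b * r i j

theorem quiverForm_add_left {V : Type} (r : V → V → ℕ) (α α' β : V →₀ ℕ) :
    quiverForm r (α + α') β = quiverForm r α β + quiverForm r α' β := by
  classical
  unfold quiverForm
  refine Finsupp.sum_add_index' (fun i => by simp) (fun i a a' => ?_)
  rw [← Finsupp.sum_add]
  exact Finsupp.sum_congr fun j _ => by ring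

theorem quiverForm_add_right {V : Type} (r : V → V → ℕ) (α β β' : V →₀ ℕ) :
    quiverForm r α (β + β') = quiverForm r α β + quiverForm r α β' := by
  classical
  unfold quiverForm
  rw [← Finsupp.sum_add]
  refine Finsupp.sum_congr fun i _ => ?_
  exact Finsupp.sum_add_index' (by simp) (fun _ _ _ => by ring)

/-- The skew form `⟨α,β⟩ = r(β,α) - r(α,β)` on the dimension vectors of a quiver. -/
noncomputable def quiverSkew {V : Type} (r : V → V → ℕ) : (V →₀ ℕ) →+ (V →₀ ℕ) →+ ℤ where
  toFun α :=
    { toFun := fun β => (quiverForm r β α : ℤ) - (quiverForm r α β : ℤ)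
      map_zero' := by simp [quiverForm]
      map_add' := fun β β' => by
        rw [quiverForm_add_left, quiverForm_add_right]; push_cast; ring }
  map_zero' := AddMonoidHom.ext fun β => by simp [quiverForm]
  map_add' α α' := AddMonoidHom.ext fun β => by
    simp only [AddMonoidHom.coe_mk, ZeroHom.coe_mk, AddMonoidHom.add_apply]
    rw [quiverForm_add_left, quiverForm_add_right]; push_cast; ring

/-! ### The rank two lattice -/

/-- `Γ₊ = ℕ e₁ + ℕ e₂`, in coordinates. -/
abbrev GPlus : Type := Fin 2 →₀ ℕ

/-- `Γ₊^* = Γ₊ \ {0}`. -/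
abbrev GStar : Type := {γ : GPlus // γ ≠ 0}

/-- The inclusion of `Γ₊` in the lattice `Γ` with basis `e`. -/
noncomputable def toLattice {Γ : Type*} [AddCommGroup Γ] (e : Module.Basis (Fin 2) ℤ Γ) :
    GPlus →+ Γ where
  toFun γ := γ 0 • e 0 + γ 1 • e 1
  map_zero' := by simp
  map_add' γ δ := by simp only [Finsupp.add_apply, add_smul]; abel

/-- The restriction to `Γ₊` of a bilinear form on `Γ`. -/
noncomputable def formPlus {Γ : Type*} [AddCommGroup Γ] (e : Module.Basis (Fin 2) ℤ Γ)
    (ω : LinearMap.BilinForm ℤ Γ) : GPlus →+ GPlus →+ ℤ where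
  toFun γ :=
    { toFun := fun δ => ω (toLattice e γ) (toLattice e δ)
      map_zero' := by simp
      map_add' := fun δ δ' => by simp }
  map_zero' := by ext; simp
  map_add' γ γ' := by ext; simp

/-- A ray `l = ℝ_{>0} v` with `v ∈ Γ₊^*`, given by the unique indivisible `v ∈ l ∩ Γ₊`. -/
def Ray : Type := {v : GPlus // Nat.gcd (v 0) (v 1) = 1}

/-- `γ ∈ l`, for `γ ∈ Γ₊`. -/
def Ray.Mem (l : Ray) (γ : GPlus) : Prop := ∃ n : ℕ, 0 < n ∧ γ = n • l.1

/-- `l` has smaller slope than `l'` in the first quadrant: `l₁/l₀ < l'₁/l'₀`. -/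
def Ray.slopeLT (l l' : Ray) : Prop := l.1 1 * l'.1 0 < l'.1 1 * l.1 0

/-- `P` is the ordered product of the series `F l` over all rays `l`, where `before l l'` means that
the factor of `l` stands to the left of the factor of `l'`: each coefficient of `P` is the
corresponding coefficient of the product over all sufficiently large finite sets of rays. -/
def HasOrderedProd {ω : GPlus →+ GPlus →+ ℤ} (before : Ray → Ray → Prop)
    (F : Ray → QTorus sqrtQ ω) (P : QTorus sqrtQ ω) : Prop :=
  ∀ γ : GPlus, ∃ S : Finset Ray, ∀ L : List Ray, L.Pairwise before → (∀ l ∈ S, l ∈ L) →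
    (L.map F).prod.coeff γ = P.coeff γ

open Classical in
/-- The factor `exp (∑_{γ ∈ l} a_γ x^γ / (q^{1/2} - q^{-1/2}))` of the ray `l`. -/
noncomputable def rayExp (ω : GPlus →+ GPlus →+ ℤ) (a : GStar → MotV) (l : Ray) :
    QTorus sqrtQ ω :=
  QTorus.exp ⟨fun γ => if h : γ ≠ 0 ∧ l.Mem γ then gmVir⁻¹ • a ⟨γ, h.1⟩ else 0⟩

/-- The Kontsevich–Soibelman wall-crossing formula: the product of the factors of `b` over the rays
in clockwise order (of decreasing slope) is equal to the product of the factors of `a` over the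
rays in anticlockwise order (of increasing slope). -/
def KSFormula (ω : GPlus →+ GPlus →+ ℤ) (b a : GStar → MotV) : Prop :=
  ∃ P : QTorus sqrtQ ω,
    HasOrderedProd (fun l l' => l'.slopeLT l) (rayExp ω b) P ∧
    HasOrderedProd (fun l l' => l.slopeLT l') (rayExp ω a) P

/-- `‖m‖ = ∑ m(α) α` for `m : Γ₊^* → ℕ` of finite support. -/
noncomputable def mnorm (m : GStar →₀ ℕ) : GPlus := m.sum fun α k => k • α.1

/-- `m! = ∏ m(α)!`. -/
noncomputable def mfact (m : GStar →₀ ℕ) : ℕ := m.prod fun _ k => k.factorial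

/-- The quiver `Q̂` on the vertex set `Γ₊^*`, with `⟨β,α⟩` arrows from `α` to `β` if this number is
positive, and no arrow otherwise. -/
noncomputable def hatQuiver (ω : GPlus →+ GPlus →+ ℤ) (α β : GStar) : ℕ := (ω β.1 α.1).toNat

open Classical in
/-- `g` is the family of abelian quiver invariants of `Q̂` with the stability function induced by
`Z`: for every ray `l`, in the quantum torus of `Q̂`,
`1 + ∑_{‖m‖ ∈ l} f_Z(m) x^m / m! = exp (∑_{‖m‖ ∈ l} g(m) / (q^{1/2} - q^{-1/2}) x^m / m!)`. -/
def IsAbelianInvariants (ω : GPlus →+ GPlus →+ ℤ) (Z : GPlus →+ ℂ)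
    (g : (GStar →₀ ℕ) → MotV) : Prop :=
  ∀ l : Ray,
    (1 + ⟨fun m => if l.Mem (mnorm m) then
        ((mfact m : ℚ)⁻¹) • fDim (hatQuiver ω) (fun α => Z α.1) m else 0⟩ :
      QTorus sqrtQ (quiverSkew (hatQuiver ω))) =
    QTorus.exp ⟨fun m => if l.Mem (mnorm m) then
        ((mfact m : ℚ)⁻¹) • (gmVir⁻¹ • g m) else 0⟩

/-- The modified Manschot–Pioline–Sen formula
`b_γ = ∑_{‖m‖ = γ} g(m)/m! ∏ a_α^{m(α)}` (a finite sum) for all `γ ∈ Γ₊^*`. -/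
def MPSFormula (g : (GStar →₀ ℕ) → MotV) (b a : GStar → MotV) : Prop :=
  ∀ γ : GStar, b γ = ∑ᶠ m ∈ {m : GStar →₀ ℕ | mnorm m = γ.1},
    ((mfact m : ℚ)⁻¹) • (g m * m.prod fun α k => a α ^ k)

/-! ### Classes of open subsets of affine space. -/

open Finset.HasAntidiagonal (antidiagonal mem_antidiagonal)

/-! The generating series of all abelian representations of `Q̂` (`totalSeries`) is factored in two
ways. A stability function cuts a representation into its Harder–Narasimhan pieces, so the total
series is the ordered product of the semistable series over the rays. For `Z` the slopes decrease
from left to right, and the factor of a ray is by definition the exponential of the abelian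
invariants `g` (`hnFactor_eq_one_add`). For the opposite stability the slopes increase. The arrows
of `Q̂` always lead to smaller slope, so now every semistable representation is supported on a
single ray, where `Q̂` has no arrows, and the factor is the exponential of `∑ x_α / (q^{1/2} -
q^{-1/2})` (`hnFactor_eq_exp_vertexSum`).

The skew form of `Q̂` is the pullback of the form of `Γ` along `m ↦ ‖m‖`, so `x^m ↦ a^m x^‖m‖` is a
homomorphism of quantum tori (`pushTorus`). It sends the second factorization to the product of the
exponentials of `a`, and the first to the product of the exponentials of the right hand side of the
Manschot–Pioline–Sen formula (`mpsSum`). Hence that right hand side solves the wall-crossing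
formula. It is the only solution, because an ordered factorization over rays determines its
exponents (`rayExp_factorization_unique`).

The Harder–Narasimhan step is made combinatorial. A subrepresentation of an abelian representation
is a set of vertices closed under the nonzero arrows, so the semistable locus is a union of torus
orbits in affine space. Slicing by coordinate hyperplanes expresses its class as a polynomial in `𝕃`
(`cls_openVariety_eq_sum`), that is, as a weighted count of relations on the vertex set
(`fAbelian_eq`). For such counts the recursion is a bijection: a relation corresponds to its maximal
destabilizing subset together with the induced pieces (`repSum_nonneg_eq`). Passing from subsets to
dimension vectors produces binomial coefficients, which is why the series carry `1/m!`, and the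
power of `q` from the arrows between the pieces is the twist of the quantum torus
(`hnCoeff_nonneg_eq`). Induction over a list of rays gives the product (`coeff_prod_hnFactor`). -/

theorem K0Var.rel_eq {p : MvPolynomial CVariety ℤ} (h : K0Rel p) :
    Ideal.Quotient.mk (Ideal.span {p | K0Rel p}) p = 0 :=
  Ideal.Quotient.eq_zero_iff_mem.2 (Ideal.subset_span h)

theorem K0Var.cls_iso (X Y : CVariety) (f : X.X ⟶ Y.X) (hf : IsIso f)
    (hstr : f ≫ Y.str = X.str) : K0Var.cls X = K0Var.cls Y := by
  have := rel_eq (K0Rel.iso X Y f hf hstr)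
  rw [map_sub] at this
  exact sub_eq_zero.1 this

theorem K0Var.cls_scissor (X Z U : CVariety) (i : Z.X ⟶ X.X) (j : U.X ⟶ X.X)
    (hi : IsClosedImmersion i) (hj : IsOpenImmersion j)
    (histr : i ≫ X.str = Z.str) (hjstr : j ≫ X.str = U.str)
    (hcompl : Set.range j = (Set.range i)ᶜ) :
    K0Var.cls X = K0Var.cls Z + K0Var.cls U := by
  have := rel_eq (K0Rel.scissor X Z U i j hi hj histr hjstr hcompl)
  rw [map_sub, map_add] at this
  exact sub_eq_zero.1 this

theorem K0Var.cls_prod (P X Y : CVariety) (p : P.X ⟶ X.X) (r : P.X ⟶ Y.X)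
    (h : IsPullback p r X.str Y.str) (hstr : p ≫ X.str = P.str) :
    K0Var.cls P = K0Var.cls X * K0Var.cls Y := by
  have := rel_eq (K0Rel.prod P X Y p r h hstr)
  rw [map_sub, map_mul] at this
  exact sub_eq_zero.1 this

theorem K0Var.cls_point (X : CVariety) (h : IsIso X.str) : K0Var.cls X = 1 := by
  have := rel_eq (K0Rel.point X h)
  rw [map_sub, map_one] at this
  exact sub_eq_zero.1 this

/-- The morphism of affine spaces given by a family of polynomials. -/
noncomputable abbrev affMap {A B : Type} (f : B → MvPolynomial A ℂ) : affSch A ⟶ affSch B :=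
  Spec.map (CommRingCat.ofHom (MvPolynomial.aeval f).toRingHom)

theorem affMap_str {A B : Type} (f : B → MvPolynomial A ℂ) : affMap f ≫ affStr B = affStr A := by
  rw [← Spec.map_comp, ← CommRingCat.ofHom_comp]
  congr 2
  exact (MvPolynomial.aeval f).comp_algebraMap

/-- The zero section of the projection of affine space that forgets one coordinate. -/
noncomputable abbrev affZero (A : Type) : affSch A ⟶ affSch (Option A) :=
  affMap (fun o => o.elim 0 MvPolynomial.X)

/-- The projection of affine space that forgets one coordinate. -/
noncomputable abbrev affProj (A : Type) : affSch (Option A) ⟶ affSch A :=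
  affMap (fun a => MvPolynomial.X (some a))

theorem affZero_surjective (A : Type) : Function.Surjective
    (MvPolynomial.aeval (R := ℂ) (fun o : Option A =>
      (o.elim 0 MvPolynomial.X : MvPolynomial A ℂ))).toRingHom := by
  intro p
  refine ⟨MvPolynomial.rename some p, ?_⟩
  change MvPolynomial.aeval _ (MvPolynomial.rename some p) = p
  rw [MvPolynomial.aeval_rename]
  exact MvPolynomial.aeval_X_left_apply p

instance (A : Type) : IsClosedImmersion (affZero A) :=
  IsClosedImmersion.spec_of_surjective _ (affZero_surjective A)

theorem mem_range_affZero {A : Type} (p : PrimeSpectrum (MvPolynomial (Option A) ℂ)) :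
    p ∈ Set.range (affZero A) ↔ (MvPolynomial.X none : MvPolynomial (Option A) ℂ) ∈ p.asIdeal := by
  change p ∈ Set.range (PrimeSpectrum.comap _) ↔ _
  rw [CommRingCat.hom_ofHom, range_comap_of_surjective _ _ (affZero_surjective A),
    PrimeSpectrum.mem_zeroLocus]
  constructor
  · intro h
    exact h (by simp [RingHom.mem_ker])
  · intro h f hf
    -- Modulo the forgotten coordinate every polynomial equals its restriction to the hyperplane. A
    -- polynomial with zero restriction is therefore a multiple of that coordinate.
    have key : ∀ f : MvPolynomial (Option A) ℂ, f - MvPolynomial.rename some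
        (MvPolynomial.aeval (fun o : Option A => (o.elim 0 MvPolynomial.X : MvPolynomial A ℂ)) f)
          ∈ Ideal.span {(MvPolynomial.X none : MvPolynomial (Option A) ℂ)} := by
      intro f
      rw [← Ideal.Quotient.mk_eq_mk_iff_sub_mem]
      let φ : MvPolynomial (Option A) ℂ →ₐ[ℂ] _ := Ideal.Quotient.mkₐ ℂ
        (Ideal.span {(MvPolynomial.X none : MvPolynomial (Option A) ℂ)})
      suffices φ = (φ.comp (MvPolynomial.rename some)).comp (MvPolynomial.aeval
        (fun o : Option A => (o.elim 0 MvPolynomial.X : MvPolynomial A ℂ))) from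
        DFunLike.congr_fun this f
      apply MvPolynomial.algHom_ext
      rintro (_ | a)
      · simp [φ]
      · simp [φ]
    have h0 : MvPolynomial.aeval (fun o : Option A => (o.elim 0 MvPolynomial.X :
        MvPolynomial A ℂ)) f = 0 := hf
    have := key f
    rw [h0, map_zero, sub_zero] at this
    exact (Ideal.span_singleton_le_iff_mem _).2 h this

theorem restrict_cls_comp {A B : Type} [Finite A] [Finite B] (f : B → MvPolynomial A ℂ)
    (U : (affSch B).Opens) :
    (affMap f ∣_ U) ≫ (openVariety B U).str = (openVariety A (affMap f ⁻¹ᵁ U)).str := by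
  simp only [openVariety]
  rw [← Category.assoc, morphismRestrict_ι, Category.assoc, affMap_str]

/-- The complement of a coordinate hyperplane. -/
noncomputable def coordOpen {A : Type} (a : A) : (affSch A).Opens :=
  PrimeSpectrum.basicOpen (MvPolynomial.X a : MvPolynomial A ℂ)

theorem range_homOfLE_coordOpen {A : Type} (U : (affSch (Option A)).Opens) :
    Set.range ((affSch (Option A)).homOfLE (inf_le_left : U ⊓ coordOpen none ≤ U)) =
      (Set.range (affZero A ∣_ U))ᶜ := by
  ext ⟨x, hxU⟩
  have hx : (⟨x, hxU⟩ : U) ∈ Set.range (affZero A ∣_ U) ↔ x ∈ Set.range (affZero A) := by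
    constructor
    · rintro ⟨y, hy⟩
      exact ⟨y.1, by rw [← morphismRestrict_base_coe, hy]⟩
    · rintro ⟨y, rfl⟩
      exact ⟨⟨y, hxU⟩, Subtype.ext (morphismRestrict_base_coe _ _ _)⟩
  refine Iff.trans ?_ (not_congr (hx.trans (mem_range_affZero x))).symm
  constructor
  · rintro ⟨y, hy⟩
    have h : ((affSch (Option A)).homOfLE (inf_le_left : U ⊓ coordOpen none ≤ U) y).1 = y.1 :=
      Scheme.homOfLE_apply _ _
    have hxy : y.1 = x := h.symm.trans (congrArg Subtype.val hy)
    exact (hxy ▸ y.2 : x ∈ U ⊓ coordOpen none).2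
  · intro h
    exact ⟨⟨x, hxU, h⟩, Scheme.homOfLE_apply' _ _ _⟩

theorem cls_openVariety_option (A : Type) [Finite A] (U : (affSch (Option A)).Opens) :
    K0Var.cls (openVariety (Option A) U) =
      K0Var.cls (openVariety A (affZero A ⁻¹ᵁ U)) +
        K0Var.cls (openVariety (Option A) (U ⊓ coordOpen none)) := by
  refine K0Var.cls_scissor _ _ _ (affZero A ∣_ U) (Scheme.homOfLE _ inf_le_left) ?_ ?_ ?_ ?_ ?_
  · exact MorphismProperty.of_isPullback (P := @IsClosedImmersion)
      (isPullback_morphismRestrict (affZero A) U).flip inferInstance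
  · exact inferInstanceAs (IsOpenImmersion (Scheme.homOfLE _ inf_le_left))
  · exact restrict_cls_comp _ _
  · simp [openVariety]
  · exact range_homOfLE_coordOpen U

theorem isPullback_affProj (A : Type) :
    IsPullback (affProj A) (affMap fun _ : Unit => MvPolynomial.X (none : Option A))
      (affStr A) (affStr Unit) := by
  apply isPullback_SpecMap_of_isPushout
  refine ⟨⟨?_⟩, ⟨Limits.PushoutCocone.IsColimit.mk _ (fun s => CommRingCat.ofHom
    (MvPolynomial.eval₂Hom (s.inl.hom.comp (algebraMap ℂ (MvPolynomial A ℂ)))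
      (fun o => o.elim (s.inr.hom (MvPolynomial.X ())) fun a => s.inl.hom (MvPolynomial.X a))))
      ?_ ?_ ?_⟩⟩
  · rw [← CommRingCat.ofHom_comp, ← CommRingCat.ofHom_comp]
    congr 1
    exact (MvPolynomial.aeval (R := ℂ) fun a : A =>
        (MvPolynomial.X (some a) : MvPolynomial (Option A) ℂ)).comp_algebraMap.trans
      (MvPolynomial.aeval (R := ℂ) fun _ : Unit =>
        (MvPolynomial.X none : MvPolynomial (Option A) ℂ)).comp_algebraMap.symm
  · intro s
    ext x
    · simp
    · simp
  · intro s
    have hs := congrArg CommRingCat.Hom.hom s.condition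
    ext x
    · have := congrArg (fun f => f x) hs
      simpa using this
    · simp
  · intro s m h1 h2
    ext x
    · have := congrArg (fun f => f.hom (MvPolynomial.C x)) h1
      simpa using this
    · rcases x with _ | a
      · have := congrArg (fun f => f.hom (MvPolynomial.X ())) h2
        simpa using this
      · have := congrArg (fun f => f.hom (MvPolynomial.X a)) h1
        simpa using this

/-- The preimage is `V × 𝔸¹`: paste the restriction square over `V` with the pullback square of
affine spaces. The isomorphism `e` is needed because `lefschetz` is the class of the open subset `⊤`
of the line. -/
theorem cls_preimage_affProj (A : Type) [Finite A] (V : (affSch A).Opens) :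
    K0Var.cls (openVariety (Option A) (affProj A ⁻¹ᵁ V)) =
      K0Var.cls (openVariety A V) * lefschetz := by
  let e : (⊤ : (affSch Unit).Opens).toScheme ≅ affSch Unit := Scheme.topIso _
  have he : e.inv ≫ (⊤ : (affSch Unit).Opens).ι = 𝟙 _ := by simp [e]
  refine K0Var.cls_prod _ _ _ (affProj A ∣_ V)
    ((affProj A ⁻¹ᵁ V).ι ≫ (affMap fun _ : Unit => MvPolynomial.X (none : Option A)) ≫
      e.inv) ?_ (restrict_cls_comp _ _)
  have h1 := (isPullback_morphismRestrict (affProj A) V).paste_vert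
    (isPullback_affProj A)
  refine h1.of_iso (Iso.refl _) (Iso.refl _) e.symm (Iso.refl _) ?_ ?_ ?_ ?_
  all_goals simp [openVariety, e]

theorem affMap_comp {A B C : Type} (f : B → MvPolynomial A ℂ) (g : C → MvPolynomial B ℂ) :
    affMap f ≫ affMap g = affMap fun c => MvPolynomial.aeval f (g c) := by
  rw [← Spec.map_comp, ← CommRingCat.ofHom_comp]
  congr 2
  have : (MvPolynomial.aeval f).comp (MvPolynomial.aeval g) =
      MvPolynomial.aeval fun c => MvPolynomial.aeval f (g c) :=
    MvPolynomial.algHom_ext fun c => by simp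
  exact congrArg (fun φ : MvPolynomial C ℂ →ₐ[ℂ] MvPolynomial A ℂ => φ.toRingHom) this

theorem affMap_X (A : Type) :
    affMap (fun a : A => (MvPolynomial.X a : MvPolynomial A ℂ)) = 𝟙 (affSch A) := by
  rw [← Spec.map_id, ← CommRingCat.ofHom_id]
  exact congrArg (fun φ : MvPolynomial A ℂ →ₐ[ℂ] MvPolynomial A ℂ =>
    Spec.map (CommRingCat.ofHom φ.toRingHom)) MvPolynomial.aeval_X_left

theorem isIso_affMap {A B : Type} (e : A ≃ B) :
    IsIso (affMap fun b : B => (MvPolynomial.X (e.symm b) : MvPolynomial A ℂ)) := by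
  refine ⟨affMap fun a : A => MvPolynomial.X (e a), ?_, ?_⟩
  · rw [affMap_comp]
    simp only [MvPolynomial.aeval_X, Equiv.symm_apply_apply]
    exact affMap_X A
  · rw [affMap_comp]
    simp only [MvPolynomial.aeval_X, Equiv.apply_symm_apply]
    exact affMap_X B

theorem cls_openVariety_equiv {A B : Type} [Finite A] [Finite B] (e : A ≃ B)
    (U : (affSch B).Opens) :
    K0Var.cls (openVariety A
      (affMap (fun b : B => (MvPolynomial.X (e.symm b) : MvPolynomial A ℂ)) ⁻¹ᵁ U)) =
      K0Var.cls (openVariety B U) := by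
  have := isIso_affMap e
  exact K0Var.cls_iso _ _ (affMap (fun b : B => (MvPolynomial.X (e.symm b) : MvPolynomial A ℂ)) ∣_ U)
    (inferInstanceAs (IsIso (_ ∣_ U))) (restrict_cls_comp _ _)

/-- The empty variety is both a closed subvariety of itself and its open complement, so its class
satisfies `c = c + c`. -/
theorem cls_openVariety_bot (A : Type) [Finite A] :
    K0Var.cls (openVariety A ⊥) = 0 := by
  have : K0Var.cls (openVariety A ⊥) =
      K0Var.cls (openVariety A ⊥) + K0Var.cls (openVariety A ⊥) := by
    refine K0Var.cls_scissor _ _ _ (𝟙 _) (𝟙 _) inferInstance inferInstance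
      (Category.id_comp _) (Category.id_comp _) ?_
    ext x
    exact x.2.elim
  simpa using this

theorem cls_openVariety_empty (A : Type) [IsEmpty A] :
    K0Var.cls (openVariety A ⊤) = 1 := by
  apply K0Var.cls_point
  have h1 : IsIso (affStr A) := by
    have : IsIso (CommRingCat.ofHom (algebraMap ℂ (MvPolynomial A ℂ))) := by
      rw [ConcreteCategory.isIso_iff_bijective]
      exact (MvPolynomial.isEmptyAlgEquiv ℂ A).symm.bijective
    infer_instance
  have h2 : IsIso (⊤ : (affSch A).Opens).ι :=
    inferInstanceAs (IsIso (Scheme.topIso _).hom)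
  exact inferInstanceAs (IsIso ((⊤ : (affSch A).Opens).ι ≫ affStr A))

/-- The prime ideal of a point of affine space. -/
noncomputable def pointIdeal {A : Type} (p : affSch A) : Ideal (MvPolynomial A ℂ) :=
  PrimeSpectrum.asIdeal (R := MvPolynomial A ℂ) p

open Classical in
/-- The coordinates that do not vanish at a point of affine space. -/
noncomputable def coordSupport {A : Type} (p : affSch A) (a : A) : Bool :=
  decide (MvPolynomial.X a ∉ pointIdeal p)

theorem coordSupport_eq_true {A : Type} (p : affSch A) (a : A) :
    coordSupport p a = true ↔ MvPolynomial.X a ∉ pointIdeal p := by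
  simp [coordSupport]

theorem coordSupport_affMap {A B : Type} (f : B → MvPolynomial A ℂ) 
    (p : affSch A) (b : B) :
    coordSupport (affMap f p) b = true ↔ f b ∉ pointIdeal p := by
  have : coordSupport (affMap f p) b = true ↔
      MvPolynomial.aeval f (MvPolynomial.X b : MvPolynomial B ℂ) ∉ pointIdeal p :=
    coordSupport_eq_true _ _
  rw [this, MvPolynomial.aeval_X]

theorem coordSupport_affMap_X {A B : Type} (f : B → A) (p : affSch A) :
    coordSupport (affMap (fun b => MvPolynomial.X (f b)) p) = coordSupport p ∘ f := by
  ext b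
  rw [Bool.eq_iff_iff, coordSupport_affMap, Function.comp_apply, coordSupport_eq_true]

theorem coordSupport_affZero {A : Type} (p : affSch A) :
    coordSupport (affZero A p) = fun o => o.elim false (coordSupport p) := by
  ext (_ | a)
  · rw [Bool.eq_iff_iff, coordSupport_affMap]
    simp
  · rw [Bool.eq_iff_iff, coordSupport_affMap]
    exact (coordSupport_eq_true p a).symm

/-- The section of the projection of affine space that sets the forgotten coordinate to `1`. -/
noncomputable abbrev affOne (A : Type) : affSch A ⟶ affSch (Option A) :=
  affMap (fun o => o.elim 1 MvPolynomial.X)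

theorem coordSupport_affOne {A : Type} (p : affSch A) :
    coordSupport (affOne A p) = fun o => o.elim true (coordSupport p) := by
  ext (_ | a)
  · rw [Bool.eq_iff_iff, coordSupport_affMap]
    exact iff_of_true (fun h => (PrimeSpectrum.isPrime _).ne_top ((Ideal.eq_top_iff_one _).2 h)) rfl
  · rw [Bool.eq_iff_iff, coordSupport_affMap]
    exact (coordSupport_eq_true p a).symm

theorem mem_coordOpen {A : Type} (a : A) (p : affSch A) :
    p ∈ coordOpen a ↔ coordSupport p a = true := (coordSupport_eq_true p a).symm

theorem affZero_preimage_affProj {A : Type} (V : (affSch A).Opens) :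
    affZero A ⁻¹ᵁ (affProj A ⁻¹ᵁ V) = V := by
  rw [← Scheme.Hom.comp_preimage, affMap_comp]
  simp only [MvPolynomial.aeval_X, Option.elim_some]
  rw [affMap_X, Scheme.Hom.id_preimage]

/-- The class of an open subset of affine space is determined recursively by slicing it with a
coordinate hyperplane, if the complement of the hyperplane is a product. -/
theorem cls_openVariety_slice (A : Type) [Finite A] (U : (affSch (Option A)).Opens)
    (V : (affSch A).Opens) (hV : U ⊓ coordOpen none = (affProj A ⁻¹ᵁ V) ⊓ coordOpen none) :
    K0Var.cls (openVariety (Option A) U) = K0Var.cls (openVariety A (affZero A ⁻¹ᵁ U)) +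
      K0Var.cls (openVariety A V) * (lefschetz - 1) := by
  -- Cutting the product `V × 𝔸¹` by the same hyperplane shows that the part off the hyperplane has
  -- class `[V] (𝕃 - 1)`.
  have h2 := cls_openVariety_option A (affProj A ⁻¹ᵁ V)
  rw [affZero_preimage_affProj, cls_preimage_affProj, ← hV] at h2
  rw [cls_openVariety_option A U, ← sub_eq_iff_eq_add'.2 h2, mul_sub_one]

/-- Membership in `U` depends only on which coordinates vanish. Off the hyperplane the forgotten
coordinate can therefore be replaced by `1`, which exhibits a product. -/
theorem inf_coordOpen_eq {A : Type} (F : (Option A → Bool) → Prop) (U : (affSch (Option A)).Opens)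
    (hU : ∀ p : affSch (Option A), p ∈ U ↔ F (coordSupport p)) :
    U ⊓ coordOpen none = (affProj A ⁻¹ᵁ (affOne A ⁻¹ᵁ U)) ⊓ coordOpen none := by
  refine TopologicalSpace.Opens.ext (Set.ext fun p => and_congr_left fun hp => ?_)
  replace hp := (mem_coordOpen _ _).1 hp
  rw [SetLike.mem_coe, SetLike.mem_coe, Scheme.Hom.mem_preimage, Scheme.Hom.mem_preimage,
    hU, hU, coordSupport_affOne, coordSupport_affMap_X]
  apply iff_of_eq
  congr 1
  ext (_ | a)
  · exact hp
  · rfl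

theorem sum_option_bool {A R : Type*} [Fintype A] [DecidableEq A] [CommRing R] (F : (Option A → Bool) → Prop)
    [DecidablePred F] (y : R) :
    (∑ s : Option A → Bool, if F s then ∏ a, (if s a then y else 1) else 0) =
      (∑ s : A → Bool, if F (fun o => o.elim false s) then ∏ a, (if s a then y else 1) else 0) +
      (∑ s : A → Bool, if F (fun o => o.elim true s) then ∏ a, (if s a then y else 1) else 0) *
        y := by
  have h : ∀ s : (Option A) → Bool, s = fun o => o.elim (s none) fun a => s (some a) :=
    fun s => by ext (_ | a) <;> rfl
  rw [← (Equiv.piOptionEquivProd (β := fun _ : Option A => Bool)).symm.sum_comp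
    (fun s => if F s then ∏ a, (if s a then y else 1) else 0),
    Fintype.sum_prod_type, Fintype.sum_bool, Finset.sum_mul, add_comm]
  congr 1
  · refine Finset.sum_congr rfl fun s _ => ?_
    rw [h (Equiv.piOptionEquivProd.symm _), Fintype.prod_option]
    simp [Equiv.piOptionEquivProd]
    rfl
  · refine Finset.sum_congr rfl fun s _ => ?_
    rw [h (Equiv.piOptionEquivProd.symm _), Fintype.prod_option]
    simp [Equiv.piOptionEquivProd, mul_comm]
    rfl

open Classical in
/-- The class of an open subset of affine space that is a union of torus orbits. -/
theorem cls_openVariety_eq_sum (A : Type) [Fintype A] (F : (A → Bool) → Prop)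
    (U : (affSch A).Opens)
    (hU : ∀ p : affSch A, p ∈ U ↔ F (coordSupport p)) :
    K0Var.cls (openVariety A U) =
      ∑ s : A → Bool, if F s then ∏ a, (if s a then lefschetz - 1 else 1) else 0 := by
  revert F U hU
  refine Fintype.induction_empty_option (P := fun A _ => ∀ (F : (A → Bool) → Prop)
    (U : (affSch A).Opens),
    (∀ p : affSch A, p ∈ U ↔ F (coordSupport p)) →
    K0Var.cls (openVariety A U) =
      ∑ s : A → Bool, if F s then ∏ a, (if s a then lefschetz - 1 else 1) else 0) ?_ ?_ ?_ A
  · intro A B _ e ih F U hU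
    let := Fintype.ofEquiv B e.symm
    have key := ih (fun s => F (s ∘ e.symm))
      (affMap (fun b : B => (MvPolynomial.X (e.symm b) : MvPolynomial A ℂ)) ⁻¹ᵁ U) ?_
    · rw [cls_openVariety_equiv] at key
      rw [key]
      refine Fintype.sum_equiv (e.arrowCongr (Equiv.refl _)) _ _ fun s => ?_
      congr 1
      exact Fintype.prod_equiv e _ _ fun a => by simp
    · intro p
      rw [Scheme.Hom.mem_preimage, hU, coordSupport_affMap_X]
  · intro F U hU
    rw [Fintype.sum_eq_single (fun a => a.elim) fun s hs => (hs (Subsingleton.elim _ _)).elim]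
    by_cases h : F fun a => a.elim
    · have : U = ⊤ := by
        refine TopologicalSpace.Opens.ext (Set.ext fun p => iff_of_true ?_ trivial)
        exact (hU p).2 ((congrArg F (Subsingleton.elim _ _)).mp h)
      rw [this, cls_openVariety_empty, if_pos h, Fintype.prod_empty]
    · have : U = ⊥ := by
        refine TopologicalSpace.Opens.ext (Set.ext fun p => iff_of_false ?_ id)
        exact fun hp => h ((congrArg F (Subsingleton.elim _ _)).mp ((hU p).1 hp))
      rw [this, cls_openVariety_bot, if_neg h]
  · intro A _ ih F U hU
    rw [cls_openVariety_slice A U _ (inf_coordOpen_eq F U hU),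
      ih (fun s => F fun o => o.elim false s), ih (fun s => F fun o => o.elim true s)]
    · convert (sum_option_bool F (lefschetz - 1)).symm
    · intro p
      rw [Scheme.Hom.mem_preimage, hU, coordSupport_affOne]
    · intro p
      rw [Scheme.Hom.mem_preimage, hU, coordSupport_affZero]

/-! ### From semistable representations to relations on the vertex set. -/

/-- The set `T` of vertices is closed under the arrows of the relation `E`. -/
def IsClosedUnder {W : Type*} (E : Finset (W × W)) (T : Finset W) : Prop :=
  ∀ p ∈ E, p.1 ∈ T → p.2 ∈ T

open Classical in
/-- The pairs of vertices joined by an arrow of `s`. -/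
noncomputable def sigmaSupport {ι : Type*} [Fintype ι] {n : ι → ℕ} (s : (Σ i, Fin (n i)) → Bool) :
    Finset ι :=
  Finset.univ.filter fun i => ∃ k, s ⟨i, k⟩ = true

/-- A subspace of a one-dimensional space is `⊥` or `⊤`, so a subrepresentation is the set of
vertices where it is `⊤`, and this set must be closed under the arrows with nonzero scalar.
Semistability thus depends only on the support of the representation. -/
theorem isSemistableRep_iff {W : Type} [Fintype W] [DecidableEq W] (r : W → W → ℕ) (ζ : W → ℂ)
    {k : Type} [Field k] (c : QArrow r → k) (s : QArrow r → Bool)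
    (hs : ∀ a, s a = true ↔ c a ≠ 0) :
    IsSemistableRep r ζ c ↔ ∀ T : Finset W, T.Nonempty → IsClosedUnder (sigmaSupport s) T →
      zslope (∑ i ∈ T, ζ i) ≤ zslope (∑ i, ζ i) := by
  have hrank : ∀ T : Finset W, (∑ i, (Module.finrank k
      ((if i ∈ T then ⊤ else ⊥ : Submodule k k)) : ℂ) * ζ i) = ∑ i ∈ T, ζ i := by
    intro T
    rw [← Finset.sum_filter_add_sum_filter_not Finset.univ (· ∈ T)]
    rw [Finset.sum_congr rfl (g := ζ), Finset.sum_eq_zero (s := Finset.univ.filter (· ∉ T))]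
    · simp
    · intro i hi
      rw [if_neg (Finset.mem_filter.1 hi).2]
      simp
    · intro i hi
      rw [if_pos (Finset.mem_filter.1 hi).2]
      simp
  constructor
  · intro h T hT hcl
    rw [← hrank T]
    refine h (fun i => if i ∈ T then ⊤ else ⊥) ?_ ?_
    · intro a x hx
      by_cases h1 : a.1.1 ∈ T
      · by_cases h2 : c a = 0
        · rw [h2, zero_mul]
          exact Submodule.zero_mem _
        · rw [if_pos (hcl a.1 (Finset.mem_filter.2 ⟨Finset.mem_univ _, a.2, (hs a).2 h2⟩) h1)]
          trivial
      · rw [if_neg h1, Submodule.mem_bot] at hx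
        rw [hx, mul_zero]
        exact Submodule.zero_mem _
    · obtain ⟨i, hi⟩ := hT
      exact ⟨i, by rw [if_pos hi]; exact top_ne_bot⟩
  · intro h N hN hne
    have := Classical.decPred fun i => N i ≠ ⊥
    obtain ⟨T, hT⟩ : ∃ T : Finset W, ∀ i, i ∈ T ↔ N i ≠ ⊥ :=
      ⟨Finset.univ.filter (fun i => N i ≠ ⊥), fun i => by
        rw [Finset.mem_filter]
        exact and_iff_right (Finset.mem_univ _)⟩
    have hNT : ∀ i, (if i ∈ T then ⊤ else ⊥) = N i := by
      intro i
      by_cases hi : N i = ⊥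
      · rw [if_neg (fun h => (hT i).1 h hi), hi]
      · rw [if_pos ((hT i).2 hi), (Ideal.eq_bot_or_top (N i)).resolve_left hi]
    have hsum : ∑ i, (Module.finrank k (N i) : ℂ) * ζ i = ∑ i ∈ T, ζ i := by
      rw [← hrank T]
      exact Finset.sum_congr rfl fun i _ => by rw [hNT i]
    rw [hsum]
    apply h
    · obtain ⟨i, hi⟩ := hne
      exact ⟨i, (hT i).2 hi⟩
    · intro p hp h1
      obtain ⟨k', hk'⟩ := (Finset.mem_filter.1 hp).2
      rw [hT] at h1 ⊢
      intro hb
      have h2 := hN ⟨p, k'⟩ 1 (by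
        rw [(Ideal.eq_bot_or_top (N p.1)).resolve_left h1]
        trivial)
      change c ⟨p, k'⟩ * 1 ∈ N p.2 at h2
      rw [hb, mul_one, Submodule.mem_bot] at h2
      exact (hs _).1 hk' h2

/-- The ring homomorphism `K₀(Var_ℂ) → 𝒱`. -/
noncomputable def K0Var.toMotV : K0Var →+* MotV :=
  (Algebra.TensorProduct.includeRight : K0Var →ₐ[ℤ[X]] HalfField ⊗[ℤ[X]] K0Var).toRingHom

theorem toMotV_cls (X : CVariety) : K0Var.toMotV (K0Var.cls X) = MotV.cls X := rfl

theorem toMotV_lefschetz :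
    K0Var.toMotV lefschetz = algebraMap HalfField MotV (HalfField.t ^ 2) := by
  have h1 : algebraMap ℤ[X] K0Var X = lefschetz := Polynomial.eval₂_X _ _
  have h2 : algebraMap ℤ[X] HalfField X = HalfField.t ^ 2 := Polynomial.eval₂_X _ _
  rw [← h1, ← h2]
  exact ((Algebra.TensorProduct.includeRight :
    K0Var →ₐ[ℤ[X]] HalfField ⊗[ℤ[X]] K0Var).commutes X)

open Classical in
theorem motV_cls_openVariety (A : Type) [Fintype A] (F : (A → Bool) → Prop)
    (U : (affSch A).Opens) (hU : ∀ p : affSch A, p ∈ U ↔ F (coordSupport p)) :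
    MotV.cls (openVariety A U) = algebraMap HalfField MotV
      (∑ s : A → Bool, if F s then ∏ a, (if s a then HalfField.t ^ 2 - 1 else 1) else 0) := by
  rw [← toMotV_cls, cls_openVariety_eq_sum A F U hU]
  simp only [map_sum, apply_ite (f := K0Var.toMotV), map_prod, map_sub, toMotV_lefschetz, map_one,
    map_zero, apply_ite (f := algebraMap HalfField MotV)]

section

variable {R : Type*} [CommRing R]

theorem sum_prod_ite_bool (n : ℕ) (y : R) :
    ∑ b : Fin n → Bool, ∏ k, (if b k then y else 1) = (1 + y) ^ n := by
  have := Finset.prod_univ_sum (R := R) (fun _ : Fin n => (Finset.univ : Finset Bool))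
    (fun _ b => if b = true then y else 1)
  rw [Fintype.piFinset_univ] at this
  rw [← this]
  simp [add_comm]

/-- With `y = q - 1` this counts `n` parallel arrows: the tuples that are not all zero have class
`q^n - 1`, the zero tuple has class `1`. -/
theorem sum_bool_exists (n : ℕ) (y : R) (q : Prop) [Decidable q] :
    (∑ b : Fin n → Bool, if (q ↔ ∃ k, b k = true) then ∏ k, (if b k then y else 1) else 0) =
      if q then (1 + y) ^ n - 1 else 1 := by
  have h0 : (∑ b : Fin n → Bool, if ¬ ∃ k, b k = true then ∏ k, (if b k then y else 1) else 0) =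
      1 := by
    rw [Finset.sum_eq_single (fun _ => false)]
    · simp
    · intro b _ hb
      rw [if_neg]
      intro h
      exact hb (funext fun k => by simpa using not_exists.1 h k)
    · simp
  by_cases hq : q
  · simp only [hq, true_iff, if_true]
    rw [eq_sub_iff_add_eq, ← sum_prod_ite_bool]
    refine (congrArg (_ + ·) h0.symm).trans ?_
    rw [← Finset.sum_add_distrib]
    refine Finset.sum_congr rfl fun b _ => ?_
    by_cases h : ∃ k, b k = true <;> simp [h]
  · simp only [hq, false_iff, if_false]
    exact h0

-- Closedness of vertex sets sees only which ordered pairs are joined by a nonzero arrow. The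
-- supports are grouped by this relation `E`, and each pair in `E` contributes the class of nonzero
-- tuples.
open Classical in
theorem sum_sigma_bool {ι : Type*} [Fintype ι] [DecidableEq ι] (n : ι → ℕ) (F : Finset ι → Prop)
    (y : R) :
    (∑ s : (Σ i, Fin (n i)) → Bool,
      if F (sigmaSupport s) then ∏ a, (if s a then y else 1) else 0) =
    ∑ E : Finset ι, if F E then ∏ i ∈ E, ((1 + y) ^ n i - 1) else 0 := by
  have key : ∀ E : Finset ι, (∑ s : (Σ i, Fin (n i)) → Bool,
      if sigmaSupport s = E then ∏ a, (if s a then y else 1) else 0) =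
      ∏ i ∈ E, ((1 + y) ^ n i - 1) := by
    intro E
    have h1 := Finset.prod_univ_sum (R := R)
      (fun i : ι => (Finset.univ : Finset (Fin (n i) → Bool)))
      (fun i b => if (i ∈ E ↔ ∃ k, b k = true) then ∏ k, (if b k then y else 1) else 0)
    simp only [sum_bool_exists, Fintype.piFinset_univ] at h1
    rw [Finset.prod_ite_mem, Finset.univ_inter] at h1
    rw [h1]
    refine Fintype.sum_equiv (Equiv.piCurry fun _ _ => Bool) _ _ fun s => ?_
    rw [Fintype.prod_ite_zero]
    have : sigmaSupport s = E ↔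
        ∀ i, i ∈ E ↔ ∃ k, (Equiv.piCurry fun _ _ => Bool) s i k = true := by
      rw [Finset.ext_iff]
      refine forall_congr' fun i => ?_
      simp [sigmaSupport, Equiv.piCurry, Sigma.curry, iff_comm]
    simp only [this, Fintype.prod_sigma]
    rfl
  have hF : ∀ E : Finset ι, (if F E then ∏ i ∈ E, ((1 + y) ^ n i - 1) else 0) =
      ∑ s : (Σ i, Fin (n i)) → Bool, if sigmaSupport s = E then
        (if F E then ∏ a, (if s a then y else 1) else 0) else 0 := by
    intro E
    rw [← key]
    by_cases hE : F E <;> simp [hE]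
  simp only [hF]
  rw [Finset.sum_comm]
  refine Finset.sum_congr rfl fun s _ => ?_
  rw [Finset.sum_eq_single (sigmaSupport s)]
  · simp
  · intro E _ hE
    simp [hE.symm]
  · simp

end

-- From here on no geometry remains: the motivic invariant is a weighted count of relations, with
-- weight `q^r - 1` for a pair joined by `r` arrows.
open Classical in
theorem fAbelian_eq {W : Type} [Fintype W] (r : W → W → ℕ) (ζ : W → ℂ) :
    fAbelian r ζ = algebraMap HalfField MotV
      (HalfField.t ^ ((Fintype.card W : ℤ) - (Fintype.card (QArrow r) : ℤ)) *
        ((HalfField.t ^ 2 - 1) ^ Fintype.card W)⁻¹ *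
      ∑ E : Finset (W × W), if (∀ T : Finset W, T.Nonempty → IsClosedUnder E T →
        zslope (∑ i ∈ T, ζ i) ≤ zslope (∑ i, ζ i)) then
          ∏ p ∈ E, ((HalfField.t ^ 2) ^ r p.1 p.2 - 1) else 0) := by
  have h := sum_sigma_bool (fun p : W × W => r p.1 p.2) (fun E => ∀ T : Finset W, T.Nonempty →
    IsClosedUnder E T → zslope (∑ i ∈ T, ζ i) ≤ zslope (∑ i, ζ i)) (HalfField.t ^ 2 - 1)
  rw [add_sub_cancel] at h
  rw [fAbelian, motV_cls_openVariety (QArrow r) (fun s => ∀ T : Finset W, T.Nonempty →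
    IsClosedUnder (sigmaSupport s) T → zslope (∑ i ∈ T, ζ i) ≤ zslope (∑ i, ζ i)),
    Algebra.smul_def, ← map_mul]
  · refine congrArg (algebraMap HalfField MotV) (congrArg (HMul.hMul _) ?_)
    convert h
  intro p
  exact isSemistableRep_iff r ζ (pointRep p) (coordSupport p) fun a =>
    (coordSupport_eq_true p a).trans (not_congr (pointRep_eq_zero p a)).symm

/-! ### The Harder–Narasimhan recursion for relations on a finite set. -/

section

variable {U R : Type*} [DecidableEq U] [CommRing R]

/-- Every nonempty set of vertices in `X` closed under `E` has the property `D`. -/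
def SubsHave (D : Finset U → Prop) (X : Finset U) (E : Finset (U × U)) : Prop :=
  ∀ T ⊆ X, T.Nonempty → IsClosedUnder E T → D T

open Classical in
/-- The weighted number of the relations on `X` whose nonempty closed subsets all have the
property `D`. -/
noncomputable def repSum (w : U × U → R) (D : Finset U → Prop) (X : Finset U) : R :=
  ∑ E ∈ (X ×ˢ X).powerset with SubsHave D X E, ∏ p ∈ E, w p

/-- The part of a relation inside `T`. -/
def relIn (T : Finset U) (E : Finset (U × U)) : Finset (U × U) :=
  E.filter fun p => p.1 ∈ T ∧ p.2 ∈ T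

/-- The part of a relation outside `T`. -/
def relOut (T : Finset U) (E : Finset (U × U)) : Finset (U × U) :=
  E.filter fun p => p.1 ∉ T ∧ p.2 ∉ T

/-- `T` is the maximal destabilizing subset of `E` with respect to `θ`. -/
def IsMaxDestab (θ : U → ℤ) (X : Finset U) (E : Finset (U × U)) (T : Finset U) : Prop :=
  T ⊆ X ∧ ∑ i ∈ T, θ i = 0 ∧ IsClosedUnder E T ∧
    SubsHave (fun T' => 0 ≤ ∑ i ∈ T', θ i) T (relIn T E) ∧
    SubsHave (fun T' => 0 < ∑ i ∈ T', θ i) (X \ T) (relOut T E)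

/-- For `N` closed, `N ∩ T` is closed inside `T` and `N \ T` is closed outside `T`, and `θ` is
additive over these two parts. -/
theorem IsMaxDestab.subsHave {θ : U → ℤ} {X : Finset U} {E : Finset (U × U)} {T : Finset U}
    (hT : IsMaxDestab θ X E T) :
    SubsHave (fun T' => 0 ≤ ∑ i ∈ T', θ i) X E := by
  obtain ⟨hTX, -, hcl, h1, h2⟩ := hT
  intro N hN _ hclN
  rw [← Finset.sum_inter_add_sum_sdiff N T]
  refine add_nonneg ?_ ?_
  · rcases (N ∩ T).eq_empty_or_nonempty with h | h
    · rw [h, Finset.sum_empty]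
    · refine h1 _ Finset.inter_subset_right h fun p hp hp1 => ?_
      rw [relIn, Finset.mem_filter] at hp
      exact Finset.mem_inter.2 ⟨hclN p hp.1 (Finset.mem_inter.1 hp1).1, hp.2.2⟩
  · rcases (N \ T).eq_empty_or_nonempty with h | h
    · rw [h, Finset.sum_empty]
    · refine (h2 _ (Finset.sdiff_subset_sdiff hN subset_rfl) h fun p hp hp1 => ?_).le
      rw [relOut, Finset.mem_filter] at hp
      exact Finset.mem_sdiff.2 ⟨hclN p hp.1 (Finset.mem_sdiff.1 hp1).1, hp.2.2⟩

/-- If `T' \ T` were nonempty it would have positive `θ`, while `T' ∩ T` has nonnegative `θ`; but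
the total `θ` of `T'` is zero. Applied in both directions this gives uniqueness. -/
theorem IsMaxDestab.subset {θ : U → ℤ} {X : Finset U} {E : Finset (U × U)} {T T' : Finset U}
    (hT : IsMaxDestab θ X E T) (hT' : IsMaxDestab θ X E T') : T' ⊆ T := by
  obtain ⟨hTX, -, hcl, -, h2⟩ := hT
  obtain ⟨hTX', h0, hcl', h1, -⟩ := hT'
  rw [← Finset.sdiff_eq_empty_iff_subset]
  by_contra hne
  have h3 : 0 < ∑ i ∈ T' \ T, θ i := h2 (T' \ T) (Finset.sdiff_subset_sdiff hTX' subset_rfl)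
    (Finset.nonempty_iff_ne_empty.2 hne) fun p hp hp1 => by
      rw [relOut, Finset.mem_filter] at hp
      exact Finset.mem_sdiff.2 ⟨hcl' p hp.1 (Finset.mem_sdiff.1 hp1).1, hp.2.2⟩
  have h4 : 0 ≤ ∑ i ∈ T' ∩ T, θ i := by
    rcases (T' ∩ T).eq_empty_or_nonempty with h | h
    · rw [h, Finset.sum_empty]
    · refine h1 _ Finset.inter_subset_left h fun p hp hp1 => ?_
      rw [relIn, Finset.mem_filter] at hp
      exact Finset.mem_inter.2 ⟨hp.2.2, hcl p hp.1 (Finset.mem_inter.1 hp1).2⟩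
  rw [← Finset.sum_inter_add_sum_sdiff T' T] at h0
  omega

/-- Take a closed subset with `θ = 0` of maximal cardinality. A closed set `N` in its complement
with `θ = 0` could be added to it, so a nonempty `N` has `θ > 0`. -/
theorem exists_isMaxDestab {θ : U → ℤ} {X : Finset U} {E : Finset (U × U)}
    (h : SubsHave (fun T' => 0 ≤ ∑ i ∈ T', θ i) X E) :
    ∃ T, IsMaxDestab θ X E T := by
  classical
  obtain ⟨T, hT, hmax⟩ := Finset.exists_max_image
    (X.powerset.filter fun T => ∑ i ∈ T, θ i = 0 ∧ IsClosedUnder E T) Finset.card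
    ⟨∅, by simp [IsClosedUnder]⟩
  simp only [Finset.mem_filter, Finset.mem_powerset] at hT hmax
  obtain ⟨hTX, h0, hcl⟩ := hT
  refine ⟨T, hTX, h0, hcl, ?_, ?_⟩
  · intro N hN hne hclN
    refine h N (hN.trans hTX) hne fun p hp hp1 => hclN p ?_ hp1
    exact Finset.mem_filter.2 ⟨hp, hN hp1, hcl p hp (hN hp1)⟩
  · intro N hN hne hclN
    have hdisj : Disjoint T N := Finset.disjoint_left.2 fun x hx hx' =>
      (Finset.mem_sdiff.1 (hN hx')).2 hx
    have hcl' : IsClosedUnder E (T ∪ N) := by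
      intro p hp hp1
      by_cases h2 : p.2 ∈ T
      · exact Finset.mem_union_left _ h2
      · rcases Finset.mem_union.1 hp1 with h1 | h1
        · exact (h2 (hcl p hp h1)).elim
        · exact Finset.mem_union_right _ (hclN p (Finset.mem_filter.2
            ⟨hp, (Finset.mem_sdiff.1 (hN h1)).2, h2⟩) h1)
    have hsub : T ∪ N ⊆ X := Finset.union_subset hTX (hN.trans Finset.sdiff_subset)
    have hsum : ∑ i ∈ T ∪ N, θ i = ∑ i ∈ N, θ i := by
      rw [Finset.sum_union hdisj, h0, zero_add]
    have hge : 0 ≤ ∑ i ∈ T ∪ N, θ i := h _ hsub (hne.mono Finset.subset_union_right) hcl'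
    rw [hsum] at hge
    refine lt_of_le_of_ne hge fun heq => ?_
    have := hmax _ ⟨hsub, hsum.trans heq.symm, hcl'⟩
    rw [Finset.card_union_of_disjoint hdisj] at this
    have := hne.card_pos
    omega

/-- The part of a relation that leads into `T` from outside. -/
def relInto (T : Finset U) (E : Finset (U × U)) : Finset (U × U) :=
  E.filter fun p => p.1 ∉ T ∧ p.2 ∈ T

theorem relIn_union_relOut_union_relInto {T : Finset U} {E : Finset (U × U)}
    (h : IsClosedUnder E T) : relIn T E ∪ relOut T E ∪ relInto T E = E := by
  ext p
  have := h p
  simp only [relIn, relOut, relInto, Finset.mem_union, Finset.mem_filter]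
  tauto

section

variable {X T : Finset U} {E₁ E₂ E₃ : Finset (U × U)} (h₁ : E₁ ⊆ T ×ˢ T)
  (h₂ : E₂ ⊆ (X \ T) ×ˢ (X \ T)) (h₃ : E₃ ⊆ (X \ T) ×ˢ T)

include h₁ h₂ h₃

theorem mem_pieces (p : U × U) : (p ∈ E₁ → p.1 ∈ T ∧ p.2 ∈ T) ∧ (p ∈ E₂ → p.1 ∉ T ∧ p.2 ∉ T) ∧
    (p ∈ E₃ → p.1 ∉ T ∧ p.2 ∈ T) :=
  ⟨fun h => Finset.mem_product.1 (h₁ h),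
    fun h => ⟨(Finset.mem_sdiff.1 (Finset.mem_product.1 (h₂ h)).1).2,
      (Finset.mem_sdiff.1 (Finset.mem_product.1 (h₂ h)).2).2⟩,
    fun h => ⟨(Finset.mem_sdiff.1 (Finset.mem_product.1 (h₃ h)).1).2,
      (Finset.mem_product.1 (h₃ h)).2⟩⟩

theorem relIn_pieces : relIn T (E₁ ∪ E₂ ∪ E₃) = E₁ := by
  ext p
  have := mem_pieces h₁ h₂ h₃ p
  simp only [relIn, Finset.mem_union, Finset.mem_filter]
  tauto

theorem relOut_pieces : relOut T (E₁ ∪ E₂ ∪ E₃) = E₂ := by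
  ext p
  have := mem_pieces h₁ h₂ h₃ p
  simp only [relOut, Finset.mem_union, Finset.mem_filter]
  tauto

theorem relInto_pieces : relInto T (E₁ ∪ E₂ ∪ E₃) = E₃ := by
  ext p
  have := mem_pieces h₁ h₂ h₃ p
  simp only [relInto, Finset.mem_union, Finset.mem_filter]
  tauto

theorem isClosedUnder_pieces : IsClosedUnder (E₁ ∪ E₂ ∪ E₃) T := by
  intro p
  have := mem_pieces h₁ h₂ h₃ p
  simp only [Finset.mem_union]
  tauto

theorem prod_pieces (w : U × U → R) :
    ∏ p ∈ E₁ ∪ E₂ ∪ E₃, w p = (∏ p ∈ E₁, w p) * (∏ p ∈ E₂, w p) * ∏ p ∈ E₃, w p := by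
  rw [Finset.prod_union, Finset.prod_union]
  · refine Finset.disjoint_left.2 fun p => ?_
    have := mem_pieces h₁ h₂ h₃ p
    tauto
  · refine Finset.disjoint_left.2 fun p => ?_
    have := mem_pieces h₁ h₂ h₃ p
    simp only [Finset.mem_union]
    tauto

end

-- A relation under which `T` is closed has no arrow leaving `T`, so it splits into its parts inside
-- `T`, outside `T` and into `T`. The first two carry the conditions; the third is an arbitrary
-- subset of `(X \ T) × T`, which gives the product of the `1 + w p`.
open Classical in
theorem sum_isMaxDestab (w : U × U → R) (θ : U → ℤ) (X T : Finset U) (hTX : T ⊆ X)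
    (hT : ∑ i ∈ T, θ i = 0) :
    (∑ E ∈ (X ×ˢ X).powerset with IsMaxDestab θ X E T, ∏ p ∈ E, w p) =
      repSum w (fun T' => 0 ≤ ∑ i ∈ T', θ i) T * repSum w (fun T' => 0 < ∑ i ∈ T', θ i) (X \ T) *
        ∏ p ∈ (X \ T) ×ˢ T, (1 + w p) := by
  rw [Finset.prod_one_add, repSum, repSum, Finset.sum_mul_sum, ← Finset.sum_product',
    Finset.sum_mul_sum, ← Finset.sum_product']
  refine Finset.sum_bij' (fun E _ => ((relIn T E, relOut T E),
    relInto T E)) (fun q _ => q.1.1 ∪ q.1.2 ∪ q.2) ?_ ?_ ?_ ?_ ?_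
  · intro E hE
    simp only [Finset.mem_filter, Finset.mem_powerset] at hE
    simp only [Finset.mem_product, Finset.mem_filter, Finset.mem_powerset]
    refine ⟨⟨⟨?_, hE.2.2.2.2.1⟩, ⟨?_, hE.2.2.2.2.2⟩⟩, ?_⟩
    · intro p hp
      exact Finset.mem_product.2 (Finset.mem_filter.1 hp).2
    · intro p hp
      obtain ⟨hp, h1, h2⟩ := Finset.mem_filter.1 hp
      have := Finset.mem_product.1 (hE.1 hp)
      exact Finset.mem_product.2 ⟨Finset.mem_sdiff.2 ⟨this.1, h1⟩, Finset.mem_sdiff.2 ⟨this.2, h2⟩⟩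
    · intro p hp
      obtain ⟨hp, h1, h2⟩ := Finset.mem_filter.1 hp
      have := Finset.mem_product.1 (hE.1 hp)
      exact Finset.mem_product.2 ⟨Finset.mem_sdiff.2 ⟨this.1, h1⟩, h2⟩
  · rintro ⟨⟨E₁, E₂⟩, E₃⟩ hq
    simp only [Finset.mem_product, Finset.mem_filter, Finset.mem_powerset] at hq ⊢
    obtain ⟨⟨⟨h₁, hs₁⟩, ⟨h₂, hs₂⟩⟩, h₃⟩ := hq
    refine ⟨?_, hTX, hT, isClosedUnder_pieces h₁ h₂ h₃, ?_, ?_⟩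
    · exact Finset.union_subset (Finset.union_subset (h₁.trans (Finset.product_subset_product hTX hTX))
        (h₂.trans (Finset.product_subset_product Finset.sdiff_subset Finset.sdiff_subset)))
        (h₃.trans (Finset.product_subset_product Finset.sdiff_subset hTX))
    · rwa [relIn_pieces h₁ h₂ h₃]
    · rwa [relOut_pieces h₁ h₂ h₃]
  · intro E hE
    exact relIn_union_relOut_union_relInto (Finset.mem_filter.1 hE).2.2.2.1
  · rintro ⟨⟨E₁, E₂⟩, E₃⟩ hq
    simp only [Finset.mem_product, Finset.mem_filter, Finset.mem_powerset] at hq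
    obtain ⟨⟨⟨h₁, -⟩, ⟨h₂, -⟩⟩, h₃⟩ := hq
    simp only [relIn_pieces h₁ h₂ h₃, relOut_pieces h₁ h₂ h₃, relInto_pieces h₁ h₂ h₃]
  · intro E hE
    simp only [Finset.mem_filter, Finset.mem_powerset] at hE
    rw [← prod_pieces (X := X) (T := T), relIn_union_relOut_union_relInto hE.2.2.2.1]
    · intro p hp
      exact Finset.mem_product.2 (Finset.mem_filter.1 hp).2
    · intro p hp
      obtain ⟨hp, h1, h2⟩ := Finset.mem_filter.1 hp
      have := Finset.mem_product.1 (hE.1 hp)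
      exact Finset.mem_product.2 ⟨Finset.mem_sdiff.2 ⟨this.1, h1⟩, Finset.mem_sdiff.2 ⟨this.2, h2⟩⟩
    · intro p hp
      obtain ⟨hp, h1, h2⟩ := Finset.mem_filter.1 hp
      have := Finset.mem_product.1 (hE.1 hp)
      exact Finset.mem_product.2 ⟨Finset.mem_sdiff.2 ⟨this.1, h1⟩, h2⟩

open Classical in
/-- The Harder–Narasimhan recursion: a relation is determined by its maximal destabilizing subset
`T`, its restrictions to `T` and to the complement of `T`, and the arrows into `T`. -/
theorem repSum_nonneg_eq (w : U × U → R) (θ : U → ℤ) (X : Finset U) :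
    repSum w (fun T' => 0 ≤ ∑ i ∈ T', θ i) X = ∑ T ∈ X.powerset, if ∑ i ∈ T, θ i = 0 then
      repSum w (fun T' => 0 ≤ ∑ i ∈ T', θ i) T * repSum w (fun T' => 0 < ∑ i ∈ T', θ i) (X \ T) *
        ∏ p ∈ (X \ T) ×ˢ T, (1 + w p) else 0 := by
  have h1 : ∀ T ∈ X.powerset, (if ∑ i ∈ T, θ i = 0 then
      repSum w (fun T' => 0 ≤ ∑ i ∈ T', θ i) T * repSum w (fun T' => 0 < ∑ i ∈ T', θ i) (X \ T) *
        ∏ p ∈ (X \ T) ×ˢ T, (1 + w p) else 0) =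
      ∑ E ∈ (X ×ˢ X).powerset, if IsMaxDestab θ X E T then ∏ p ∈ E, w p else 0 := by
    intro T hT
    rw [← Finset.sum_filter]
    split_ifs with h0
    · exact (sum_isMaxDestab w θ X T (Finset.mem_powerset.1 hT) h0).symm
    · rw [Finset.filter_false_of_mem, Finset.sum_empty]
      exact fun E _ hE => h0 hE.2.1
  rw [Finset.sum_congr rfl h1, Finset.sum_comm, repSum, Finset.sum_filter]
  refine Finset.sum_congr rfl fun E hE => ?_
  rw [Finset.mem_powerset] at hE
  split_ifs with h
  · obtain ⟨T, hT⟩ := exists_isMaxDestab h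
    rw [Finset.sum_eq_single T, if_pos hT]
    · intro T' _ hne
      rw [if_neg]
      exact fun hT' => hne ((hT.subset hT').antisymm (hT'.subset hT))
    · exact fun h => (h (Finset.mem_powerset.2 hT.1)).elim
  · refine (Finset.sum_eq_zero fun T _ => if_neg fun hT => h hT.subsHave).symm

end

/-! ### Counts that depend only on the dimension vector. -/

section

variable {V U U' R : Type*} [CommRing R]

/-- The dimension vector of a set of labelled vertices. -/
noncomputable def dimVec (lab : U → V) (X : Finset U) : V →₀ ℕ :=
  ∑ u ∈ X, Finsupp.single (lab u) 1

theorem map_dimVec {G : Type*} [AddCommMonoid G] (θ : (V →₀ ℕ) →+ G) (lab : U → V) (X : Finset U) :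
    θ (dimVec lab X) = ∑ u ∈ X, θ (Finsupp.single (lab u) 1) := map_sum _ _ _

theorem dimVec_mono (lab : U → V) {X T : Finset U} (h : T ⊆ X) : dimVec lab T ≤ dimVec lab X :=
  Finset.sum_le_sum_of_subset h

theorem dimVec_eq_zero (lab : U → V) {X : Finset U} : dimVec lab X = 0 ↔ X = ∅ := by
  simp [dimVec, Finset.sum_eq_zero_iff, Finset.eq_empty_iff_forall_notMem]

theorem dimVec_map (lab : U' → V) (f : U ↪ U') (X : Finset U) :
    dimVec lab (X.map f) = dimVec (lab ∘ f) X := Finset.sum_map _ _ _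

theorem dimVec_apply [DecidableEq V] (lab : U → V) (X : Finset U) (i : V) :
    dimVec lab X i = (X.filter fun u => lab u = i).card := by
  rw [dimVec, Finset.card_filter, Finsupp.finsetSum_apply]
  exact Finset.sum_congr rfl fun u _ => by rw [Finsupp.single_apply]

/-- `repSum` for weights and conditions that depend only on the labels. -/
noncomputable def labSum [DecidableEq U] (w : V → V → R) (D : (V →₀ ℕ) → Prop) (lab : U → V)
    (X : Finset U) : R :=
  repSum (fun p => w (lab p.1) (lab p.2)) (fun T => D (dimVec lab T)) X

theorem labSum_map [DecidableEq U] [DecidableEq U'] (w : V → V → R) (D : (V →₀ ℕ) → Prop)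
    (lab : U' → V) (f : U ↪ U') (X : Finset U) :
    labSum w D lab (X.map f) = labSum w D (lab ∘ f) X := by
  classical
  rw [labSum, labSum, repSum, repSum]
  have hprod : X.map f ×ˢ X.map f = (X ×ˢ X).map (f.prodMap f) := by
    ext ⟨a, b⟩
    simp only [Finset.mem_product, Finset.mem_map, Prod.exists, Function.Embedding.coe_prodMap,
      Prod.map_apply, Prod.mk.injEq]
    constructor
    · rintro ⟨⟨x, hx, rfl⟩, ⟨y, hy, rfl⟩⟩
      exact ⟨x, y, ⟨hx, hy⟩, rfl, rfl⟩
    · rintro ⟨x, y, ⟨hx, hy⟩, rfl, rfl⟩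
      exact ⟨⟨x, hx, rfl⟩, ⟨y, hy, rfl⟩⟩
  have hcl : ∀ (E : Finset (U × U)) (T : Finset U),
      IsClosedUnder (E.map (f.prodMap f)) (T.map f) ↔ IsClosedUnder E T := by
    intro E T
    constructor
    · intro h p hp hp1
      have := h _ (Finset.mem_map_of_mem _ hp) (Finset.mem_map_of_mem f hp1)
      exact (Finset.mem_map' f).1 this
    · intro h p hp hp1
      obtain ⟨q, hq, rfl⟩ := Finset.mem_map.1 hp
      exact Finset.mem_map_of_mem f (h q hq ((Finset.mem_map' f).1 hp1))
  have hsub : ∀ E : Finset (U × U), SubsHave (fun T => D (dimVec lab T)) (X.map f)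
      (E.map (f.prodMap f)) ↔ SubsHave (fun T => D (dimVec (lab ∘ f) T)) X E := by
    intro E
    constructor
    · intro h T hT hne hT'
      rw [← dimVec_map]
      exact h _ (Finset.map_subset_map.2 hT) (hne.map) ((hcl _ _).2 hT')
    · intro h T hT hne hT'
      obtain ⟨T, hT1, rfl⟩ := Finset.subset_map_iff.1 hT
      rw [dimVec_map]
      exact h _ hT1 (Finset.map_nonempty.1 hne) ((hcl _ _).1 hT')
  symm
  refine Finset.sum_bij (fun E _ => E.map (f.prodMap f)) ?_ ?_ ?_ ?_
  · intro E hE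
    rw [Finset.mem_filter, Finset.mem_powerset] at hE ⊢
    exact ⟨hprod ▸ Finset.map_subset_map.2 hE.1, (hsub E).2 hE.2⟩
  · exact fun E _ E' _ h => Finset.map_injective _ h
  · intro E hE
    rw [Finset.mem_filter, Finset.mem_powerset, hprod] at hE
    obtain ⟨E, hE1, rfl⟩ := Finset.subset_map_iff.1 hE.1
    exact ⟨E, Finset.mem_filter.2 ⟨Finset.mem_powerset.2 hE1, (hsub E).1 hE.2⟩, rfl⟩
  · intro E _
    rw [Finset.prod_map]
    rfl

theorem card_fiber [DecidableEq V] (lab : U → V) (X : Finset U) (i : V) :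
    Nat.card {x : X // lab x = i} = (X.filter fun u => lab u = i).card := by
  rw [← Fintype.card_coe, ← Nat.card_eq_fintype_card]
  refine Nat.card_congr ((Equiv.subtypeSubtypeEquivSubtypeInter (· ∈ X) (lab · = i)).trans
    (Equiv.subtypeEquivRight fun u => ?_))
  rw [Finset.mem_filter]

theorem exists_equiv_of_dimVec_eq (lab : U → V) (lab' : U' → V) (X : Finset U) (Y : Finset U')
    (h : dimVec lab X = dimVec lab' Y) : ∃ e : X ≃ Y, ∀ x, lab' (e x) = lab x := by
  classical
  have h1 : ∀ i : V, Nonempty ({x : X // lab x = i} ≃ {y : Y // lab' y = i}) := by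
    intro i
    rw [← Finite.card_eq]
    have := DFunLike.congr_fun h i
    rw [dimVec_apply, dimVec_apply] at this
    rw [card_fiber, card_fiber, this]
  let e : X ≃ Y := (Equiv.sigmaFiberEquiv fun x : X => lab x).symm.trans
    ((Equiv.sigmaCongrRight fun i => (h1 i).some).trans (Equiv.sigmaFiberEquiv fun y : Y => lab' y))
  exact ⟨e, fun x => ((h1 (lab x)).some ⟨x, rfl⟩).2⟩

/-- Equal dimension vectors give a bijection of vertices that preserves labels, and the count is
invariant under such bijections. -/
theorem labSum_congr [DecidableEq U] [DecidableEq U'] (w : V → V → R) (D : (V →₀ ℕ) → Prop)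
    (lab : U → V) (lab' : U' → V) (X : Finset U) (Y : Finset U')
    (h : dimVec lab X = dimVec lab' Y) : labSum w D lab X = labSum w D lab' Y := by
  obtain ⟨e, he⟩ := exists_equiv_of_dimVec_eq lab lab' X Y h
  have hX : X = (Finset.univ : Finset X).map (Function.Embedding.subtype _) := by
    rw [Finset.univ_eq_attach, Finset.attach_map_val]
  have hY : Y = (Finset.univ : Finset X).map
      (e.toEmbedding.trans (Function.Embedding.subtype _)) := by
    rw [← Finset.map_map, Finset.univ_map_equiv_to_embedding, Finset.univ_eq_attach,
      Finset.attach_map_val]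
  rw [hX, hY, labSum_map, labSum_map]
  congr 1
  exact funext fun x => (he x).symm

/-- The standard set of vertices with dimension vector `m`. -/
abbrev StdVertex (m : V →₀ ℕ) := Σ i : m.support, Fin (m i)

/-- `labSum` for the standard set of vertices with dimension vector `m`. -/
noncomputable def dimSum [DecidableEq V] (w : V → V → R) (D : (V →₀ ℕ) → Prop) (m : V →₀ ℕ) : R :=
  labSum w D (fun x : StdVertex m => (x.1 : V)) Finset.univ

theorem dimVec_stdVertex (m : V →₀ ℕ) :
    dimVec (fun x : StdVertex m => (x.1 : V)) Finset.univ = m := by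
  rw [dimVec, Fintype.sum_sigma]
  simp only [Finset.sum_const, Finset.card_univ, Fintype.card_fin, Finsupp.smul_single,
    smul_eq_mul, mul_one]
  conv_rhs => rw [← Finsupp.sum_single m]
  exact Finset.sum_coe_sort m.support fun i => Finsupp.single i (m i)

theorem labSum_eq_dimSum [DecidableEq U] [DecidableEq V] (w : V → V → R) (D : (V →₀ ℕ) → Prop)
    (lab : U → V) (X : Finset U) : labSum w D lab X = dimSum w D (dimVec lab X) :=
  labSum_congr w D _ _ _ _ (dimVec_stdVertex _).symm

theorem labSum_congr_cond [DecidableEq U] (w : V → V → R) (D D' : (V →₀ ℕ) → Prop)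
    (lab : U → V) (X : Finset U) (h : ∀ m ≤ dimVec lab X, m ≠ 0 → (D m ↔ D' m)) :
    labSum w D lab X = labSum w D' lab X := by
  rw [labSum, labSum, repSum, repSum]
  congr 1
  ext E
  simp only [Finset.mem_filter]
  refine and_congr_right fun _ => ?_
  refine forall_congr' fun T => forall_congr' fun hT => forall_congr' fun hne =>
    forall_congr' fun _ => h _ (dimVec_mono lab hT) ?_
  rw [Ne, dimVec_eq_zero]
  exact hne.ne_empty

theorem dimSum_congr_cond [DecidableEq V] (w : V → V → R) (D D' : (V →₀ ℕ) → Prop) (m : V →₀ ℕ)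
    (h : ∀ m' ≤ m, m' ≠ 0 → (D m' ↔ D' m')) : dimSum w D m = dimSum w D' m :=
  labSum_congr_cond w D D' _ _ (by rwa [dimVec_stdVertex])

/-- The product of the factorials of the values of `m`. -/
noncomputable def dimFact (m : V →₀ ℕ) : ℕ := m.prod fun _ k => k.factorial

theorem dimFact_ne_zero (m : V →₀ ℕ) : (dimFact m : ℚ) ≠ 0 :=
  Nat.cast_ne_zero.2 (Finset.prod_ne_zero_iff.2 fun _ _ => Nat.factorial_ne_zero _)

theorem dimFact_zero : dimFact (0 : V →₀ ℕ) = 1 := Finsupp.prod_zero_index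

theorem dimFact_add_single [DecidableEq V] (m : V →₀ ℕ) (i : V) :
    dimFact (m + Finsupp.single i 1) = (m i + 1) * dimFact m := by
  have h : ∀ m' : V →₀ ℕ, m'.support ⊆ insert i m.support →
      dimFact m' = (m' i).factorial * ∏ j ∈ m.support.erase i, (m' j).factorial := by
    intro m' hm'
    rw [dimFact, Finsupp.prod_of_support_subset m' hm' _ (fun _ _ => rfl),
      ← Finset.insert_erase (Finset.mem_insert_self i m.support),
      Finset.prod_insert (Finset.notMem_erase _ _), Finset.erase_insert_eq_erase]
  rw [h m (Finset.subset_insert _ _), h (m + Finsupp.single i 1), Finsupp.add_apply,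
    Finsupp.single_eq_same, Nat.factorial_succ, mul_assoc]
  · congr 2
    refine Finset.prod_congr rfl fun j hj => ?_
    rw [Finsupp.add_apply, Finsupp.single_eq_of_ne (Finset.ne_of_mem_erase hj), add_zero]
  · intro j hj
    rw [Finset.mem_insert, Finsupp.mem_support_iff]
    by_contra! hcon
    rw [Finsupp.mem_support_iff, Finsupp.add_apply, Finsupp.single_eq_of_ne hcon.1, hcon.2] at hj
    exact hj rfl

theorem sub_add_single [DecidableEq V] {m : V →₀ ℕ} {i : V} (h : m i ≠ 0) :
    m - Finsupp.single i 1 + Finsupp.single i 1 = m := by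
  refine tsub_add_cancel_of_le ?_
  rw [Finsupp.single_le_iff]
  omega

/-- Terms whose first entry vanishes at `i` drop out, and from the others one unit at `i` can be
removed. This is the index shift in Pascal's rule below. -/
theorem sum_antidiagonal_add_single [DecidableEq V] (m : V →₀ ℕ) (i : V)
    (f : (V →₀ ℕ) × (V →₀ ℕ) → R) (hf : ∀ p, p.1 i = 0 → f p = 0) :
    ∑ p ∈ antidiagonal (m + Finsupp.single i 1), f p =
      ∑ p ∈ antidiagonal m, f (p.1 + Finsupp.single i 1, p.2) := by
  symm
  refine Finset.sum_bij_ne_zero (fun p _ _ => (p.1 + Finsupp.single i 1, p.2)) ?_ ?_ ?_ ?_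
  · intro p hp _
    rw [mem_antidiagonal] at hp ⊢
    rw [← hp]
    exact add_right_comm _ _ _
  · rintro p _ _ q _ _ h
    rw [Prod.mk.injEq] at h
    exact Prod.ext (add_right_cancel h.1) h.2
  · intro p hp hfp
    have hpi : p.1 i ≠ 0 := fun h => hfp (hf p h)
    refine ⟨(p.1 - Finsupp.single i 1, p.2), ?_, ?_, ?_⟩
    · rw [mem_antidiagonal] at hp ⊢
      apply add_right_cancel (b := Finsupp.single i 1)
      rw [← hp, add_right_comm, sub_add_single hpi]
    · rwa [sub_add_single hpi]
    · rw [sub_add_single hpi]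
  · exact fun _ _ _ => rfl

theorem sum_antidiagonal_swap [DecidableEq V] (m : V →₀ ℕ) (f : (V →₀ ℕ) × (V →₀ ℕ) → R) :
    ∑ p ∈ antidiagonal m, f p.swap = ∑ p ∈ antidiagonal m, f p :=
  Finset.sum_nbij' Prod.swap Prod.swap
    (fun p hp => by rw [mem_antidiagonal] at hp ⊢; exact (add_comm _ _).trans hp)
    (fun p hp => by rw [mem_antidiagonal] at hp ⊢; exact (add_comm _ _).trans hp)
    (fun _ _ => rfl) (fun _ _ => rfl) (fun _ _ => rfl)

theorem sum_antidiagonal_add_single' [DecidableEq V] (m : V →₀ ℕ) (i : V)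
    (f : (V →₀ ℕ) × (V →₀ ℕ) → R) (hf : ∀ p, p.2 i = 0 → f p = 0) :
    ∑ p ∈ antidiagonal (m + Finsupp.single i 1), f p =
      ∑ p ∈ antidiagonal m, f (p.1, p.2 + Finsupp.single i 1) := by
  have h := sum_antidiagonal_add_single m i (fun p => f p.swap) fun p hp => hf _ hp
  rw [sum_antidiagonal_swap] at h
  rw [h, ← sum_antidiagonal_swap]
  rfl

/-- The number of subsets with given dimension vectors of the subset and of its complement is a
product of binomial coefficients. -/
theorem sum_powerset_dimVec [DecidableEq U] [DecidableEq V] [Algebra ℚ R] (lab : U → V)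
    (X : Finset U) (φ : (V →₀ ℕ) × (V →₀ ℕ) → R) :
    ∑ T ∈ X.powerset, φ (dimVec lab T, dimVec lab (X \ T)) =
      ∑ p ∈ antidiagonal (dimVec lab X),
        ((dimFact (dimVec lab X) : ℚ) * (dimFact p.1 : ℚ)⁻¹ * (dimFact p.2 : ℚ)⁻¹) • φ p := by
  induction X using Finset.induction_on generalizing φ with
  | empty => simp [dimVec, dimFact_zero]
  | insert a X ha ih =>
    have hins : ∀ {S : Finset U}, a ∉ S →
        dimVec lab (insert a S) = dimVec lab S + Finsupp.single (lab a) 1 := fun h => by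
      rw [dimVec, Finset.sum_insert h, add_comm]
      rfl
    set δ : V →₀ ℕ := Finsupp.single (lab a) 1 with hδ
    set m := dimVec lab X with hm
    have h1 : ∑ T ∈ (insert a X).powerset, φ (dimVec lab T, dimVec lab (insert a X \ T)) =
        ∑ T ∈ X.powerset, (φ (dimVec lab T, dimVec lab (X \ T) + δ) +
          φ (dimVec lab T + δ, dimVec lab (X \ T))) := by
      rw [Finset.sum_powerset_insert ha, Finset.sum_add_distrib]
      congr 1
      · refine Finset.sum_congr rfl fun T hT => ?_
        have haT : a ∉ T := fun h => ha (Finset.mem_powerset.1 hT h)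
        rw [Finset.insert_sdiff_of_notMem _ haT, hins]
        exact fun h => ha (Finset.mem_sdiff.1 h).1
      · refine Finset.sum_congr rfl fun T hT => ?_
        have haT : a ∉ T := fun h => ha (Finset.mem_powerset.1 hT h)
        rw [hins haT, Finset.insert_sdiff_insert, Finset.sdiff_insert_of_notMem ha]
    rw [h1, ih (fun p => φ (p.1, p.2 + δ) + φ (p.1 + δ, p.2)), hins ha, dimFact_add_single]
    -- Pascal's rule: the factor `m i + 1` of the new factorial is the sum of the entries of `p.1`
    -- and `p.2` at `i`, the label of the added vertex.
    have h2 : ∀ p ∈ antidiagonal (m + δ),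
        (((((m (lab a) + 1) * dimFact m : ℕ) : ℚ)) * (dimFact p.1 : ℚ)⁻¹ *
          (dimFact p.2 : ℚ)⁻¹) • φ p =
        ((dimFact m : ℚ) * ((p.1 (lab a) : ℚ) * (dimFact p.1 : ℚ)⁻¹) * (dimFact p.2 : ℚ)⁻¹) • φ p +
        ((dimFact m : ℚ) * (dimFact p.1 : ℚ)⁻¹ * ((p.2 (lab a) : ℚ) * (dimFact p.2 : ℚ)⁻¹)) • φ p := by
      intro p hp
      rw [← add_smul]
      congr 1
      have := DFunLike.congr_fun (mem_antidiagonal.1 hp) (lab a)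
      rw [Finsupp.add_apply, Finsupp.add_apply, hδ, Finsupp.single_eq_same] at this
      rw [← this]
      push_cast
      ring
    have h3 : ∀ n : V →₀ ℕ, ((n + δ) (lab a) : ℚ) * (dimFact (n + δ) : ℚ)⁻¹ =
        (dimFact n : ℚ)⁻¹ := by
      intro n
      rw [dimFact_add_single, Finsupp.add_apply, hδ, Finsupp.single_eq_same]
      have h0 : ((n (lab a) + 1 : ℕ) : ℚ) ≠ 0 := Nat.cast_ne_zero.2 (Nat.succ_ne_zero _)
      rw [Nat.cast_mul, mul_inv, mul_inv_cancel_left₀ h0]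
    rw [Finset.sum_congr rfl h2, Finset.sum_add_distrib, sum_antidiagonal_add_single,
      sum_antidiagonal_add_single', ← Finset.sum_add_distrib]
    · refine Finset.sum_congr rfl fun p _ => ?_
      rw [h3, h3, smul_add, add_comm]
    · intro p hp
      simp [hp]
    · intro p hp
      simp [hp]

end

/-! ### The Harder–Narasimhan recursion in the quantum torus. -/

section

variable {V : Type} [DecidableEq V] {R : Type*} [CommRing R]

theorem quiverForm_single (r : V → V → ℕ) (i j : V) :
    quiverForm r (Finsupp.single i 1) (Finsupp.single j 1) = r i j := by
  rw [quiverForm, Finsupp.sum_single_index, Finsupp.sum_single_index]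
  · simp
  · simp
  · simp

theorem quiverForm_dimVec {U : Type*} (r : V → V → ℕ) (lab : U → V) (X Y : Finset U) :
    quiverForm r (dimVec lab X) (dimVec lab Y) = ∑ p ∈ X ×ˢ Y, r (lab p.1) (lab p.2) := by
  classical
  rw [Finset.sum_product]
  have h0 : ∀ β : V →₀ ℕ, quiverForm r 0 β = 0 := fun β => Finsupp.sum_zero_index
  have h1 : ∀ α : V →₀ ℕ, quiverForm r α 0 = 0 := fun α => by
    simp [quiverForm]
  have h2 : ∀ i, quiverForm r (Finsupp.single i 1) (dimVec lab Y) = ∑ y ∈ Y, r i (lab y) := by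
    intro i
    let f : (V →₀ ℕ) →+ ℕ := ⟨⟨fun β => quiverForm r (Finsupp.single i 1) β, h1 _⟩,
      quiverForm_add_right r _⟩
    refine (map_dimVec f lab Y).trans (Finset.sum_congr rfl fun y _ => quiverForm_single r _ _)
  let f : (V →₀ ℕ) →+ ℕ := ⟨⟨fun α => quiverForm r α (dimVec lab Y), h0 _⟩,
      fun α α' => quiverForm_add_left r α α' _⟩
  exact (map_dimVec f lab X).trans (Finset.sum_congr rfl fun x _ => h2 _)

/-- The weight of the pairs of vertices in a motivic count of representations. -/
def arrowWeight (r : V → V → ℕ) (v : Rˣ) (i j : V) : R := ((v : R) ^ 2) ^ r i j - 1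

/-- This is `repSum_nonneg_eq` with the subsets `T` grouped by dimension vector. Since `1 + w = q^r`
for each pair, the free arrows into `T` contribute `q` to the power `r(p.2, p.1)`. -/
theorem dimSum_nonneg_eq [Algebra ℚ R] (r : V → V → ℕ) (v : Rˣ)
    (θ : (V →₀ ℕ) →+ ℤ) (m : V →₀ ℕ) :
    dimSum (arrowWeight r v) (fun m => 0 ≤ θ m) m = ∑ p ∈ antidiagonal m,
      ((dimFact m : ℚ) * (dimFact p.1 : ℚ)⁻¹ * (dimFact p.2 : ℚ)⁻¹) • if θ p.1 = 0 then
        dimSum (arrowWeight r v) (fun m => 0 ≤ θ m) p.1 *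
        dimSum (arrowWeight r v) (fun m => 0 < θ m) p.2 *
          ((v : R) ^ 2) ^ quiverForm r p.2 p.1 else 0 := by
  let lab := fun x : StdVertex m => (x.1 : V)
  have key := sum_powerset_dimVec lab Finset.univ (fun p => if θ p.1 = 0 then
        dimSum (arrowWeight r v) (fun m => 0 ≤ θ m) p.1 *
        dimSum (arrowWeight r v) (fun m => 0 < θ m) p.2 *
          ((v : R) ^ 2) ^ quiverForm r p.2 p.1 else 0)
  rw [dimVec_stdVertex] at key
  rw [← key, dimSum, labSum]
  simp only [map_dimVec]
  rw [repSum_nonneg_eq]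
  refine Finset.sum_congr rfl fun T _ => ?_
  congr 1
  rw [← labSum_eq_dimSum, ← labSum_eq_dimSum, labSum, labSum, quiverForm_dimVec,
    ← Finset.prod_pow_eq_pow_sum]
  simp only [map_dimVec]
  congr 1
  refine Finset.prod_congr rfl fun p _ => ?_
  simp [arrowWeight, lab]

/-- The normalized motivic count of the representations with dimension vector `m` whose nonzero
subrepresentations have dimension vectors with the property `D`, divided by the factorial
of `m`. -/
noncomputable def hnCoeff [Algebra ℚ R] (r : V → V → ℕ) (v u : Rˣ) (D : (V →₀ ℕ) → Prop)
    (m : V →₀ ℕ) : R :=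
  ((dimFact m : ℚ)⁻¹) • (((u ^ (-(m.degree : ℤ)) * v ^ (-(quiverForm r m m : ℤ)) : Rˣ) : R) *
    dimSum (arrowWeight r v) D m)

/-- The normalization turns the recursion into a product of series. In `r(m, m)` with `m = p.1 +
p.2` the mixed terms are `r(p.1, p.2) + r(p.2, p.1)`; together with `q^{r(p.2, p.1)} = v^{2 r(p.2,
p.1)}` they leave the exponent `r(p.2, p.1) - r(p.1, p.2)`, which is the twist. The factorials
cancel the binomial coefficients. -/
theorem hnCoeff_nonneg_eq [Algebra ℚ R] (r : V → V → ℕ) (v u : Rˣ)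
    (θ : (V →₀ ℕ) →+ ℤ) (m : V →₀ ℕ) :
    hnCoeff r v u (fun m => 0 ≤ θ m) m = ∑ p ∈ antidiagonal m,
      ((v ^ quiverSkew r p.1 p.2 : Rˣ) : R) *
        ((if θ p.1 = 0 then hnCoeff r v u (fun m => 0 ≤ θ m) p.1 else 0) *
          hnCoeff r v u (fun m => 0 < θ m) p.2) := by
  rw [hnCoeff, dimSum_nonneg_eq, Finset.mul_sum, Finset.smul_sum]
  refine Finset.sum_congr rfl fun p hp => ?_
  split_ifs with h
  · have hv : (u ^ (-(m.degree : ℤ)) * v ^ (-(quiverForm r m m : ℤ)) : Rˣ) *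
        (v ^ 2) ^ quiverForm r p.2 p.1 = v ^ quiverSkew r p.1 p.2 *
        ((u ^ (-(p.1.degree : ℤ)) * v ^ (-(quiverForm r p.1 p.1 : ℤ)) : Rˣ) *
        (u ^ (-(p.2.degree : ℤ)) * v ^ (-(quiverForm r p.2 p.2 : ℤ)) : Rˣ)) := by
      rw [← mem_antidiagonal.1 hp]
      simp only [map_add, quiverForm_add_left, quiverForm_add_right, quiverSkew,
        AddMonoidHom.coe_mk, ZeroHom.coe_mk]
      rw [← pow_mul, ← zpow_natCast v (2 * _)]
      rw [mul_assoc, ← zpow_add, mul_mul_mul_comm, ← zpow_add, ← zpow_add, mul_left_comm,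
        ← zpow_add]
      congr 2
      · push_cast; ring
      · push_cast; ring
    have hv' := congrArg (Units.val) hv
    push_cast at hv'
    rw [hnCoeff, hnCoeff]
    have hm : algebraMap ℚ R (dimFact m : ℚ)⁻¹ * (dimFact m : R) = 1 := by
      rw [← map_natCast (algebraMap ℚ R), ← map_mul, inv_mul_cancel₀ (dimFact_ne_zero m), map_one]
    simp only [Algebra.smul_def, map_mul, map_natCast]
    push_cast
    generalize algebraMap ℚ R (dimFact m : ℚ)⁻¹ = a at hm ⊢
    generalize (dimFact m : R) = b at hm ⊢
    generalize algebraMap ℚ R (dimFact p.1 : ℚ)⁻¹ = a₁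
    generalize algebraMap ℚ R (dimFact p.2 : ℚ)⁻¹ = a₂
    generalize ((v ^ quiverSkew r p.1 p.2 : Rˣ) : R) = c at hv' ⊢
    generalize ((u ^ (-(p.1.degree : ℤ)) : Rˣ) : R) = b₁ at hv' ⊢
    generalize ((u ^ (-(p.2.degree : ℤ)) : Rˣ) : R) = b₂ at hv' ⊢
    generalize ((v ^ (-(quiverForm r p.1 p.1 : ℤ)) : Rˣ) : R) = c₁ at hv' ⊢
    generalize ((v ^ (-(quiverForm r p.2 p.2 : ℤ)) : Rˣ) : R) = c₂ at hv' ⊢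
    generalize dimSum (arrowWeight r v) _ p.1 = d₁
    generalize dimSum (arrowWeight r v) _ p.2 = d₂
    linear_combination (a * b * a₁ * a₂ * d₁ * d₂) * hv' + (a₁ * a₂ * d₁ * d₂ * c * (b₁ * c₁ * (b₂ * c₂))) * hm
  · simp

theorem hnCoeff_congr [Algebra ℚ R] (r : V → V → ℕ) (v u : Rˣ) (D D' : (V →₀ ℕ) → Prop)
    (m : V →₀ ℕ) (h : ∀ m' ≤ m, m' ≠ 0 → (D m' ↔ D' m')) :
    hnCoeff r v u D m = hnCoeff r v u D' m := by
  rw [hnCoeff, hnCoeff, dimSum_congr_cond _ _ _ _ h]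

/-- The full vertex set is always closed, so a condition that never holds admits only the empty
representation. -/
theorem dimSum_false (w : V → V → R) (m : V →₀ ℕ) :
    dimSum w (fun _ => False) m = if m = 0 then 1 else 0 := by
  classical
  rw [dimSum, labSum, repSum]
  split_ifs with h
  · subst h
    have : IsEmpty (StdVertex (0 : V →₀ ℕ)) := ⟨fun x => x.2.elim0⟩
    rw [Finset.univ_eq_empty, Finset.product_empty, Finset.powerset_empty,
      Finset.filter_true_of_mem, Finset.sum_singleton, Finset.prod_empty]
    intro E _ T hT hne
    exact (hne.ne_empty (Finset.subset_empty.1 hT)).elim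
  · rw [Finset.filter_false_of_mem, Finset.sum_empty]
    intro E _ hE
    refine hE Finset.univ subset_rfl ?_ fun _ _ _ => Finset.mem_univ _
    rw [Finset.nonempty_iff_ne_empty, Ne, ← dimVec_eq_zero (fun x : StdVertex m => (x.1 : V)),
      dimVec_stdVertex]
    exact h

theorem hnCoeff_false [Algebra ℚ R] (r : V → V → ℕ) (v u : Rˣ) (m : V →₀ ℕ) :
    hnCoeff r v u (fun _ => False) m = if m = 0 then 1 else 0 := by
  rw [hnCoeff, dimSum_false]
  split_ifs with h
  · subst h
    simp [dimFact_zero, quiverForm]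
  · simp

variable [Algebra ℚ R]

/-- The generating series of the semistable representations of slope determined by `θ = 0`. -/
noncomputable def hnFactor (r : V → V → ℕ) (v u : Rˣ) (θ : (V →₀ ℕ) →+ ℤ) :
    QTorus v (quiverSkew r) :=
  ⟨fun m => if θ m = 0 then hnCoeff r v u (fun m => 0 ≤ θ m) m else 0⟩

/-- Peel off the head `l` of the list. By the two hypotheses, "some member of the list vanishes on
`m'`" means `0 ≤ θ l m'` for the whole list and `0 < θ l m'` for its tail, so `hnCoeff_nonneg_eq` is
the induction step. The hypotheses are restricted to `m' ≤ m` so that a finite list suffices for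
each coefficient. -/
theorem coeff_prod_hnFactor {ℓ : Type*} (r : V → V → ℕ) (v u : Rˣ) (θ : ℓ → (V →₀ ℕ) →+ ℤ)
    (L : List ℓ) (m : V →₀ ℕ)
    (h1 : L.Pairwise fun l l' => ∀ m' ≤ m, m' ≠ 0 → 0 ≤ θ l' m' → 0 < θ l m')
    (h2 : ∀ l ∈ L, ∀ m' ≤ m, m' ≠ 0 → 0 ≤ θ l m' → ∃ l' ∈ L, θ l' m' = 0) :
    (L.map fun l => hnFactor r v u (θ l)).prod.coeff m =
      hnCoeff r v u (fun m' => ∃ l ∈ L, θ l m' = 0) m := by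
  induction L generalizing m with
  | nil =>
    rw [List.map_nil, List.prod_nil, QTorus.coeff_one]
    simp only [List.not_mem_nil, false_and, exists_false]
    exact (hnCoeff_false r v u m).symm
  | cons l L ih =>
    rw [List.pairwise_cons] at h1
    have hL : ∀ m' ≤ m, m' ≠ 0 → ((∃ l' ∈ L, θ l' m' = 0) ↔ 0 < θ l m') := by
      intro m' hm' h0
      constructor
      · rintro ⟨l', hl', h⟩
        exact h1.1 l' hl' m' hm' h0 h.ge
      · intro h
        obtain ⟨l', hl', h'⟩ := h2 l List.mem_cons_self m' hm' h0 h.le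
        rcases List.mem_cons.1 hl' with rfl | hl'
        · exact (h.ne' h').elim
        · exact ⟨l', hl', h'⟩
    have hlL : ∀ m' ≤ m, m' ≠ 0 → ((∃ l' ∈ l :: L, θ l' m' = 0) ↔ 0 ≤ θ l m') := by
      intro m' hm' h0
      constructor
      · rintro ⟨l', hl', h⟩
        rcases List.mem_cons.1 hl' with rfl | hl'
        · exact h.ge
        · exact (h1.1 l' hl' m' hm' h0 h.ge).le
      · exact h2 l List.mem_cons_self m' hm' h0
    rw [hnCoeff_congr r v u _ _ m hlL, hnCoeff_nonneg_eq, List.map_cons, List.prod_cons,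
      QTorus.coeff_mul]
    refine Finset.sum_congr rfl fun p hp => ?_
    have hpm : p.2 ≤ m := by
      rw [← mem_antidiagonal.1 hp]
      exact le_add_self
    rw [ih p.2]
    · rw [hnCoeff_congr r v u _ _ p.2 fun m' hm' => hL m' (hm'.trans hpm)]
      rfl
    · exact h1.2.imp fun h m' hm' => h m' (hm'.trans hpm)
    · intro l' hl' m' hm' h0 h
      obtain ⟨l'', hl'', h''⟩ := h2 l' (List.mem_cons_of_mem _ hl') m' (hm'.trans hpm) h0 h
      rcases List.mem_cons.1 hl'' with rfl | hl''
      · exact ((h1.1 l' hl' m' (hm'.trans hpm) h0 h).ne' h'').elim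
      · exact ⟨l'', hl'', h''⟩

/-- The generating series of all representations is the ordered product of the series of the
semistable ones. -/
theorem coeff_prod_hnFactor_eq_total {ℓ : Type*} (r : V → V → ℕ) (v u : Rˣ)
    (θ : ℓ → (V →₀ ℕ) →+ ℤ) (L : List ℓ) (m : V →₀ ℕ)
    (h1 : L.Pairwise fun l l' => ∀ m' ≤ m, m' ≠ 0 → 0 ≤ θ l' m' → 0 < θ l m')
    (h2 : ∀ m' ≤ m, m' ≠ 0 → ∃ l ∈ L, θ l m' = 0) :
    (L.map fun l => hnFactor r v u (θ l)).prod.coeff m = hnCoeff r v u (fun _ => True) m := by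
  rw [coeff_prod_hnFactor r v u θ L m h1 fun _ _ m' hm' h0 _ => h2 m' hm' h0]
  exact hnCoeff_congr r v u _ _ m fun m' hm' h0 => iff_of_true (h2 m' hm' h0) trivial

end

/-! ### Leading differences of products and exponentials. -/

namespace QTorus

section

variable {σ R : Type*} [DecidableEq σ] [CommRing R] {v : Rˣ} {ω : (σ →₀ ℕ) →+ (σ →₀ ℕ) →+ ℤ}

theorem coeff_mul_zero (A B : QTorus v ω) : (A * B).coeff 0 = A.coeff 0 * B.coeff 0 := by
  rw [coeff_mul, Finset.sum_eq_single (0, 0)]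
  · simp
  · intro p hp hne
    rw [mem_antidiagonal, add_eq_zero] at hp
    exact (hne (Prod.ext hp.1 hp.2)).elim
  · simp

theorem coeff_mul_congr {A A' B B' : QTorus v ω} {γ : σ →₀ ℕ}
    (hA : ∀ δ ≤ γ, A.coeff δ = A'.coeff δ) (hB : ∀ δ ≤ γ, B.coeff δ = B'.coeff δ) :
    (A * B).coeff γ = (A' * B').coeff γ := by
  rw [coeff_mul, coeff_mul]
  refine Finset.sum_congr rfl fun p hp => ?_
  rw [mem_antidiagonal] at hp
  rw [hA p.1 (hp ▸ le_self_add), hB p.2 (hp ▸ le_add_self)]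

theorem coeff_pow_congr {A A' : QTorus v ω} {γ : σ →₀ ℕ}
    (h : ∀ δ ≤ γ, A.coeff δ = A'.coeff δ) (n : ℕ) : (A ^ n).coeff γ = (A' ^ n).coeff γ := by
  induction n generalizing γ with
  | zero => rw [pow_zero, pow_zero]
  | succ n ih =>
    rw [pow_succ, pow_succ]
    exact coeff_mul_congr (fun δ hδ => ih fun ε hε => h ε (hε.trans hδ)) h

theorem coeff_pow_eq_zero {A : QTorus v ω} (hA : A.coeff 0 = 0) {n : ℕ} {γ : σ →₀ ℕ}
    (h : γ.degree < n) : (A ^ n).coeff γ = 0 := by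
  induction n generalizing γ with
  | zero => exact (Nat.not_lt_zero _ h).elim
  | succ n ih =>
    rw [pow_succ, coeff_mul]
    refine Finset.sum_eq_zero fun p hp => ?_
    by_cases hp2 : p.2 = 0
    · rw [hp2, hA, mul_zero, mul_zero]
    · have := (Finsupp.degree_eq_zero_iff p.2).not.2 hp2
      rw [← mem_antidiagonal.1 hp, map_add] at h
      rw [ih (by omega), zero_mul, mul_zero]

theorem coeff_list_prod_zero {ι : Type*} (F : ι → QTorus v ω) (hF : ∀ i, (F i).coeff 0 = 1)
    (L : List ι) : (L.map F).prod.coeff 0 = 1 := by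
  induction L with
  | nil => simp [coeff_one]
  | cons i L ih => rw [List.map_cons, List.prod_cons, coeff_mul_zero, hF, ih, one_mul]

theorem coeff_list_prod_congr {ι : Type*} {F F' : ι → QTorus v ω} {γ : σ →₀ ℕ}
    (h : ∀ i, ∀ δ ≤ γ, (F i).coeff δ = (F' i).coeff δ) (L : List ι) :
    (L.map F).prod.coeff γ = (L.map F').prod.coeff γ := by
  induction L generalizing γ with
  | nil => rfl
  | cons i L ih =>
    rw [List.map_cons, List.prod_cons, List.map_cons, List.prod_cons]
    exact coeff_mul_congr (h i) fun δ hδ => ih fun j ε hε => h j ε (hε.trans hδ)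

/-- If two pairs of series agree below `γ`, then the coefficients of their products differ by the
coefficients at the extreme decompositions of `γ`. -/
theorem coeff_mul_sub {A A' B B' : QTorus v ω} {γ : σ →₀ ℕ} (hγ : γ ≠ 0)
    (hA : ∀ δ < γ, A.coeff δ = A'.coeff δ) (hB : ∀ δ < γ, B.coeff δ = B'.coeff δ) :
    (A * B).coeff γ - (A' * B').coeff γ =
      (A.coeff γ - A'.coeff γ) * B.coeff 0 + A.coeff 0 * (B.coeff γ - B'.coeff γ) := by
  have h0 : 0 < γ := pos_iff_ne_zero.2 hγ
  rw [coeff_mul, coeff_mul, ← Finset.sum_sub_distrib,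
    Finset.sum_eq_add (γ, 0) (0, γ) (fun h => hγ (Prod.mk.inj h).1)]
  · simp only [map_zero, AddMonoidHom.zero_apply, zpow_zero, Units.val_one, one_mul]
    rw [← hA 0 h0, ← hB 0 h0]
    ring
  · rintro ⟨x, y⟩ hp ⟨h1, h2⟩
    rw [mem_antidiagonal] at hp
    dsimp only at hp ⊢
    have hx : x < γ := by
      refine lt_of_le_of_ne (hp ▸ le_self_add) fun h => h1 ?_
      rw [h] at hp
      rw [h, add_eq_left.1 hp]
    have hy : y < γ := by
      refine lt_of_le_of_ne (hp ▸ le_add_self) fun h => h2 ?_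
      rw [h] at hp
      rw [h, add_eq_right.1 hp]
    rw [hA x hx, hB y hy, sub_self]
  · simp
  · simp

/-- When all lower coefficients agree, a product of series with constant term `1` depends additively
on the coefficients at `γ`. -/
theorem coeff_list_prod_sub {ι : Type*} {F F' : ι → QTorus v ω} {γ : σ →₀ ℕ} (hγ : γ ≠ 0)
    (hF : ∀ i, (F i).coeff 0 = 1) (h : ∀ i, ∀ δ < γ, (F i).coeff δ = (F' i).coeff δ)
    (L : List ι) : (L.map F).prod.coeff γ - (L.map F').prod.coeff γ =
      (L.map fun i => (F i).coeff γ - (F' i).coeff γ).sum := by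
  induction L with
  | nil => simp
  | cons i L ih =>
    rw [List.map_cons, List.prod_cons, List.map_cons, List.prod_cons, List.map_cons,
      List.sum_cons, ← ih, coeff_mul_sub hγ (h i), hF, coeff_list_prod_zero F hF, mul_one, one_mul]
    exact fun δ hδ => coeff_list_prod_congr (fun j ε hε => h j ε (hε.trans_lt hδ)) L

/-- Without constant term, a product of at least two factors involves only coefficients strictly
below `γ`. -/
theorem coeff_pow_sub {A A' : QTorus v ω} (hA0 : A.coeff 0 = 0) {γ : σ →₀ ℕ} (hγ : γ ≠ 0)
    (h : ∀ δ < γ, A.coeff δ = A'.coeff δ) {n : ℕ} (hn : 2 ≤ n) :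
    (A ^ n).coeff γ = (A' ^ n).coeff γ := by
  obtain ⟨n, rfl⟩ := Nat.exists_eq_add_of_le hn
  have hpow : (A ^ (n + 1)).coeff 0 = 0 :=
    coeff_pow_eq_zero hA0 (by rw [map_zero]; exact Nat.succ_pos n)
  rw [show 2 + n = n + 1 + 1 by omega, pow_succ, pow_succ A', ← sub_eq_zero,
    coeff_mul_sub hγ (fun δ hδ => coeff_pow_congr (fun ε hε => h ε (hε.trans_lt hδ)) _) h, hA0,
    hpow, mul_zero, zero_mul, add_zero]

variable [Algebra ℚ R]

theorem coeff_exp {A : QTorus v ω} (hA : A.coeff 0 = 0) {γ : σ →₀ ℕ} {N : ℕ}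
    (hN : γ.degree < N) :
    (exp A).coeff γ = ∑ n ∈ Finset.range N, ((n.factorial : ℚ)⁻¹) • (A ^ n).coeff γ := by
  refine finsum_eq_sum_of_support_subset _ fun n hn => ?_
  rw [Finset.coe_range, Set.mem_Iio]
  by_contra! hcon
  refine hn ?_
  dsimp only
  rw [coeff_pow_eq_zero hA (hN.trans_le hcon), smul_zero]

theorem coeff_exp_zero {A : QTorus v ω} (hA : A.coeff 0 = 0) : (exp A).coeff 0 = 1 := by
  rw [coeff_exp hA (N := 1) (by rw [map_zero]; exact one_pos)]
  simp [coeff_one]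

theorem coeff_exp_congr {A A' : QTorus v ω} {γ : σ →₀ ℕ}
    (h : ∀ δ ≤ γ, A.coeff δ = A'.coeff δ) : (exp A).coeff γ = (exp A').coeff γ :=
  finsum_congr fun n => by rw [coeff_pow_congr h]

/-- Only the linear term of the exponential sees the coefficient at `γ` itself. -/
theorem coeff_exp_sub {A A' : QTorus v ω} (hA : A.coeff 0 = 0) {γ : σ →₀ ℕ} (hγ : γ ≠ 0)
    (h : ∀ δ < γ, A.coeff δ = A'.coeff δ) :
    (exp A).coeff γ - (exp A').coeff γ = A.coeff γ - A'.coeff γ := by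
  have hA' : A'.coeff 0 = 0 := (h 0 (pos_iff_ne_zero.2 hγ)).symm.trans hA
  have hN : γ.degree < γ.degree + 2 := by omega
  rw [coeff_exp hA hN, coeff_exp hA' hN, ← Finset.sum_sub_distrib, Finset.sum_eq_single 1]
  · simp
  · intro n _ hn
    rcases Nat.lt_or_ge n 2 with h2 | h2
    · obtain rfl : n = 0 := by omega
      simp
    · rw [coeff_pow_sub hA hγ h h2, sub_self]
  · simp

end

end QTorus

/-! ### The homomorphism of quantum tori -/

theorem mnorm_zero : mnorm 0 = 0 := Finsupp.sum_zero_index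

theorem mnorm_add (m m' : GStar →₀ ℕ) : mnorm (m + m') = mnorm m + mnorm m' :=
  Finsupp.sum_add_index' (fun _ => zero_smul _ _) fun _ _ _ => add_smul _ _ _

theorem mnorm_single (α : GStar) (k : ℕ) : mnorm (Finsupp.single α k) = k • α.1 :=
  Finsupp.sum_single_index (zero_smul _ _)

/-- `mnorm` as a homomorphism. -/
noncomputable def mnormHom : (GStar →₀ ℕ) →+ GPlus := ⟨⟨mnorm, mnorm_zero⟩, mnorm_add⟩

@[simp] theorem mnormHom_apply (m : GStar →₀ ℕ) : mnormHom m = mnorm m := rfl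

theorem degree_le_degree_mnorm (m : GStar →₀ ℕ) : m.degree ≤ (mnorm m).degree := by
  induction m using Finsupp.induction_linear with
  | zero => simp [mnorm_zero]
  | add m m' h h' => rw [mnorm_add, map_add, map_add]; exact add_le_add h h'
  | single α k =>
    rw [mnorm_single, map_nsmul, Finsupp.degree_single, smul_eq_mul]
    exact Nat.le_mul_of_pos_right _ (Nat.pos_of_ne_zero ((Finsupp.degree_eq_zero_iff _).not.2 α.2))

theorem mnorm_eq_zero {m : GStar →₀ ℕ} : mnorm m = 0 ↔ m = 0 := by
  constructor
  · intro h
    have := degree_le_degree_mnorm m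
    rw [h, map_zero] at this
    exact (Finsupp.degree_eq_zero_iff m).1 (Nat.le_zero.1 this)
  · rintro rfl
    exact mnorm_zero

theorem mnorm_mono {m m' : GStar →₀ ℕ} (h : m ≤ m') : mnorm m ≤ mnorm m' := by
  obtain ⟨c, rfl⟩ := exists_add_of_le h
  rw [mnorm_add]
  exact le_self_add

theorem finite_mnorm_eq (γ : GPlus) : {m : GStar →₀ ℕ | mnorm m = γ}.Finite := by
  have hS : {α : GStar | α.1 ≤ γ}.Finite :=
    (Set.finite_Iic γ).preimage Subtype.val_injective.injOn
  refine (Set.finite_Iic (∑ α ∈ hS.toFinset, Finsupp.single α γ.degree)).subset fun m hm => ?_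
  rw [Set.mem_ofPred_eq] at hm
  intro α
  by_cases hα : m α = 0
  · rw [hα]
    exact Nat.zero_le _
  have h1 : α.1 ≤ γ := by
    have h2 : Finsupp.single α 1 ≤ m := by
      rw [Finsupp.single_le_iff]
      omega
    have := mnorm_mono h2
    rwa [mnorm_single, one_smul, hm] at this
  have h3 : Finsupp.single α γ.degree ≤ ∑ α ∈ hS.toFinset, Finsupp.single α γ.degree :=
    Finset.single_le_sum (f := fun α => Finsupp.single α γ.degree) (fun _ _ => zero_le)
      (hS.mem_toFinset.2 h1)
  calc m α ≤ m.degree := Finsupp.le_degree α m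
    _ ≤ γ.degree := hm ▸ degree_le_degree_mnorm m
    _ = Finsupp.single α γ.degree α := Finsupp.single_eq_same.symm
    _ ≤ _ := h3 α

/-- The dimension vectors of `Q̂` of norm `γ`. -/
noncomputable def normFiber (γ : GPlus) : Finset (GStar →₀ ℕ) := (finite_mnorm_eq γ).toFinset

@[simp] theorem mem_normFiber {γ : GPlus} {m : GStar →₀ ℕ} : m ∈ normFiber γ ↔ mnorm m = γ :=
  (finite_mnorm_eq γ).mem_toFinset

section

variable {R : Type*} [CommRing R] {v : Rˣ} {ω : GPlus →+ GPlus →+ ℤ}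
  {ω' : (GStar →₀ ℕ) →+ (GStar →₀ ℕ) →+ ℤ}

/-- The homomorphism of quantum tori that maps `x^m` to `a^m x^‖m‖`. -/
noncomputable def pushTorus (hω : ∀ m m', ω' m m' = ω (mnorm m) (mnorm m')) (a : GStar → R) :
    QTorus v ω' →+* QTorus v ω where
  toFun A := ⟨fun γ => ∑ m ∈ normFiber γ, A.coeff m * m.prod fun α k => a α ^ k⟩
  map_zero' := by ext; simp
  map_add' A B := by ext; simp [add_mul, Finset.sum_add_distrib]
  map_one' := by
    ext γ
    simp only [QTorus.coeff_one, ite_mul, one_mul, zero_mul, Finset.sum_ite_eq', mem_normFiber,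
      mnorm_zero, Finsupp.prod_zero_index, eq_comm]
  map_mul' A B := by
    ext γ
    have hl : ∀ m, (A * B).coeff m * (m.prod fun α k => a α ^ k) =
        ∑ p ∈ antidiagonal m, ((v ^ ω (mnorm p.1) (mnorm p.2) : Rˣ) : R) *
          ((A.coeff p.1 * p.1.prod fun α k => a α ^ k) *
            (B.coeff p.2 * p.2.prod fun α k => a α ^ k)) := by
      intro m
      rw [QTorus.coeff_mul, Finset.sum_mul]
      refine Finset.sum_congr rfl fun p hp => ?_
      rw [← mem_antidiagonal.1 hp, Finsupp.prod_add_index' (fun _ => pow_zero _)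
        (fun _ _ _ => pow_add _ _ _), hω]
      ring
    refine (Finset.sum_congr rfl fun m _ => hl m).trans ?_
    rw [QTorus.coeff_mul]
    simp only [Finset.sum_mul_sum]
    simp only [← Finset.sum_product', Finset.mul_sum, Finset.sum_sigma']
    refine Finset.sum_bij' (fun x _ => ⟨(mnorm x.2.1, mnorm x.2.2), x.2⟩)
      (fun y _ => ⟨y.2.1 + y.2.2, y.2⟩) ?_ ?_ ?_ ?_ ?_
    · rintro ⟨m, p⟩ h
      simp only [Finset.mem_sigma, mem_normFiber, mem_antidiagonal, Finset.mem_product,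
        and_true] at h ⊢
      rw [← mnorm_add, h.2, h.1]
    · rintro ⟨⟨γ₁, γ₂⟩, p⟩ h
      simp only [Finset.mem_sigma, mem_normFiber, mem_antidiagonal, Finset.mem_product,
        and_true] at h ⊢
      rw [mnorm_add, h.2.1, h.2.2, h.1]
    · rintro ⟨m, p⟩ h
      simp only [Finset.mem_sigma, mem_antidiagonal] at h
      rw [h.2]
    · rintro ⟨⟨γ₁, γ₂⟩, p⟩ h
      simp only [Finset.mem_sigma, mem_normFiber, Finset.mem_product] at h
      rw [h.2.1, h.2.2]
    · rintro ⟨m, p⟩ h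
      rfl

theorem coeff_pushTorus (hω : ∀ m m', ω' m m' = ω (mnorm m) (mnorm m')) (a : GStar → R)
    (A : QTorus v ω') (γ : GPlus) : (pushTorus hω a A).coeff γ =
      ∑ m ∈ normFiber γ, A.coeff m * m.prod fun α k => a α ^ k := rfl

theorem pushTorus_exp [Algebra ℚ R] (hω : ∀ m m', ω' m m' = ω (mnorm m) (mnorm m'))
    (a : GStar → R) {A : QTorus v ω'} (hA : A.coeff 0 = 0) :
    pushTorus hω a (QTorus.exp A) = QTorus.exp (pushTorus hω a A) := by
  have h0 : (pushTorus hω a A).coeff 0 = 0 := by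
    rw [coeff_pushTorus]
    refine Finset.sum_eq_zero fun m hm => ?_
    rw [mem_normFiber, mnorm_eq_zero] at hm
    rw [hm, hA, zero_mul]
  ext γ
  rw [coeff_pushTorus, QTorus.coeff_exp h0 (Nat.lt_succ_self _)]
  simp only [← map_pow, coeff_pushTorus, Finset.smul_sum]
  rw [Finset.sum_comm]
  refine Finset.sum_congr rfl fun m hm => ?_
  rw [mem_normFiber] at hm
  -- Since the degree of `m` is at most that of `‖m‖`, both exponentials may be truncated at the
  -- same order.
  rw [QTorus.coeff_exp hA (Nat.lt_succ_of_le (hm ▸ degree_le_degree_mnorm m)), Finset.sum_mul]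
  exact Finset.sum_congr rfl fun n _ => smul_mul_assoc _ _ _

end

/-! ### Rays -/

/-- `rayCross l γ` is positive, zero or negative if the slope of `γ` is smaller than, equal to or
larger than that of `l`. -/
noncomputable def rayCross (l : Ray) : GPlus →+ ℤ where
  toFun γ := (γ 0 : ℤ) * l.1 1 - (γ 1 : ℤ) * l.1 0
  map_zero' := by simp
  map_add' γ δ := by simp only [Finsupp.add_apply]; push_cast; ring

theorem rayCross_apply (l : Ray) (γ : GPlus) :
    rayCross l γ = (γ 0 : ℤ) * l.1 1 - (γ 1 : ℤ) * l.1 0 := rfl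

theorem gplus_ext {γ δ : GPlus} (h0 : γ 0 = δ 0) (h1 : γ 1 = δ 1) : γ = δ := by
  ext i
  fin_cases i
  · exact h0
  · exact h1

theorem gplus_ne_zero {γ : GPlus} : γ ≠ 0 ↔ γ 0 ≠ 0 ∨ γ 1 ≠ 0 := by
  rw [← not_and_or, not_iff_not]
  exact ⟨fun h => by simp [h], fun h => gplus_ext h.1 h.2⟩

theorem Ray.Mem.ne_zero {l : Ray} {γ : GPlus} (h : l.Mem γ) : γ ≠ 0 := by
  obtain ⟨n, hn, rfl⟩ := h
  rw [gplus_ne_zero, Finsupp.smul_apply, Finsupp.smul_apply, smul_eq_mul, smul_eq_mul]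
  by_contra! hcon
  have h0 := (Nat.mul_eq_zero.1 hcon.1).resolve_left hn.ne'
  have h1 := (Nat.mul_eq_zero.1 hcon.2).resolve_left hn.ne'
  have := l.2
  rw [h0, h1] at this
  simp at this

/-- The coordinates of `l` are coprime, so proportionality to `l` forces each of them to divide the
corresponding coordinate of `γ`. The vertical ray is separate because the multiplier cannot be read
off from a zero coordinate. -/
theorem rayCross_eq_zero_iff {l : Ray} {γ : GPlus} (hγ : γ ≠ 0) :
    rayCross l γ = 0 ↔ l.Mem γ := by
  rw [rayCross_apply, sub_eq_zero]
  constructor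
  · intro h
    have h' : γ 0 * l.1 1 = γ 1 * l.1 0 := by exact_mod_cast h
    have hd0 : l.1 0 ∣ γ 0 :=
      Nat.Coprime.dvd_of_dvd_mul_right l.2 (h' ▸ dvd_mul_left _ _)
    have hd1 : l.1 1 ∣ γ 1 :=
      Nat.Coprime.dvd_of_dvd_mul_right (Nat.coprime_comm.1 l.2) (h' ▸ dvd_mul_left _ _)
    obtain ⟨a, ha⟩ := hd0
    obtain ⟨b, hb⟩ := hd1
    by_cases h0 : l.1 0 = 0
    · have h1 : l.1 1 = 1 := by simpa [h0] using l.2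
      have hγ0 : γ 0 = 0 := by rw [ha, h0, zero_mul]
      refine ⟨γ 1, Nat.pos_of_ne_zero ((gplus_ne_zero.1 hγ).resolve_left (not_not.2 hγ0)),
        gplus_ext ?_ ?_⟩
      · simp [h0, hγ0]
      · simp [h1]
    · have hγ1 : γ 1 = a * l.1 1 := by
        rw [ha] at h'
        have : l.1 0 * (a * l.1 1) = l.1 0 * γ 1 := by linarith
        exact (Nat.eq_of_mul_eq_mul_left (Nat.pos_of_ne_zero h0) this).symm
      refine ⟨a, Nat.pos_of_ne_zero fun h => ?_, gplus_ext ?_ ?_⟩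
      · rw [gplus_ne_zero, ha, hγ1, h] at hγ
        simp at hγ
      · simp [ha, mul_comm]
      · simp [hγ1]
  · rintro ⟨n, -, rfl⟩
    simp only [Finsupp.smul_apply, smul_eq_mul]
    push_cast
    ring

theorem exists_ray {γ : GPlus} (hγ : γ ≠ 0) : ∃ l : Ray, l.Mem γ := by
  have hg : 0 < Nat.gcd (γ 0) (γ 1) := by
    rw [gplus_ne_zero] at hγ
    rcases hγ with h | h
    · exact Nat.gcd_pos_of_pos_left _ (Nat.pos_of_ne_zero h)
    · exact Nat.gcd_pos_of_pos_right _ (Nat.pos_of_ne_zero h)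
  refine ⟨⟨Finsupp.equivFunOnFinite.symm ![γ 0 / Nat.gcd (γ 0) (γ 1), γ 1 / Nat.gcd (γ 0) (γ 1)],
    Nat.coprime_div_gcd_div_gcd hg⟩, Nat.gcd (γ 0) (γ 1), hg, gplus_ext ?_ ?_⟩
  · simp [Nat.mul_div_cancel' (Nat.gcd_dvd_left (γ 0) (γ 1))]
  · simp [Nat.mul_div_cancel' (Nat.gcd_dvd_right (γ 0) (γ 1))]

theorem Ray.eq_of_mem {l l' : Ray} {γ : GPlus} (h : l.Mem γ) (h' : l'.Mem γ) : l = l' := by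
  obtain ⟨n, hn, rfl⟩ := h
  obtain ⟨n', hn', h'⟩ := h'
  have h0 := DFunLike.congr_fun h' 0
  have h1 := DFunLike.congr_fun h' 1
  simp only [Finsupp.smul_apply, smul_eq_mul] at h0 h1
  have hnn : n = n' := by
    have := congrArg₂ Nat.gcd h0 h1
    rwa [Nat.gcd_mul_left, Nat.gcd_mul_left, l.2, l'.2, mul_one, mul_one] at this
  subst hnn
  exact Subtype.ext (gplus_ext (Nat.eq_of_mul_eq_mul_left hn h0) (Nat.eq_of_mul_eq_mul_left hn h1))

/-- This is the order condition of the Harder–Narasimhan product, for decreasing slopes. -/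
theorem rayCross_pos_of_slopeLT {l l' : Ray} (h : l'.slopeLT l) {γ : GPlus} (hγ : γ ≠ 0)
    (h' : 0 ≤ rayCross l' γ) : 0 < rayCross l γ := by
  rw [rayCross_apply] at h' ⊢
  have h : (l'.1 1 : ℤ) * l.1 0 < l.1 1 * l'.1 0 := by exact_mod_cast h
  rw [gplus_ne_zero] at hγ
  have p1 : (0 : ℤ) ≤ l.1 0 := Int.natCast_nonneg _
  have p2 : (0 : ℤ) ≤ l.1 1 := Int.natCast_nonneg _
  have p3 : (0 : ℤ) ≤ l'.1 0 := Int.natCast_nonneg _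
  have p4 : (0 : ℤ) ≤ l'.1 1 := Int.natCast_nonneg _
  have hl : (0 : ℤ) < l'.1 0 := by
    refine lt_of_le_of_ne p3 fun h0 => ?_
    rw [← h0] at h
    nlinarith
  have hγ0 : (0 : ℤ) < γ 0 := by
    by_contra! hcon
    have h00 : γ 0 = 0 := by omega
    have h1 : (0 : ℤ) < γ 1 := by omega
    rw [h00] at h'
    push_cast at h'
    nlinarith
  refine pos_of_mul_pos_left (b := (l'.1 0 : ℤ)) ?_ p3
  nlinarith [mul_lt_mul_of_pos_left h hγ0, mul_nonneg h' p1]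

theorem rayCross_neg_of_slopeLT {l l' : Ray} (h : l.slopeLT l') {γ : GPlus} (hγ : γ ≠ 0)
    (h' : rayCross l' γ ≤ 0) : rayCross l γ < 0 := by
  by_contra! hcon
  exact absurd (rayCross_pos_of_slopeLT h hγ hcon) (not_lt.2 h')

/-- The ratio `l₁ / (l₀ + l₁)`, a strictly monotone function of the slope. -/
def raySlope (l : Ray) : ℚ := (l.1 1 : ℚ) / (l.1 0 + l.1 1 : ℕ)

theorem ray_sum_pos (l : Ray) : 0 < l.1 0 + l.1 1 := by
  refine Nat.pos_of_ne_zero fun h => ?_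
  have := l.2
  rw [(Nat.add_eq_zero_iff.1 h).1, (Nat.add_eq_zero_iff.1 h).2] at this
  simp at this

theorem raySlope_lt_iff (l l' : Ray) : raySlope l < raySlope l' ↔ l.slopeLT l' := by
  rw [raySlope, raySlope, div_lt_div_iff₀ (Nat.cast_pos.2 (ray_sum_pos l))
    (Nat.cast_pos.2 (ray_sum_pos l')), Ray.slopeLT]
  norm_cast
  rw [mul_add, mul_add, mul_comm (l.1 1) (l'.1 1), add_lt_add_iff_right]

theorem raySlope_injective : Function.Injective raySlope := by
  intro l l' h
  have h1 := (raySlope_lt_iff l l').not.1 h.not_lt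
  have h2 := (raySlope_lt_iff l' l).not.1 h.not_gt
  rw [Ray.slopeLT, not_lt] at h1 h2
  have hl : l.Mem l.1 := ⟨1, one_pos, (one_smul _ _).symm⟩
  refine Ray.eq_of_mem hl ((rayCross_eq_zero_iff hl.ne_zero).1 ?_)
  rw [rayCross_apply]
  have := h1.antisymm h2
  have h3 : (l.1 1 : ℤ) * l'.1 0 = l'.1 1 * l.1 0 := by exact_mod_cast this.symm
  linarith

theorem exists_sorted_rays (S : Finset Ray) :
    ∃ L : List Ray, L.Pairwise (fun l l' => l.slopeLT l') ∧ ∀ l ∈ S, l ∈ L := by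
  let := LinearOrder.lift' raySlope raySlope_injective
  refine ⟨S.sort, ?_, fun l hl => (Finset.mem_sort _).2 hl⟩
  exact S.sortedLT_sort.pairwise.imp fun h => (raySlope_lt_iff _ _).1 h

theorem exists_sorted_rays' (S : Finset Ray) :
    ∃ L : List Ray, L.Pairwise (fun l l' => l'.slopeLT l) ∧ ∀ l ∈ S, l ∈ L := by
  obtain ⟨L, h, hS⟩ := exists_sorted_rays S
  exact ⟨L.reverse, List.pairwise_reverse.2 h, fun l hl => List.mem_reverse.2 (hS l hl)⟩

/-! ### Uniqueness of the ordered factorization -/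

theorem HasOrderedProd.unique {ω : GPlus →+ GPlus →+ ℤ} {before : Ray → Ray → Prop}
    (hb : ∀ S : Finset Ray, ∃ L : List Ray, L.Pairwise before ∧ ∀ l ∈ S, l ∈ L)
    {F : Ray → QTorus sqrtQ ω} {P P' : QTorus sqrtQ ω} (h : HasOrderedProd before F P)
    (h' : HasOrderedProd before F P') : P = P' := by
  classical
  ext γ
  obtain ⟨S, hS⟩ := h γ
  obtain ⟨S', hS'⟩ := h' γ
  obtain ⟨L, hL, hSL⟩ := hb (S ∪ S')
  rw [← hS L hL fun l hl => hSL l (Finset.mem_union_left _ hl),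
    ← hS' L hL fun l hl => hSL l (Finset.mem_union_right _ hl)]

theorem gmVir_ne_zero : gmVir ≠ 0 := by
  intro h
  rw [gmVir, sub_eq_zero] at h
  have h1 : (RatFunc.X : RatFunc ℚ) * RatFunc.X = 1 :=
    (congrArg (· * HalfField.t) h).trans (inv_mul_cancel₀ HalfField.t_ne_zero)
  rw [← RatFunc.algebraMap_X, ← map_mul, ← map_one (algebraMap ℚ[X] (RatFunc ℚ))] at h1
  have h2 := RatFunc.algebraMap_injective ℚ h1
  have h3 := congrArg (Polynomial.eval 0) h2
  simp at h3

open Classical in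
/-- The logarithm of `rayExp`. -/
noncomputable def rayLog (ω : GPlus →+ GPlus →+ ℤ) (a : GStar → MotV) (l : Ray) :
    QTorus sqrtQ ω :=
  ⟨fun γ => if h : γ ≠ 0 ∧ l.Mem γ then gmVir⁻¹ • a ⟨γ, h.1⟩ else 0⟩

theorem rayExp_eq_exp_rayLog (ω : GPlus →+ GPlus →+ ℤ) (a : GStar → MotV) (l : Ray) :
    rayExp ω a l = QTorus.exp (rayLog ω a l) := rfl

theorem coeff_rayLog_zero (ω : GPlus →+ GPlus →+ ℤ) (a : GStar → MotV) (l : Ray) :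
    (rayLog ω a l).coeff 0 = 0 := by
  simp [rayLog]

theorem coeff_rayExp_zero (ω : GPlus →+ GPlus →+ ℤ) (a : GStar → MotV) (l : Ray) :
    (rayExp ω a l).coeff 0 = 1 :=
  QTorus.coeff_exp_zero (coeff_rayLog_zero ω a l)

open Classical in
theorem coeff_rayExp_sub (ω : GPlus →+ GPlus →+ ℤ) (a b : GStar → MotV) (l : Ray) (γ : GStar)
    (h : ∀ δ : GStar, δ.1 < γ.1 → a δ = b δ) :
    (rayExp ω a l).coeff γ.1 - (rayExp ω b l).coeff γ.1 =
      if l.Mem γ.1 then gmVir⁻¹ • (a γ - b γ) else 0 := by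
  rw [rayExp_eq_exp_rayLog, rayExp_eq_exp_rayLog,
    QTorus.coeff_exp_sub (coeff_rayLog_zero ω a l) γ.2, rayLog, rayLog]
  · by_cases hl : l.Mem γ.1
    · simp only [hl, γ.2, ne_eq, not_false_eq_true, and_self, dif_pos, if_true, smul_sub]
    · simp [hl]
  · intro δ hδ
    by_cases hl : δ ≠ 0 ∧ l.Mem δ
    · simp only [rayLog, dif_pos hl, h ⟨δ, hl.1⟩ hδ]
    · simp only [rayLog, dif_neg hl]

theorem coeff_rayExp_congr (ω : GPlus →+ GPlus →+ ℤ) {a b : GStar → MotV} (l : Ray) {γ : GPlus}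
    (h : ∀ δ : GStar, δ.1 ≤ γ → a δ = b δ) :
    (rayExp ω a l).coeff γ = (rayExp ω b l).coeff γ := by
  refine QTorus.coeff_exp_congr fun δ hδ => ?_
  by_cases hl : δ ≠ 0 ∧ l.Mem δ
  · simp only [dif_pos hl, h ⟨δ, hl.1⟩ hδ]
  · simp only [dif_neg hl]

/-- Induction on the degree of `γ`. If `a` and `b` agree below `γ`, the two products differ at `γ`
by the sum over rays of the differences of the exponents; only the ray of `γ` contributes, with `(a
γ - b γ) / (q^{1/2} - q^{-1/2})`. -/
theorem rayExp_factorization_unique (ω : GPlus →+ GPlus →+ ℤ) {before : Ray → Ray → Prop}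
    (hb : ∀ S : Finset Ray, ∃ L : List Ray, L.Pairwise before ∧ ∀ l ∈ S, l ∈ L)
    (hirr : ∀ l, ¬ before l l) {a b : GStar → MotV} {P : QTorus sqrtQ ω}
    (ha : HasOrderedProd before (rayExp ω a) P) (hb' : HasOrderedProd before (rayExp ω b) P) :
    a = b := by
  classical
  have key : ∀ n : ℕ, ∀ γ : GStar, γ.1.degree < n → a γ = b γ := by
    intro n
    induction n with
    | zero => exact fun γ h => (Nat.not_lt_zero _ h).elim
    | succ n ih =>
      intro γ hγ
      have hlt : ∀ δ : GStar, δ.1 < γ.1 → a δ = b δ := fun δ hδ => ih δ (by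
        obtain ⟨ε, hε⟩ := exists_add_of_le hδ.le
        have hne : ε ≠ 0 := fun h0 => hδ.ne (by rw [hε, h0, add_zero])
        have := (Finsupp.degree_eq_zero_iff ε).not.2 hne
        rw [hε, map_add] at hγ
        omega)
      obtain ⟨S, hS⟩ := ha γ.1
      obtain ⟨S', hS'⟩ := hb' γ.1
      obtain ⟨l, hl⟩ := exists_ray γ.2
      obtain ⟨L, hL, hSL⟩ := hb (insert l (S ∪ S'))
      have h1 := QTorus.coeff_list_prod_sub γ.2 (coeff_rayExp_zero ω a)
        (fun l δ hδ => coeff_rayExp_congr ω l fun ε hε => hlt ε (hε.trans_lt hδ)) L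
        (F' := rayExp ω b)
      rw [hS L hL fun l hl => hSL l (by simp [hl]), hS' L hL fun l hl => hSL l (by simp [hl]),
        sub_self] at h1
      simp only [coeff_rayExp_sub ω a b _ γ hlt] at h1
      -- An irreflexive order on the list excludes repetitions, so the ray of `γ` is counted exactly
      -- once.
      have hnd : L.Nodup := hL.imp fun {x y} hxy => fun hne : x = y => by
        subst hne
        exact hirr x hxy
      have hmem : ∀ l', l'.Mem γ.1 ↔ l' = l :=
        fun l' => ⟨fun h => Ray.eq_of_mem h hl, fun h => h ▸ hl⟩
      simp only [hmem] at h1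
      rw [← List.sum_toFinset _ hnd, Finset.sum_ite_eq', if_pos
        (List.mem_toFinset.2 (hSL l (Finset.mem_insert_self _ _)))] at h1
      have h2 := congrArg (gmVir • ·) h1
      simp only [smul_zero, smul_inv_smul₀ gmVir_ne_zero] at h2
      exact (sub_eq_zero.1 h2.symm)
  exact funext fun γ => key _ γ (Nat.lt_succ_self _)

/-! ### The slopes of a stability function -/

theorem HPlus.add {z w : ℂ} (hz : HPlus z) (hw : HPlus w) : HPlus (z + w) := by
  unfold HPlus at *
  rw [Complex.add_im, Complex.add_re]
  rcases hz with h | ⟨h, h'⟩ <;> rcases hw with k | ⟨k, k'⟩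
  · exact Or.inl (by linarith)
  · exact Or.inl (by linarith)
  · exact Or.inl (by linarith)
  · exact Or.inr ⟨by linarith, by linarith⟩

/-- Cross-multiplication of the fractions. It stays valid for slope `∞` because the real part is
then negative. -/
theorem zslope_le_iff {z w : ℂ} (hz : HPlus z) (hw : HPlus w) :
    zslope z ≤ zslope w ↔ w.re * z.im ≤ z.re * w.im := by
  unfold zslope
  rcases hz with h | ⟨h, h'⟩ <;> rcases hw with k | ⟨k, k'⟩
  · rw [if_neg h.ne', if_neg k.ne', WithTop.coe_le_coe, div_le_div_iff₀ h k]
    constructor <;> intro h <;> linarith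
  · rw [if_pos k, k, mul_zero]
    exact iff_of_true le_top (mul_nonpos_of_nonpos_of_nonneg k'.le h.le)
  · rw [if_pos h, if_neg k.ne', h, mul_zero]
    refine iff_of_false (by simp) (not_le.2 (mul_neg_of_neg_of_pos h' k))
  · rw [if_pos h, if_pos k, h, k, mul_zero, mul_zero]
    simp

section

variable {Z : GPlus →+ ℂ}

theorem gplus_eq (γ : GPlus) : γ = γ 0 • Finsupp.single 0 1 + γ 1 • Finsupp.single 1 1 :=
  gplus_ext (by simp) (by simp)

theorem hPlus_map (h0 : HPlus (Z (Finsupp.single 0 1))) (h1 : HPlus (Z (Finsupp.single 1 1)))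
    {γ : GPlus} (hγ : γ ≠ 0) : HPlus (Z γ) := by
  have hn : ∀ {z : ℂ}, HPlus z → ∀ {n : ℕ}, n ≠ 0 → HPlus (n • z) := by
    intro z hz n hn
    induction n with
    | zero => exact (hn rfl).elim
    | succ n ih =>
      by_cases h : n = 0
      · rw [h, zero_add, one_smul]
        exact hz
      · rw [succ_nsmul]
        exact (ih h).add hz
  rw [gplus_eq γ, map_add, map_nsmul, map_nsmul]
  by_cases h : γ 0 = 0
  · have h' := (gplus_ne_zero.1 hγ).resolve_left (not_not.2 h)
    rw [h, zero_smul, zero_add]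
    exact hn h1 h'
  · by_cases h' : γ 1 = 0
    · rw [h', zero_smul, add_zero]
      exact hn h0 h
    · exact (hn h0 h).add (hn h1 h')

/-- The cross-multiplied difference is bilinear and alternating in the two vectors, hence a multiple
of their determinant, with positive factor because the slope of `e₁` is smaller than that of `e₂`.
Comparing slopes for `Z` is thus the same as comparing them in the first quadrant. -/
theorem zslope_map_le_iff (h0 : HPlus (Z (Finsupp.single 0 1)))
    (h1 : HPlus (Z (Finsupp.single 1 1)))
    (hlt : zslope (Z (Finsupp.single 0 1)) < zslope (Z (Finsupp.single 1 1)))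
    {γ δ : GPlus} (hγ : γ ≠ 0) {l : Ray} (hδ : l.Mem δ) :
    zslope (Z γ) ≤ zslope (Z δ) ↔ 0 ≤ rayCross l γ := by
  rw [zslope_le_iff (hPlus_map h0 h1 hγ) (hPlus_map h0 h1 hδ.ne_zero)]
  rw [← not_le, zslope_le_iff h1 h0, not_le, ← sub_pos] at hlt
  obtain ⟨n, hn, rfl⟩ := hδ
  have e : ∀ γ : GPlus, Z γ = (γ 0 : ℂ) * Z (Finsupp.single 0 1) +
      (γ 1 : ℂ) * Z (Finsupp.single 1 1) := by
    intro γ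
    conv_lhs => rw [gplus_eq γ]
    rw [map_add, map_nsmul, map_nsmul, nsmul_eq_mul, nsmul_eq_mul]
  rw [e γ, e (n • l.1)]
  generalize Z (Finsupp.single 0 1) = z at *
  generalize Z (Finsupp.single 1 1) = w at *
  simp only [Finsupp.smul_apply, smul_eq_mul, Complex.add_re, Complex.add_im, Complex.mul_re,
    Complex.mul_im, Complex.natCast_re, Complex.natCast_im, zero_mul, sub_zero, add_zero]
  rw [← sub_nonneg, rayCross_apply]
  have hn' : (0 : ℝ) < n := Nat.cast_pos.2 hn
  rw [show ((γ 0 : ℝ) * z.re + γ 1 * w.re) * (((n * l.1 0 : ℕ) : ℝ) * z.im +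
      ((n * l.1 1 : ℕ) : ℝ) * w.im) - (((n * l.1 0 : ℕ) : ℝ) * z.re +
      ((n * l.1 1 : ℕ) : ℝ) * w.re) * (γ 0 * z.im + γ 1 * w.im) =
      (n * (z.re * w.im - w.re * z.im)) *
        (((γ 0 : ℤ) * l.1 1 - (γ 1 : ℤ) * l.1 0 : ℤ) : ℝ) by push_cast; ring,
    mul_nonneg_iff_of_pos_left (mul_pos hn' hlt), Int.cast_nonneg_iff]

end

/-! ### The series of the quiver `Q̂` -/

section

variable {ω : GPlus →+ GPlus →+ ℤ}

/-- Both sides are biadditive, so it suffices to compare single vertices. There the numbers of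
arrows in the two directions are the positive and negative parts of `ω α β`. -/
theorem quiverSkew_hatQuiver (hω : ∀ γ δ, ω δ γ = -ω γ δ) (m m' : GStar →₀ ℕ) :
    quiverSkew (hatQuiver ω) m m' = ω (mnorm m) (mnorm m') := by
  have h : quiverSkew (hatQuiver ω) =
      ((AddMonoidHom.compHom (M := GStar →₀ ℕ) (N := GPlus) (P := ℤ)).flip mnormHom).comp
        (ω.comp mnormHom) := by
    refine Finsupp.addHom_ext' fun α => AddMonoidHom.ext_nat ?_
    refine Finsupp.addHom_ext' fun β => AddMonoidHom.ext_nat ?_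
    have h1 : ((hatQuiver ω β α : ℕ) : ℤ) - (hatQuiver ω α β : ℕ) = ω α.1 β.1 := by
      rw [hatQuiver, hatQuiver, hω α.1 β.1]
      omega
    have h2 : ω (mnorm (Finsupp.single α 1)) (mnorm (Finsupp.single β 1)) = ω α.1 β.1 := by
      rw [mnorm_single, mnorm_single, one_smul, one_smul]
    refine Eq.trans ?_ h2.symm
    rw [← h1, ← quiverForm_single (hatQuiver ω), ← quiverForm_single (hatQuiver ω)]
    rfl
  rw [h]
  rfl

/-- The unit `q^{1/2} - q^{-1/2}` of `𝒱`. -/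
noncomputable def gmUnit : MotVˣ :=
  Units.map (algebraMap HalfField MotV).toMonoidHom (Units.mk0 gmVir gmVir_ne_zero)

theorem hnCoeff_zero {V : Type} [DecidableEq V] {R : Type*} [CommRing R] [Algebra ℚ R]
    (r : V → V → ℕ) (v u : Rˣ) (D : (V →₀ ℕ) → Prop) : hnCoeff r v u D 0 = 1 := by
  rw [hnCoeff_congr r v u D (fun _ => False) 0, hnCoeff_false, if_pos rfl]
  intro m' hm' h0
  exact (h0 (nonpos_iff_eq_zero.1 hm')).elim

theorem card_stdVertex {V : Type} (m : V →₀ ℕ) : Fintype.card (StdVertex m) = m.degree := by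
  rw [Fintype.card_sigma]
  simp only [Fintype.card_fin]
  exact Finset.sum_coe_sort m.support fun i => m i

theorem card_qArrow_stdVertex {V : Type} (r : V → V → ℕ) (m : V →₀ ℕ) :
    Fintype.card (QArrow fun x y : StdVertex m => r x.1 y.1) = quiverForm r m m := by
  classical
  have h := quiverForm_dimVec r (fun x : StdVertex m => (x.1 : V)) Finset.univ Finset.univ
  rw [dimVec_stdVertex, Finset.univ_product_univ] at h
  rw [h, Fintype.card_sigma]
  simp only [Fintype.card_fin]

/-- Identifies the geometric invariant with the combinatorial coefficient, once the slope inequality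
is rewritten as a condition on dimension vectors. -/
theorem fDim_eq {V : Type} [DecidableEq V] (r : V → V → ℕ) (ζ : V → ℂ) (m : V →₀ ℕ)
    (D : (V →₀ ℕ) → Prop)
    (hD : ∀ T : Finset (StdVertex m), T.Nonempty →
      (zslope (∑ i ∈ T, ζ i.1) ≤ zslope (∑ i : StdVertex m, ζ i.1) ↔
        D (dimVec (fun x : StdVertex m => (x.1 : V)) T))) :
    ((dimFact m : ℚ)⁻¹) • fDim r ζ m = hnCoeff r sqrtQ gmUnit D m := by
  classical
  rw [hnCoeff, fDim, fAbelian_eq]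
  congr 1
  have hsum : (∑ E : Finset (StdVertex m × StdVertex m), if (∀ T : Finset (StdVertex m),
      T.Nonempty → IsClosedUnder E T → zslope (∑ i ∈ T, ζ i.1) ≤ zslope (∑ i : StdVertex m, ζ i.1)) then
        ∏ p ∈ E, ((HalfField.t ^ 2) ^ r p.1.1 p.2.1 - 1) else 0) =
      repSum (fun p : StdVertex m × StdVertex m => (HalfField.t ^ 2) ^ r p.1.1 p.2.1 - 1)
        (fun T => D (dimVec (fun x : StdVertex m => (x.1 : V)) T)) Finset.univ := by
    rw [repSum, Finset.univ_product_univ, Finset.powerset_univ, Finset.sum_filter]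
    refine Finset.sum_congr rfl fun E _ => ?_
    congr 1
    refine propext (forall_congr' fun T => ?_)
    rw [forall_prop_of_true (Finset.subset_univ T)]
    exact forall_congr' fun hT => forall_congr' fun _ => hD T hT
  have hmap : algebraMap HalfField MotV
      (repSum (fun p : StdVertex m × StdVertex m => (HalfField.t ^ 2) ^ r p.1.1 p.2.1 - 1)
        (fun T => D (dimVec (fun x : StdVertex m => (x.1 : V)) T)) Finset.univ) =
      dimSum (arrowWeight r sqrtQ) D m := by
    rw [dimSum, labSum, repSum, repSum, map_sum]
    refine Finset.sum_congr (by congr) fun E _ => ?_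
    rw [map_prod]
    refine Finset.prod_congr rfl fun p _ => ?_
    rw [arrowWeight, map_sub, map_pow, map_pow, map_one]
    rfl
  rw [map_mul, ← hmap, card_stdVertex, card_qArrow_stdVertex]
  congr 1
  · have hne : HalfField.t ^ 2 - 1 = gmVir * HalfField.t := by
      rw [gmVir, sub_mul, inv_mul_cancel₀ HalfField.t_ne_zero, pow_two]
    have hpre : HalfField.t ^ ((m.degree : ℤ) - (quiverForm r m m : ℤ)) *
        ((HalfField.t ^ 2 - 1) ^ m.degree)⁻¹ =
        gmVir ^ (-(m.degree : ℤ)) * HalfField.t ^ (-(quiverForm r m m : ℤ)) := by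
      rw [hne, mul_pow, mul_inv, sub_eq_add_neg, zpow_add₀ HalfField.t_ne_zero, zpow_neg gmVir,
        zpow_natCast, zpow_natCast]
      have := pow_ne_zero m.degree HalfField.t_ne_zero
      field_simp
    rw [hpre, sqrtQ, gmUnit, ← map_zpow, ← map_zpow, ← map_mul]
    simp only [zpow_neg, zpow_natCast, ← inv_pow, map_mul, map_pow]
    rfl
  · refine congrArg (algebraMap HalfField MotV) ?_
    convert hsum

end

/-! ### Semistable series for `Z` and for the opposite stability. -/

section

variable {ω : GPlus →+ GPlus →+ ℤ}

theorem mnorm_dimVec {U : Type*} (lab : U → GStar) (X : Finset U) :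
    mnorm (dimVec lab X) = ∑ u ∈ X, (lab u).1 := by
  refine (map_dimVec mnormHom lab X).trans (Finset.sum_congr rfl fun u _ => ?_)
  rw [mnormHom_apply, mnorm_single, one_smul]

-- The zero vector lies on no ray although every `rayCross` vanishes on it; this is the separate
-- summand `1`.
open Classical in
theorem hnFactor_eq_one_add {Z : GPlus →+ ℂ} (h0 : HPlus (Z (Finsupp.single 0 1)))
    (h1 : HPlus (Z (Finsupp.single 1 1)))
    (hlt : zslope (Z (Finsupp.single 0 1)) < zslope (Z (Finsupp.single 1 1))) (l : Ray) :
    hnFactor (hatQuiver ω) sqrtQ gmUnit ((rayCross l).comp mnormHom) =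
      1 + ⟨fun m => if l.Mem (mnorm m) then
        ((mfact m : ℚ)⁻¹) • fDim (hatQuiver ω) (fun α => Z α.1) m else 0⟩ := by
  ext m
  rw [QTorus.coeff_add, QTorus.coeff_one, hnFactor]
  by_cases hm : m = 0
  · subst hm
    have : ¬ l.Mem (mnorm 0) := fun h => h.ne_zero mnorm_zero
    dsimp only
    rw [if_pos rfl, if_neg this, if_pos (map_zero _), hnCoeff_zero, add_zero]
  · have hm' : mnorm m ≠ 0 := fun h => hm (mnorm_eq_zero.1 h)
    simp only [AddMonoidHom.comp_apply, mnormHom_apply, rayCross_eq_zero_iff hm', if_neg hm,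
      zero_add]
    split_ifs with hl
    · refine (fDim_eq (hatQuiver ω) _ m (fun m => 0 ≤ rayCross l (mnorm m)) fun T hT => ?_).symm
      have hZ : ∀ X : Finset (StdVertex m), ∑ i ∈ X, Z (i.1 : GStar).1 =
          Z (mnorm (dimVec (fun x : StdVertex m => (x.1 : GStar)) X)) := fun X => by
        rw [mnorm_dimVec, map_sum]
      have hZ' := hZ Finset.univ
      rw [dimVec_stdVertex] at hZ'
      rw [hZ, hZ']
      refine zslope_map_le_iff h0 h1 hlt (fun h => ?_) hl
      rw [mnorm_eq_zero, dimVec_eq_zero] at h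
      exact hT.ne_empty h
    · rfl

/-- All vectors in the support of `m` lie on the ray `l`. -/
def SupportedOn (l : Ray) (m : GStar →₀ ℕ) : Prop := ∀ α ∈ m.support, l.Mem α.1

theorem SupportedOn.rayCross_eq_zero {l : Ray} {m : GStar →₀ ℕ} (h : SupportedOn l m) :
    rayCross l (mnorm m) = 0 := by
  rw [mnorm, map_finsuppSum]
  refine Finset.sum_eq_zero fun α hα => ?_
  change rayCross l (m α • α.1) = 0
  rw [map_nsmul, (rayCross_eq_zero_iff α.2).2 (h α hα), smul_zero]

theorem SupportedOn.mono {l : Ray} {m m' : GStar →₀ ℕ} (h : SupportedOn l m') (hm : m ≤ m') :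
    SupportedOn l m := fun α hα => h α (Finsupp.support_mono hm hα)

/-- The form `ω` is a positive multiple of the determinant. -/
def IsPosMulDet (ω : GPlus →+ GPlus →+ ℤ) : Prop :=
  ∃ κ : ℤ, 0 < κ ∧ ∀ γ δ : GPlus, ω γ δ = κ * ((γ 0 : ℤ) * δ 1 - γ 1 * δ 0)

theorem hatQuiver_eq_zero (hω : IsPosMulDet ω) {l : Ray} {α β : GStar} (hα : l.Mem α.1)
    (hβ : l.Mem β.1) : hatQuiver ω α β = 0 := by
  obtain ⟨κ, -, h⟩ := hω
  obtain ⟨n, -, hn⟩ := hα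
  obtain ⟨n', -, hn'⟩ := hβ
  rw [hatQuiver, h, hn, hn']
  simp only [Finsupp.smul_apply, smul_eq_mul]
  push_cast
  rw [Int.toNat_eq_zero]
  apply le_of_eq
  ring

/-- Arrows of `Q̂` lead to strictly smaller slope, so the vertices of slope below `l` are closed
under arrows. -/
theorem rayCross_pos_of_hatQuiver (hω : IsPosMulDet ω) {l : Ray} {α β : GStar}
    (h : hatQuiver ω α β ≠ 0) (hα : 0 < rayCross l α.1) : 0 < rayCross l β.1 := by
  obtain ⟨κ, hκ, hω⟩ := hω
  rw [hatQuiver, hω, Ne, Int.toNat_eq_zero, not_le] at h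
  have h := pos_of_mul_pos_right h hκ.le
  rw [rayCross_apply] at hα ⊢
  have p1 : (0 : ℤ) ≤ α.1 0 := Int.natCast_nonneg _
  have p2 : (0 : ℤ) ≤ α.1 1 := Int.natCast_nonneg _
  have p3 : (0 : ℤ) ≤ β.1 1 := Int.natCast_nonneg _
  have p4 : (0 : ℤ) ≤ l.1 0 := Int.natCast_nonneg _
  have hβ0 : (0 : ℤ) < β.1 0 := by
    refine lt_of_le_of_ne (Int.natCast_nonneg _) fun h0 => ?_
    rw [← h0] at h
    nlinarith
  refine pos_of_mul_pos_left (b := (α.1 0 : ℤ)) ?_ p1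
  nlinarith [mul_pos hβ0 hα, mul_nonneg p4 h.le]

theorem quiverForm_eq_zero (hω : IsPosMulDet ω) {l : Ray} {m m' : GStar →₀ ℕ}
    (h : SupportedOn l m) (h' : SupportedOn l m') : quiverForm (hatQuiver ω) m m' = 0 :=
  Finset.sum_eq_zero fun α hα => Finset.sum_eq_zero fun β hβ => by
    change m α * m' β * hatQuiver ω α β = 0
    rw [hatQuiver_eq_zero hω (h α hα) (h' β hβ), mul_zero]

open Classical in
/-- For the opposite stability the semistable representations are those supported on a ray. -/
theorem dimSum_neg_rayCross {R : Type*} [CommRing R] (v : Rˣ) (hω : IsPosMulDet ω) (l : Ray)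
    (m : GStar →₀ ℕ) (hm : rayCross l (mnorm m) = 0) :
    dimSum (arrowWeight (hatQuiver ω) v) (fun m => 0 ≤ (-(rayCross l).comp mnormHom) m) m =
      if SupportedOn l m then 1 else 0 := by
  have hlab : ∀ x : StdVertex m, (x.1 : GStar) ∈ m.support := fun x => x.1.2
  have hw : ∀ α β : GStar, hatQuiver ω α β = 0 → arrowWeight (hatQuiver ω) v α β = 0 := by
    intro α β h
    rw [arrowWeight, h, pow_zero, sub_self]
  rw [dimSum, labSum, repSum]
  split_ifs with hl
  -- Between vectors on one ray there are no arrows, so every pair has weight `q^0 - 1 = 0` and only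
  -- the empty relation counts.
  · rw [Finset.sum_eq_single ∅, Finset.prod_empty]
    · intro E _ hE
      obtain ⟨p, hp⟩ := Finset.nonempty_iff_ne_empty.2 hE
      exact Finset.prod_eq_zero hp
        (hw _ _ (hatQuiver_eq_zero hω (hl _ (hlab p.1)) (hl _ (hlab p.2))))
    · intro h
      refine (h (Finset.mem_filter.2 ⟨Finset.empty_mem_powerset _, fun T _ _ _ => ?_⟩)).elim
      have hT : dimVec (fun x : StdVertex m => (x.1 : GStar)) T ≤ m := by
        conv_rhs => rw [← dimVec_stdVertex m]
        exact dimVec_mono _ (Finset.subset_univ T)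
      have := (hl.mono hT).rayCross_eq_zero
      simp [this]
  · refine Finset.sum_eq_zero fun E hE => ?_
    by_contra hne
    rw [Finset.mem_filter] at hE
    have hpos : ∀ p ∈ E, hatQuiver ω p.1.1 p.2.1 ≠ 0 := fun p hp h =>
      hne (Finset.prod_eq_zero hp (hw _ _ h))
    -- The vertices of slope below `l` form a destabilizing subrepresentation. It is nonempty:
    -- otherwise all values of `rayCross l` are nonpositive with sum zero, hence zero, and `m` is
    -- supported on `l`.
    let T : Finset (StdVertex m) := Finset.univ.filter fun x => 0 < rayCross l (x.1 : GStar).1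
    have hsum : ∑ x : StdVertex m, rayCross l (x.1 : GStar).1 = 0 := by
      rw [← map_sum, ← mnorm_dimVec (fun x : StdVertex m => (x.1 : GStar)), dimVec_stdVertex, hm]
    have hT : T.Nonempty := by
      by_contra hemp
      rw [Finset.not_nonempty_iff_eq_empty, Finset.filter_eq_empty_iff] at hemp
      have hall := (Finset.sum_eq_zero_iff_of_nonpos
        (fun x _ => not_lt.1 (hemp (Finset.mem_univ x)))).1 hsum
      refine hl fun α hα => (rayCross_eq_zero_iff α.2).1 ?_
      have hα' : 0 < m α := Nat.pos_of_ne_zero (Finsupp.mem_support_iff.1 hα)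
      exact hall ⟨⟨α, hα⟩, ⟨0, hα'⟩⟩ (Finset.mem_univ _)
    have hTcl : IsClosedUnder E T := fun p hp hp1 => Finset.mem_filter.2 ⟨Finset.mem_univ _,
      rayCross_pos_of_hatQuiver hω (hpos p hp) (Finset.mem_filter.1 hp1).2⟩
    have h1 : 0 ≤ (-(rayCross l).comp mnormHom)
        (dimVec (fun x : StdVertex m => (x.1 : GStar)) T) := hE.2 T (Finset.subset_univ T) hT hTcl
    rw [AddMonoidHom.neg_apply, AddMonoidHom.comp_apply, mnormHom_apply, mnorm_dimVec, map_sum] at h1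
    have h2 : 0 < ∑ x ∈ T, rayCross l (x.1 : GStar).1 :=
      Finset.sum_pos (fun x hx => (Finset.mem_filter.1 hx).2) hT
    omega

open Classical in
theorem coeff_hnFactor_neg_rayCross {R : Type*} [CommRing R] [Algebra ℚ R] (v u : Rˣ)
    (hω : IsPosMulDet ω) (l : Ray) (m : GStar →₀ ℕ) :
    (hnFactor (hatQuiver ω) v u (-(rayCross l).comp mnormHom)).coeff m =
      if SupportedOn l m then ((dimFact m : ℚ)⁻¹) • ((u⁻¹ : Rˣ) : R) ^ m.degree else 0 := by
  rw [hnFactor]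
  dsimp only
  by_cases hl : SupportedOn l m
  · have h0 := hl.rayCross_eq_zero
    rw [if_pos (by simp [h0]), if_pos hl, hnCoeff, dimSum_neg_rayCross v hω l m h0, if_pos hl,
      quiverForm_eq_zero hω hl hl]
    simp
  · rw [if_neg hl]
    split_ifs with h
    · have h0 : rayCross l (mnorm m) = 0 := by simpa using h
      rw [hnCoeff, dimSum_neg_rayCross v hω l m h0, if_neg hl, mul_zero, smul_zero]
    · rfl

end

/-! ### Exponential of a sum of commuting vertex variables. -/

namespace QTorus

section

variable {V : Type*} [DecidableEq V] {R : Type*} [CommRing R] {v : Rˣ}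
  {ω : (V →₀ ℕ) →+ (V →₀ ℕ) →+ ℤ}

open Classical in
/-- The series `∑ c x_i`, where the sum is over the vertices `i` with the property `S`. -/
noncomputable def vertexSum (v : Rˣ) (ω : (V →₀ ℕ) →+ (V →₀ ℕ) →+ ℤ) (S : V → Prop) (c : R) :
    QTorus v ω :=
  ⟨fun m => if ∃ i, S i ∧ m = Finsupp.single i 1 then c else 0⟩

theorem coeff_vertexSum_zero (S : V → Prop) (c : R) : (vertexSum v ω S c).coeff 0 = 0 :=
  if_neg fun ⟨_, _, h⟩ => Finsupp.single_ne_zero.2 one_ne_zero h.symm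

open Classical in
theorem coeff_vertexSum_mul (S : V → Prop) (c : R) (B : QTorus v ω) (m : V →₀ ℕ) :
    (vertexSum v ω S c * B).coeff m = ∑ i ∈ m.support, if S i then
      ((v ^ ω (Finsupp.single i 1) (m - Finsupp.single i 1) : Rˣ) : R) *
        (c * B.coeff (m - Finsupp.single i 1)) else 0 := by
  rw [coeff_mul]
  symm
  refine Finset.sum_of_injOn (fun i => (Finsupp.single i 1, m - Finsupp.single i 1)) ?_ ?_ ?_ ?_
  · intro i _ j _ h
    exact Finsupp.single_left_injective one_ne_zero (Prod.mk.inj h).1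
  · intro i hi
    rw [Finset.mem_coe, mem_antidiagonal]
    dsimp only
    rw [add_comm, sub_add_single (Finsupp.mem_support_iff.1 hi)]
  · intro p hp hne
    rw [vertexSum]
    dsimp only
    rw [if_neg, zero_mul, mul_zero]
    rintro ⟨i, -, hi⟩
    rw [mem_antidiagonal] at hp
    refine hne ⟨i, ?_, ?_⟩
    · rw [Finset.mem_coe, Finsupp.mem_support_iff, ← hp, hi]
      simp
    · refine Prod.ext hi.symm ?_
      dsimp only
      rw [← hp, hi, add_tsub_cancel_left]
  · intro i _
    rw [vertexSum]
    dsimp only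
    split_ifs with h1 h2 h2
    · rfl
    · exact (h2 ⟨i, h1, rfl⟩).elim
    · obtain ⟨j, hj, hij⟩ := h2
      exact (h1 (Finsupp.single_left_injective one_ne_zero hij ▸ hj)).elim
    · rw [zero_mul, mul_zero]

-- The multinomial theorem: on the vertices with property `S` the twist is trivial. In the induction
-- step, the sum of the `m i` over the support is `n + 1`.
open Classical in
theorem coeff_vertexSum_pow [Algebra ℚ R] (S : V → Prop) (c : R)
    (hω : ∀ i m, S i → (∀ j ∈ m.support, S j) → ω (Finsupp.single i 1) m = 0) (n : ℕ)
    (m : V →₀ ℕ) :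
    (vertexSum v ω S c ^ n).coeff m = if m.degree = n ∧ ∀ i ∈ m.support, S i then
      ((n.factorial : ℚ) * (dimFact m : ℚ)⁻¹) • c ^ n else 0 := by
  induction n generalizing m with
  | zero =>
    rw [pow_zero, coeff_one]
    by_cases hm : m = 0
    · subst hm
      simp [dimFact_zero]
    · rw [if_neg hm, if_neg fun h => hm ((Finsupp.degree_eq_zero_iff m).1 h.1)]
  | succ n ih =>
    rw [pow_succ', coeff_vertexSum_mul]
    simp only [ih]
    have hsub : ∀ i ∈ m.support, m - Finsupp.single i 1 + Finsupp.single i 1 = m :=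
      fun i hi => sub_add_single (Finsupp.mem_support_iff.1 hi)
    have hdeg : ∀ i ∈ m.support, (m - Finsupp.single i 1).degree + 1 = m.degree := by
      intro i hi
      conv_rhs => rw [← hsub i hi, map_add, Finsupp.degree_single]
    split_ifs with h
    · obtain ⟨hn, hS⟩ := h
      have hS' : ∀ i, ∀ j ∈ (m - Finsupp.single i 1).support, S j := fun i j hj =>
        hS j (Finsupp.support_mono tsub_le_self hj)
      have hterm : ∀ i ∈ m.support, (if S i then
          ((v ^ ω (Finsupp.single i 1) (m - Finsupp.single i 1) : Rˣ) : R) *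
          (c * if (m - Finsupp.single i 1).degree = n ∧
            ∀ j ∈ (m - Finsupp.single i 1).support, S j then
          ((n.factorial : ℚ) * (dimFact (m - Finsupp.single i 1) : ℚ)⁻¹) • c ^ n else 0) else 0) =
          ((m i : ℚ) * ((n.factorial : ℚ) * (dimFact m : ℚ)⁻¹)) • c ^ (n + 1) := by
        intro i hi
        have hd := hdeg i hi
        rw [if_pos (hS i hi), if_pos ⟨by omega, hS' i⟩, hω i _ (hS i hi) (hS' i), zpow_zero,
          Units.val_one, one_mul, mul_smul_comm, ← pow_succ']
        congr 1
        have hf := dimFact_add_single (m - Finsupp.single i 1) i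
        have hmi : m i ≠ 0 := Finsupp.mem_support_iff.1 hi
        rw [hsub i hi, Finsupp.tsub_apply, Finsupp.single_eq_same,
          Nat.sub_add_cancel (Nat.pos_of_ne_zero hmi)] at hf
        have hmi' : (m i : ℚ) ≠ 0 := Nat.cast_ne_zero.2 hmi
        rw [hf, Nat.cast_mul, mul_inv, mul_left_comm, mul_inv_cancel_left₀ hmi']
      rw [Finset.sum_congr rfl hterm, ← Finset.sum_smul, ← Finset.sum_mul, ← Nat.cast_sum]
      have : ∑ i ∈ m.support, m i = n + 1 := hn
      rw [this, Nat.factorial_succ, Nat.cast_mul, mul_assoc]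
    · refine Finset.sum_eq_zero fun i hi => ?_
      split_ifs with hi' h'
      · refine (h ⟨by rw [← hdeg i hi, h'.1], fun j hj => ?_⟩).elim
        rw [← hsub i hi] at hj
        rcases Finset.mem_union.1 (Finsupp.support_add hj) with hj | hj
        · exact h'.2 j hj
        · rwa [Finset.mem_singleton.1 (Finsupp.support_single_subset hj)]
      · rw [mul_zero, mul_zero]
      · rfl

open Classical in
theorem coeff_exp_vertexSum [Algebra ℚ R] (S : V → Prop) (c : R)
    (hω : ∀ i m, S i → (∀ j ∈ m.support, S j) → ω (Finsupp.single i 1) m = 0) (m : V →₀ ℕ) :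
    (exp (vertexSum v ω S c)).coeff m = if ∀ i ∈ m.support, S i then
      ((dimFact m : ℚ)⁻¹) • c ^ m.degree else 0 := by
  rw [coeff_exp (coeff_vertexSum_zero S c) (Nat.lt_succ_self _),
    Finset.sum_eq_single m.degree]
  · rw [coeff_vertexSum_pow S c hω]
    split_ifs with h h' h'
    · rw [smul_smul, inv_mul_cancel_left₀ (Nat.cast_ne_zero.2 (Nat.factorial_ne_zero _))]
    · exact (h' h.2).elim
    · exact (h ⟨rfl, h'⟩).elim
    · rw [smul_zero]
  · intro n _ hn
    rw [coeff_vertexSum_pow S c hω, if_neg fun h => hn h.1.symm, smul_zero]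
  · exact fun h => (h (Finset.self_mem_range_succ _)).elim

end

end QTorus

/-- Without arrows on the ray, the coefficients `u^{-|m|} / m!` of the semistable series are those
of the exponential of `∑ u⁻¹ x_α`. -/
theorem hnFactor_eq_exp_vertexSum {R : Type*} [CommRing R] [Algebra ℚ R]
    {ω : GPlus →+ GPlus →+ ℤ} (v u : Rˣ) (hω : IsPosMulDet ω) (l : Ray) :
    hnFactor (hatQuiver ω) v u (-(rayCross l).comp mnormHom) =
      QTorus.exp (QTorus.vertexSum v _ (fun α => l.Mem α.1) ((u⁻¹ : Rˣ) : R)) := by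
  classical
  ext m
  rw [coeff_hnFactor_neg_rayCross v u hω, QTorus.coeff_exp_vertexSum]
  · exact if_congr Iff.rfl rfl rfl
  · intro α m hα hm
    have h1 : SupportedOn l (Finsupp.single α 1) := fun β hβ => by
      rwa [Finset.mem_singleton.1 (Finsupp.support_single_subset hβ)]
    change (quiverForm (hatQuiver ω) m (Finsupp.single α 1) : ℤ) -
      (quiverForm (hatQuiver ω) (Finsupp.single α 1) m : ℤ) = 0
    rw [quiverForm_eq_zero hω hm h1, quiverForm_eq_zero hω h1 hm, sub_self]

/-! ### The wall-crossing formula -/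

theorem IsPosMulDet.antisymm {ω : GPlus →+ GPlus →+ ℤ} (hω : IsPosMulDet ω) (γ δ : GPlus) :
    ω δ γ = -ω γ δ := by
  obtain ⟨κ, -, h⟩ := hω
  rw [h, h]
  ring

theorem isPosMulDet_formPlus {Γ : Type*} [AddCommGroup Γ] (e : Module.Basis (Fin 2) ℤ Γ)
    {ω : LinearMap.BilinForm ℤ Γ} (hω : ω.IsAlt) (hpos : 0 < ω (e 0) (e 1)) :
    IsPosMulDet (formPlus e ω) := by
  refine ⟨ω (e 0) (e 1), hpos, fun γ δ => ?_⟩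
  change ω (γ 0 • e 0 + γ 1 • e 1) (δ 0 • e 0 + δ 1 • e 1) = _
  simp only [map_add, LinearMap.add_apply, map_nsmul, LinearMap.smul_apply, hω.self_eq_zero,
    ← hω.neg_eq (e 0) (e 1)]
  simp only [nsmul_eq_mul, smul_neg, smul_zero]
  ring

/-- The ray of a nonzero vector. -/
noncomputable def rayOf (γ : GStar) : Ray := (exists_ray γ.2).choose

theorem mem_rayOf (γ : GStar) : (rayOf γ).Mem γ.1 := (exists_ray γ.2).choose_spec

section

variable {ω : GPlus →+ GPlus →+ ℤ}

/-- The generating series of all representations of the quiver `Q̂`. -/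
noncomputable def totalSeries (ω : GPlus →+ GPlus →+ ℤ) :
    QTorus sqrtQ (quiverSkew (hatQuiver ω)) :=
  ⟨hnCoeff (hatQuiver ω) sqrtQ gmUnit fun _ => True⟩

/-- The common source of both factorizations. For the coefficient at `γ` the rays of the vectors
below `γ` suffice: if `‖m‖ = γ` and `m' ≤ m`, then `‖m'‖ ≤ γ`. -/
theorem hasOrderedProd_pushTorus (hω : IsPosMulDet ω) (a : GStar → MotV)
    {before : Ray → Ray → Prop} (θ : Ray → GPlus →+ ℤ)
    (hθ : ∀ l l', before l l' → ∀ γ, γ ≠ 0 → 0 ≤ θ l' γ → 0 < θ l γ)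
    (hθ0 : ∀ l γ, l.Mem γ → θ l γ = 0) :
    HasOrderedProd before (fun l => pushTorus (quiverSkew_hatQuiver hω.antisymm) a
        (hnFactor (hatQuiver ω) sqrtQ gmUnit ((θ l).comp mnormHom)))
      (pushTorus (quiverSkew_hatQuiver hω.antisymm) a (totalSeries ω)) := by
  classical
  intro γ
  have hS : {α : GStar | α.1 ≤ γ}.Finite :=
    (Set.finite_Iic γ).preimage Subtype.val_injective.injOn
  refine ⟨hS.toFinset.image rayOf, fun L hL hSL => ?_⟩
  have hmap : (L.map fun l => pushTorus (quiverSkew_hatQuiver hω.antisymm) a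
        (hnFactor (hatQuiver ω) sqrtQ gmUnit ((θ l).comp mnormHom))).prod =
      pushTorus (quiverSkew_hatQuiver hω.antisymm) a
        (L.map fun l => hnFactor (hatQuiver ω) sqrtQ gmUnit ((θ l).comp mnormHom)).prod := by
    rw [map_list_prod, List.map_map]
    rfl
  rw [hmap, coeff_pushTorus, coeff_pushTorus]
  refine Finset.sum_congr rfl fun m hm => ?_
  rw [mem_normFiber] at hm
  rw [coeff_prod_hnFactor_eq_total]
  · rfl
  · exact hL.imp fun {l l'} h m' _ h0 => hθ l l' h _ (mnorm_eq_zero.not.2 h0)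
  · intro m' hm' h0
    let α : GStar := ⟨mnorm m', mnorm_eq_zero.not.2 h0⟩
    refine ⟨rayOf α, hSL _ (Finset.mem_image_of_mem _ (hS.mem_toFinset.2 ?_)),
      hθ0 _ _ (mem_rayOf α)⟩
    exact hm ▸ mnorm_mono hm'

theorem pushTorus_vertexSum (h : ∀ m m', quiverSkew (hatQuiver ω) m m' = ω (mnorm m) (mnorm m'))
    (a : GStar → MotV) (l : Ray) :
    pushTorus h a (QTorus.vertexSum sqrtQ _ (fun α => l.Mem α.1) ((gmUnit⁻¹ : MotVˣ) : MotV)) =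
      rayLog ω a l := by
  classical
  ext γ
  rw [coeff_pushTorus, rayLog]
  dsimp only [QTorus.vertexSum]
  split_ifs with hγ
  · rw [Finset.sum_eq_single (Finsupp.single ⟨γ, hγ.1⟩ 1)]
    · rw [if_pos ⟨_, hγ.2, rfl⟩, Finsupp.prod_single_index
        (h := fun α k => a α ^ k) (pow_zero _), pow_one, Algebra.smul_def]
      rfl
    · intro m hm hne
      rw [if_neg, zero_mul]
      rintro ⟨α, -, rfl⟩
      rw [mem_normFiber, mnorm_single, one_smul] at hm
      exact hne (by congr 1; exact Subtype.ext hm)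
    · intro hm
      rw [mem_normFiber, mnorm_single, one_smul] at hm
      exact (hm rfl).elim
  · refine Finset.sum_eq_zero fun m hm => ?_
    rw [if_neg, zero_mul]
    rintro ⟨α, hα, rfl⟩
    rw [mem_normFiber, mnorm_single, one_smul] at hm
    exact hγ ⟨hm ▸ α.2, hm ▸ hα⟩

/-- The opposite stability `-rayCross` reverses the order of the rays, and its semistable factors
push forward to the exponentials of `a`. -/
theorem hasOrderedProd_rayExp (hω : IsPosMulDet ω) (a : GStar → MotV) :
    HasOrderedProd (fun l l' => l.slopeLT l') (rayExp ω a)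
      (pushTorus (quiverSkew_hatQuiver hω.antisymm) a (totalSeries ω)) := by
  have h := hasOrderedProd_pushTorus hω a (before := fun l l' => l.slopeLT l')
    (fun l => -rayCross l)
    (fun l l' h γ hγ h' => neg_pos.2 (rayCross_neg_of_slopeLT h hγ (neg_nonneg.1 h')))
    (fun l γ hγ => neg_eq_zero.2 ((rayCross_eq_zero_iff hγ.ne_zero).2 hγ))
  convert h using 2 with l
  have hneg : (-rayCross l).comp mnormHom = -(rayCross l).comp mnormHom := rfl
  rw [hneg, hnFactor_eq_exp_vertexSum _ _ hω,
    pushTorus_exp _ _ (QTorus.coeff_vertexSum_zero _ _), pushTorus_vertexSum]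
  rfl

/-- The right hand side of the Manschot–Pioline–Sen formula. -/
noncomputable def mpsSum (g : (GStar →₀ ℕ) → MotV) (a : GStar → MotV) (γ : GStar) : MotV :=
  ∑ m ∈ normFiber γ.1, ((mfact m : ℚ)⁻¹) • (g m * m.prod fun α k => a α ^ k)

theorem mpsFormula_iff (g : (GStar →₀ ℕ) → MotV) (b a : GStar → MotV) :
    MPSFormula g b a ↔ b = mpsSum g a := by
  rw [MPSFormula, funext_iff]
  refine forall_congr' fun γ => ?_
  rw [finsum_mem_eq_finite_toFinset_sum _ (finite_mnorm_eq γ.1)]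
  rfl

open Classical in
theorem pushTorus_invariants
    (h : ∀ m m', quiverSkew (hatQuiver ω) m m' = ω (mnorm m) (mnorm m'))
    (g : (GStar →₀ ℕ) → MotV) (a : GStar → MotV) (l : Ray) :
    pushTorus h a (⟨fun m => if l.Mem (mnorm m) then
        ((mfact m : ℚ)⁻¹) • (gmVir⁻¹ • g m) else 0⟩ : QTorus sqrtQ _) =
      rayLog ω (mpsSum g a) l := by
  ext γ
  rw [coeff_pushTorus, rayLog]
  dsimp only
  split_ifs with hγ
  · rw [mpsSum, Finset.smul_sum]
    refine Finset.sum_congr rfl fun m hm => ?_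
    rw [mem_normFiber] at hm
    rw [if_pos (hm ▸ hγ.2)]
    simp only [Algebra.smul_def]
    ring
  · refine Finset.sum_eq_zero fun m hm => ?_
    rw [mem_normFiber] at hm
    rw [if_neg fun h => hγ ⟨hm ▸ h.ne_zero, hm ▸ h⟩, zero_mul]

/-- The same total series factored by `Z`: the defining equation of `g` turns each factor into an
exponential, and pushing forward collects the terms with `‖m‖ = γ` into the Manschot–Pioline–Sen
sum. -/
theorem hasOrderedProd_rayExp_mpsSum (hω : IsPosMulDet ω) {Z : GPlus →+ ℂ}
    (h0 : HPlus (Z (Finsupp.single 0 1))) (h1 : HPlus (Z (Finsupp.single 1 1)))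
    (hlt : zslope (Z (Finsupp.single 0 1)) < zslope (Z (Finsupp.single 1 1)))
    {g : (GStar →₀ ℕ) → MotV} (hg : IsAbelianInvariants ω Z g) (a : GStar → MotV) :
    HasOrderedProd (fun l l' => l'.slopeLT l) (rayExp ω (mpsSum g a))
      (pushTorus (quiverSkew_hatQuiver hω.antisymm) a (totalSeries ω)) := by
  have h := hasOrderedProd_pushTorus hω a (before := fun l l' => l'.slopeLT l) rayCross
    (fun l l' h γ hγ h' => rayCross_pos_of_slopeLT h hγ h')
    (fun l γ hγ => (rayCross_eq_zero_iff hγ.ne_zero).2 hγ)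
  convert h using 2 with l
  rw [hnFactor_eq_one_add h0 h1 hlt, hg l, pushTorus_exp, pushTorus_invariants]
  · rfl
  · exact if_neg fun h => h.ne_zero mnorm_zero

end

theorem mainTheorem1 {Γ : Type*} [AddCommGroup Γ] (e : Module.Basis (Fin 2) ℤ Γ)
    (ω : LinearMap.BilinForm ℤ Γ) (hω : ω.IsAlt) (hpos : 0 < ω (e 0) (e 1))
    (Z : Γ →+ ℂ) (hZ : ∀ i, HPlus (Z (e i))) (hchamber : zslope (Z (e 0)) < zslope (Z (e 1)))
    (g : (GStar →₀ ℕ) → MotV)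
    (hg : IsAbelianInvariants (formPlus e ω) (Z.comp (toLattice e)) g)
    (b a : GStar → MotV) :
    KSFormula (formPlus e ω) b a ↔ MPSFormula g b a := by
  have hdet := isPosMulDet_formPlus e hω hpos
  have e0 : (Z.comp (toLattice e)) (Finsupp.single 0 1) = Z (e 0) := by simp [toLattice]
  have e1 : (Z.comp (toLattice e)) (Finsupp.single 1 1) = Z (e 1) := by simp [toLattice]
  have hb := hasOrderedProd_rayExp_mpsSum hdet (e0 ▸ hZ 0) (e1 ▸ hZ 1)
    (by rw [e0, e1]; exact hchamber) hg a
  have ha := hasOrderedProd_rayExp hdet a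
  rw [mpsFormula_iff]
  constructor
  · rintro ⟨P, hP, hP'⟩
    -- The factorization by `a` identifies `P` with the image of the total series. Its clockwise
    -- factorizations by `b` and by the Manschot–Pioline–Sen sums must then coincide.
    rw [hP'.unique exists_sorted_rays ha] at hP
    exact rayExp_factorization_unique _ exists_sorted_rays' (fun l => Nat.lt_irrefl _) hP hb
  · rintro rfl
    exact ⟨_, hb, ha⟩
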